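/- **Consistency of the HDG scheme.** Let $d\in\{2,3\}$, let $\mathbb S$ be the space of symmetric real $d\times d$ matrices with the product $\sigma:\tau=\sum_{i,j}\sigma_{ij}\tau_{ij}$, and let $\Omega\subset\mathbb R^d$ be a polygonal/polyhedral bounded Lipschitz domain divided into two disjoint polygonal/polyhedral Lipschitz subdomains $\Omega_s,\Omega_f$ with $\overline\Omega=\overline\Omega_s\cup\overline\Omega_f$. Let $\rho|_{\Omega_s}=\rho_s>0$, $\rho|_{\Omega_f}=\rho_f>0$, $\mu_f,\lambda_f>0$; let $\mathcal A_s=\mathcal C_s^{-1}$, where $\mathcal C_s:\mathbb S\to\mathbb S$ is constant, symmetric and positive definite, and $\mathcal A_f\tau=\frac1{2\mu_f}\big(\tau-\frac{\lambda_f}{d\lambda_f+2\mu_f}(\operatorname{tr}\tau)I\big)$. Write $(\cdot,\cdot)_D$ for the $L^2(D)$ product, $\mathbf{div}$ for the row-wise divergence, $H(\mathbf{div},\Omega,\mathbb S)=\{\tau\in L^2(\Omega,\mathbb S):\mathbf{div}\,\tau\in L^2(\Omega,\mathbb R^d)\}$ and $\varepsilon(v)=\frac12(\nabla v+(\nabla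 v)^{\mathsf t})$. Let $T>0$, and let $$u\in W^{1,\infty}(0,T;L^2(\Omega,\mathbb R^d))\cap L^2(0,T;H^1_0(\Omega,\mathbb R^d)),\qquad \sigma\in H^1(0,T;L^2(\Omega,\mathbb S))\cap L^2(0,T;H(\mathbf{div},\Omega,\mathbb S))$$ satisfy, for a.e. $t\in(0,T)$, $$(\rho\dot u,v)_\Omega-(\mathbf{div}\,\sigma,v)_\Omega=(F,v)_\Omega\quad\forall v\in L^2(\Omega,\mathbb R^d),$$ $$(\mathcal A_s\dot\sigma,\tau)_{\Omega_s}+(\mathcal A_f\sigma,\tau)_{\Omega_f}+(u,\mathbf{div}\,\tau)_\Omega=0\quad\forall\tau\in H(\mathbf{div},\Omega,\mathbb S),$$ with $F(t)\in L^2(\Omega,\mathbb R^d)$ and initial conditions $u(0)=u^0$, $\sigma(0)|_{\Omega_s}=\sigma^0_s$. Let $\mathcal T_h$ be a partition of $\overline\Omega$ into triangles and/or convex quadrilaterals ($d=2$), or tetrahedra and/or parallelepipeds ($d=3$), possibly with hanging nodes, such that $\overline\Omega_s$ and $\overline\Omega_f$ are unions of elements. Its interior edges/faces are the sets $F=K\cap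 K'$, with $K\neq K'$ in $\mathcal T_h$, of positive $(d-1)$-dimensional measure; its boundary edges/faces are the edges/faces of elements that lie in $\partial\Omega$. Let $\mathcal F_h$ be the set of all of these, $\mathcal F(K)=\{F\in\mathcal F_h:F\subset\partial K\}$, and assume that $\partial K=\bigcup_{F\in\mathcal F(K)}F$ for each $K$. Let $h_F$ be the diameter of $F$ and $n_K$ the outward unit normal of $K$. On a simplex, $\mathcal P_m$ denotes the polynomials of degree at most $m$; on any other element or face, those of degree at most $m$ in each variable, for affine coordinates fixed on it. For $k\ge0$ let $\mathcal H_h$ be the space of $\mathbb S$-valued functions that are in $\mathcal P_k$ on each element, and let $\underline{\mathcal V}_h$ be the space of pairs $\underline v=(v,\hat v)$ with $v$ an $\mathbb R^d$-valued function that is in $\mathcal P_{k+1}$ on each element and $\hat v=(\hat v_F)_{F\in\mathcal F_h}$ with $\hat v_F\in\mathcal P_{k+1}(F,\mathbb R^d)$, $\hat v_F=0$ on boundary edges/faces. With the jump $[\![\underline v]\!]|_F=v|_{\partial K}-\hat v_F$ for $F\in\mathcal F(K)$, $\langle a,b\rangle_{\partial\mathcal T_h}=\sum_{K\in\mathcal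 T_h}\sum_{F\in\mathcal F(K)}\int_F a\cdot b$ and $(\cdot,\cdot)_{\mathcal T_h}=\sum_{K\in\mathcal T_h}(\cdot,\cdot)_K$, put $$B_h(\tau,\underline v)=(\tau,\varepsilon(v))_{\mathcal T_h}-\langle\tau n,[\![\underline v]\!]\rangle_{\partial\mathcal T_h},$$ where all boundary values are traces and $\varepsilon(v)$ is computed on each element. For $w\in H^1_0(\Omega,\mathbb R^d)$ let $\underline i(w)=(w,\hat w)$, where $\hat w_F$ is the trace of $w$ on $F$ for each $F\in\mathcal F_h$. Assume that $\sigma\in C^0([0,T];H^s(\mathcal T_h,\mathbb S)\cap H(\mathbf{div},\Omega,\mathbb S))$ for some $s>1/2$, where $H^s(\mathcal T_h,\mathbb S)$ is the space of tensors in $L^2(\Omega,\mathbb S)$ whose restriction to each $K\in\mathcal T_h$ is in $H^s(K,\mathbb S)$. Then, for a.e. $t\in(0,T)$, the traces and elementwise weak derivatives of $\sigma(t)$ and $u(t)$ that occur below exist, and $$(\rho\dot u,v)_{\mathcal T_h}+(\mathcal A_s\dot\sigma,\tau)_{\Omega_s}+(\mathcal A_f\sigma,\tau)_{\Omega_f}+B_h(\sigma,\underline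 v)-B_h(\tau,\underline i(u))+\Big\langle\tfrac{(k+1)^2}{h_F}[\![\underline i(u)]\!],[\![\underline v]\!]\Big\rangle_{\partial\mathcal T_h}=(F(t),v)_{\mathcal T_h}$$ for all $\tau\in\mathcal H_h$ and all $\underline v=(v,\hat v)\in\underline{\mathcal V}_h$. -/

import Mathlib

open MeasureTheory Set Filter Topology
open scoped ENNReal NNReal ContDiff InnerProductSpace

noncomputable section

namespace HDG

/-! ### Vectors and symmetric tensors -/

/-- `ℝ^d` with the Euclidean norm. -/
abbrev E (d : ℕ) := EuclideanSpace ℝ (Fin d)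

/-- The symmetric matrices, inside `ℝ^{d × d}` with the Frobenius inner product. -/
def symSubmodule (d : ℕ) : Submodule ℝ (EuclideanSpace ℝ (Fin d × Fin d)) where
  carrier := {τ | ∀ i j, τ (i, j) = τ (j, i)}
  add_mem' := by
    intro a b ha hb i j
    simp [ha i j, hb i j]
  zero_mem' := by
    intro i j
    simp
  smul_mem' := by
    intro c a ha i j
    simp [ha i j]

/-- `𝕊`: symmetric `d × d` tensors; `⟪σ, τ⟫_ℝ` is the component-wise product `σ : τ`. -/
abbrev Sym (d : ℕ) := ↥(symSubmodule d)

variable {d : ℕ}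

/-- The entry `τ_{ij}`. -/
def entry (τ : Sym d) (i j : Fin d) : ℝ := (τ : EuclideanSpace ℝ (Fin d × Fin d)) (i, j)

/-- The symmetric part `(A + Aᵀ) / 2` of a matrix. -/
def symPart (A : Fin d → Fin d → ℝ) : Sym d :=
  ⟨WithLp.toLp 2 (fun q => (A q.1 q.2 + A q.2 q.1) / 2), by
    intro i j
    simp [add_comm]⟩

/-- The identity tensor. -/
def idTensor : Sym d := symPart (fun i j => if i = j then 1 else 0)

/-- The trace `tr τ`. -/
def trTensor (τ : Sym d) : ℝ := ∑ i, entry τ i i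

/-- The product `τ n` of a tensor and a vector. -/
def mulVec (τ : Sym d) (n : E d) : E d := WithLp.toLp 2 (fun i => ∑ j, entry τ i j * n j)

/-- The `j`-th unit vector. -/
def unitVec (j : Fin d) : E d := EuclideanSpace.single j (1 : ℝ)

/-! ### Weak derivatives and Sobolev spaces -/

variable {V : Type*} [NormedAddCommGroup V] [NormedSpace ℝ V]

/-- `φ` is an infinitely differentiable function with compact support in `D`. -/
def IsTest (D : Set (E d)) (φ : E d → V) : Prop :=
  ContDiff ℝ ∞ φ ∧ HasCompactSupport φ ∧ tsupport φ ⊆ D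

/-- `g ∈ L²(D)` is the weak derivative `∂_{I 0} ⋯ ∂_{I (j-1)} f` of `f ∈ L²(D)`. -/
def HasWeakDeriv (D : Set (E d)) {j : ℕ} (I : Fin j → Fin d) (f g : E d → V) : Prop :=
  MemLp f 2 (volume.restrict D) ∧ MemLp g 2 (volume.restrict D) ∧
  ∀ φ : E d → ℝ, IsTest D φ →
    ∫ x in D, iteratedFDeriv ℝ j φ x (fun i => unitVec (I i)) • f x
      = (-1 : ℝ) ^ j • ∫ x in D, φ x • g x

/-- The squared Gagliardo (Sobolev--Slobodeckij) semi-norm of order `θ ∈ (0,1)`. -/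
def gagliardoSq (θ : ℝ) (D : Set (E d)) (f : E d → V) : ℝ≥0∞ :=
  ∫⁻ x in D, ∫⁻ y in D, ‖f x - f y‖ₑ ^ 2 / ‖x - y‖ₑ ^ ((d : ℝ) + 2 * θ)

open Classical in
/-- The squared norm of `H^s(D)`, `s ≥ 0`, on an open set `D`; it is `∞` when `f ∉ H^s(D)`.
The infimum runs over the families of weak derivatives of `f` of order at most `⌊s⌋`, which are
unique up to null sets, so that it is `∞` if there are none and a value otherwise. -/
def sobolevSq (s : ℝ) (D : Set (E d)) (f : E d → V) : ℝ≥0∞ :=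
  ⨅ (G : (j : ℕ) → (Fin j → Fin d) → E d → V)
    (_ : ∀ j ≤ ⌊s⌋₊, ∀ I : Fin j → Fin d, HasWeakDeriv D I f (G j I)),
    (∑ j ∈ Finset.range (⌊s⌋₊ + 1), ∑ I : Fin j → Fin d,
        eLpNorm (G j I) 2 (volume.restrict D) ^ 2)
      + if Int.fract s = 0 then 0
        else ∑ I : Fin ⌊s⌋₊ → Fin d, gagliardoSq (Int.fract s) D (G ⌊s⌋₊ I)

/-- `g ∈ L²(Γ)` is the trace on `Γ` (a `(d-1)`-dimensional subset of `closure D`) of the function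
`f` on `D`: the restriction to `Γ` is extended by continuity from smooth functions to `H^r(D)`,
for some `1/2 < r < 1` (larger exponents give smaller spaces and the same trace). -/
def HasTrace (D Γ : Set (E d)) (f g : E d → V) : Prop :=
  MemLp g 2 ((Measure.euclideanHausdorffMeasure (d - 1)).restrict Γ) ∧
  ∃ r : ℝ, 1 / 2 < r ∧ r < 1 ∧ ∃ φ : ℕ → E d → V,
    (∀ n, ContDiff ℝ ∞ (φ n)) ∧
    Tendsto (fun n => sobolevSq r D (φ n - f)) atTop (𝓝 0) ∧
    Tendsto (fun n => eLpNorm (φ n - g) 2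
      ((Measure.euclideanHausdorffMeasure (d - 1)).restrict Γ)) atTop (𝓝 0)

open Classical in
/-- The trace on `Γ` of a function on `D` (zero if there is none). -/
def trace (D Γ : Set (E d)) (f : E d → V) : E d → V :=
  if h : ∃ g, HasTrace D Γ f g then h.choose else 0

open Classical in
/-- The weak partial derivative `∂_j f` in `L²(D)` (zero if there is none). -/
def weakPartial (D : Set (E d)) (j : Fin d) (f : E d → V) : E d → V :=
  if h : ∃ g, HasWeakDeriv D (fun _ : Fin 1 => j) f g then h.choose else 0

/-- The linearized strain `ε(v) = (∇v + (∇v)ᵀ) / 2` of `v ∈ H¹(D, ℝ^d)`. -/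
def strain (D : Set (E d)) (v : E d → E d) : E d → Sym d :=
  fun x => symPart (fun i j => weakPartial D j v x i)

/-- `L²(D, V)`. -/
abbrev L2 (D : Set (E d)) (V : Type*) [NormedAddCommGroup V] := Lp V 2 (volume.restrict D)

/-- `w ∈ L²(D, ℝ^d)` is the (row-wise) weak divergence of `τ ∈ L²(D, 𝕊)`; so `τ ∈ H(div, D, 𝕊)`
if and only if there is such a `w`. -/
def IsWeakDiv (D : Set (E d)) (τ : L2 D (Sym d)) (w : L2 D (E d)) : Prop :=
  ∀ φ : E d → ℝ, IsTest D φ → ∀ i : Fin d,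
    ∫ x in D, ∑ j, entry (τ x) i j * fderiv ℝ φ x (unitVec j) = - ∫ x in D, w x i * φ x

/-- `v ∈ H¹₀(D, ℝ^d)` with partial derivatives `∂_j v = g j`: the closure of the test functions in
the norm of `H¹`. -/
def IsH10 (D : Set (E d)) (v : L2 D (E d)) (g : Fin d → L2 D (E d)) : Prop :=
  ∃ φ : ℕ → E d → E d, (∀ n, IsTest D (φ n)) ∧
    Tendsto (fun n => eLpNorm (fun x => φ n x - v x) 2 (volume.restrict D)) atTop (𝓝 0) ∧
    ∀ j, Tendsto (fun n => eLpNorm (fun x => fderiv ℝ (φ n) x (unitVec j) - g j x) 2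
      (volume.restrict D)) atTop (𝓝 0)

/-! ### Functions of time -/

/-- `f ∈ W^{1,p}_{[0,T]}(V)` with time derivative `f' ∈ L^p_{[0,T]}(V)`. -/
def IsTimeDeriv (p : ℝ≥0∞) (T : ℝ) (f f' : ℝ → V) : Prop :=
  MemLp f' p (volume.restrict (Ioo 0 T)) ∧ ∀ t ∈ Icc 0 T, f t = f 0 + ∫ r in (0 : ℝ)..t, f' r

/-- `u ∈ L²_{[0,T]}(H¹₀(D, ℝ^d))`; an element of `H¹` is identified with the tuple of the function
and its first derivatives. -/
def MemL2H10 (D : Set (E d)) (T : ℝ) (u : ℝ → L2 D (E d)) : Prop :=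
  MemLp u 2 (volume.restrict (Ioo 0 T)) ∧
  ∃ G : Fin d → ℝ → L2 D (E d), (∀ j, MemLp (G j) 2 (volume.restrict (Ioo 0 T))) ∧
    ∀ᵐ t ∂(volume.restrict (Ioo 0 T)), IsH10 D (u t) (fun j => G j t)

/-- `σ ∈ L²_{[0,T]}(H(div, D, 𝕊))`; an element of `H(div)` is identified with the pair of the tensor
and its divergence. -/
def MemL2Hdiv (D : Set (E d)) (T : ℝ) (σ : ℝ → L2 D (Sym d)) : Prop :=
  MemLp σ 2 (volume.restrict (Ioo 0 T)) ∧
  ∃ w : ℝ → L2 D (E d), MemLp w 2 (volume.restrict (Ioo 0 T)) ∧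
    ∀ᵐ t ∂(volume.restrict (Ioo 0 T)), IsWeakDiv D (σ t) (w t)

/-! ### The fluid-structure interaction problem -/

/-- A bounded open set with Lipschitz boundary: near each boundary point and in suitable orthonormal
coordinates it is the set above the graph of a Lipschitz function. -/
def IsLipschitzDomain (D : Set (E d)) : Prop :=
  IsOpen D ∧ Bornology.IsBounded D ∧
  ∀ x ∈ frontier D, ∃ (e : E d) (r : ℝ) (L : ℝ≥0) (γ : E d → ℝ),
    ‖e‖ = 1 ∧ 0 < r ∧ LipschitzWith L γ ∧
    ∀ y ∈ Metric.ball x r, y ∈ D ↔ γ (y - ⟪e, y⟫_ℝ • e) < ⟪e, y⟫_ℝ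

/-- The geometry and the coefficients: the domain `Ω` is split into the solid part `Ωs` and the
fluid part `Ωf`; `Cs` is a symmetric and positive definite tensor of order 4. That the three sets
are polyhedral is part of the existence of an aligned mesh. -/
structure Model (d : ℕ) where
  Ω : Set (E d)
  Ωs : Set (E d)
  Ωf : Set (E d)
  lip : IsLipschitzDomain Ω
  lip_s : IsLipschitzDomain Ωs
  lip_f : IsLipschitzDomain Ωf
  sub_s : Ωs ⊆ Ω
  sub_f : Ωf ⊆ Ω
  disj : Disjoint Ωs Ωf
  cover : Ω ⊆ closure Ωs ∪ closure Ωf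
  ρs : ℝ
  ρf : ℝ
  μf : ℝ
  lamf : ℝ
  ρs_pos : 0 < ρs
  ρf_pos : 0 < ρf
  μf_pos : 0 < μf
  lamf_pos : 0 < lamf
  Cs : Sym d ≃ₗ[ℝ] Sym d
  Cs_symm : ∀ σ τ : Sym d, ⟪Cs σ, τ⟫_ℝ = ⟪σ, Cs τ⟫_ℝ
  Cs_pos : ∀ τ : Sym d, τ ≠ 0 → 0 < ⟪Cs τ, τ⟫_ℝ

namespace Model

variable (P : Model d)

open Classical in
/-- The piecewise constant mass density. -/
def ρ (x : E d) : ℝ := if x ∈ P.Ωs then P.ρs else P.ρf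

/-- `A_s`, the inverse of `C_s`. -/
def As (τ : Sym d) : Sym d := P.Cs.symm τ

/-- `A_f`, the inverse of `C_f τ = 2 μ_f τ + λ_f (tr τ) I`. -/
def Af (τ : Sym d) : Sym d :=
  (1 / (2 * P.μf)) • (τ - (P.lamf / (d * P.lamf + 2 * P.μf) * trTensor τ) • idTensor)

/-- `(A_s σ', τ)_{Ω_s} + (A_f σ, τ)_{Ω_f}`. -/
def stressForm (σ' σ τ : E d → Sym d) : ℝ :=
  (∫ x in P.Ωs, ⟪P.As (σ' x), τ x⟫_ℝ) + ∫ x in P.Ωf, ⟪P.Af (σ x), τ x⟫_ℝ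

/-- `(u, σ)`, with time derivatives `u'` and `σ'`, is a solution of the velocity/stress formulation
with body force `F` and initial data `u0`, `σ0`. The space with the weighted inner product
`(A_s σ, τ)_{Ω_s} + (A_f σ, τ)_{Ω_f}` is `L²(Ω, 𝕊)` with an equivalent norm. -/
structure IsSolution (T : ℝ) (F : ℝ → L2 P.Ω (E d)) (u0 : L2 P.Ω (E d)) (σ0 : L2 P.Ωs (Sym d))
    (u u' : ℝ → L2 P.Ω (E d)) (σ σ' : ℝ → L2 P.Ω (Sym d)) : Prop where
  u_time : IsTimeDeriv ∞ T u u'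
  u_space : MemL2H10 P.Ω T u
  σ_time : IsTimeDeriv 2 T σ σ'
  σ_space : MemL2Hdiv P.Ω T σ
  momentum : ∀ᵐ t ∂(volume.restrict (Ioo 0 T)), ∀ w : L2 P.Ω (E d), IsWeakDiv P.Ω (σ t) w →
    ∀ v : L2 P.Ω (E d),
      (∫ x in P.Ω, P.ρ x * ⟪u' t x, v x⟫_ℝ) - ∫ x in P.Ω, ⟪w x, v x⟫_ℝ
        = ∫ x in P.Ω, ⟪F t x, v x⟫_ℝ
  constitutive : ∀ᵐ t ∂(volume.restrict (Ioo 0 T)),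
    ∀ (τ : L2 P.Ω (Sym d)) (w : L2 P.Ω (E d)), IsWeakDiv P.Ω τ w →
      P.stressForm (σ' t) (σ t) τ + ∫ x in P.Ω, ⟪u t x, w x⟫_ℝ = 0
  u_init : u 0 = u0
  σ_init : ∀ᵐ x ∂(volume.restrict P.Ωs), σ 0 x = σ0 x

end Model

/-! ### Meshes -/

/-- The (closed) `n`-simplices in `ℝ^d`. -/
def IsSimplex (n : ℕ) (K : Set (E d)) : Prop :=
  ∃ p : Fin (n + 1) → E d, AffineIndependent ℝ p ∧ K = convexHull ℝ (range p)

/-- Triangles and (convex) quadrilaterals if `d = 2`, tetrahedra and parallelepipeds if `d = 3`. -/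
def IsElement (K : Set (E d)) : Prop :=
  IsSimplex d K ∨
  (d = 2 ∧ ∃ p : Fin 4 → E d, ConvexIndependent ℝ p ∧ K = convexHull ℝ (range p)) ∨
  (d = 3 ∧ ∃ e : E d ≃ᵃ[ℝ] E d, K = e '' {x | ∀ i, x i ∈ Icc (0 : ℝ) 1})

/-- `F` is an edge/face, of dimension `d - 1`, of the convex polytope `K`. -/
def IsFacet (K F : Set (E d)) : Prop :=
  IsExposed ℝ K F ∧ F ≠ K ∧ 0 < Measure.euclideanHausdorffMeasure (d - 1) F

/-- `F` is an interior edge/face of the partition. -/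
def IsInteriorFace (elems : Finset (Set (E d))) (F : Set (E d)) : Prop :=
  0 < Measure.euclideanHausdorffMeasure (d - 1) F ∧
  ∃ K ∈ elems, ∃ K' ∈ elems, K ≠ K' ∧ F = K ∩ K'

/-- `F` is a boundary edge/face of the partition of `closure Ω`. -/
def IsBoundaryFace (Ω : Set (E d)) (elems : Finset (Set (E d))) (F : Set (E d)) : Prop :=
  F ⊆ frontier Ω ∧ ∃ K ∈ elems, IsFacet K F

/-- A partition `T_h` of `closure Ω`, possibly with hanging nodes, aligned with the interface.
`elemCoord K` and `faceCoord F` are the affine coordinates in which the degree in each variable is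
measured, for elements and faces that are not simplices: they can be the Cartesian coordinates, or
those of a reference cube. -/
structure Mesh (P : Model d) where
  elems : Finset (Set (E d))
  isElement : ∀ K ∈ elems, IsElement K
  disj : ∀ K ∈ elems, ∀ K' ∈ elems, K ≠ K' → Disjoint (interior K) (interior K')
  cover : closure P.Ω = ⋃ K ∈ elems, K
  cover_s : closure P.Ωs = ⋃ K ∈ elems, ⋃ (_ : K ⊆ closure P.Ωs), K
  cover_f : closure P.Ωf = ⋃ K ∈ elems, ⋃ (_ : K ⊆ closure P.Ωf), K
  faces : Finset (Set (E d))
  mem_faces : ∀ F, F ∈ faces ↔ IsInteriorFace elems F ∨ IsBoundaryFace P.Ω elems F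
  /-- the edges/faces in `F(K)` compose the boundary of `K` -/
  frontier_eq : ∀ K ∈ elems, frontier K = ⋃ F ∈ faces, ⋃ (_ : F ⊆ frontier K), F
  elemCoord : Set (E d) → (E d ≃ᵃ[ℝ] E d)
  faceCoord : Set (E d) → (E d →ᵃ[ℝ] E (d - 1))
  faceCoord_inj : ∀ F ∈ faces, InjOn (faceCoord F) F

open Classical in
/-- `f` is on `D` a polynomial function, with values in `V`, of the coordinates `c`: of total degree
at most `m` if `D` is the simplex `S`, of degree at most `m` in each variable otherwise. -/
def IsPolyOn {n : ℕ} (simplex : Prop) (c : E d → E n) (m : ℕ) (D : Set (E d)) (f : E d → V) :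
    Prop :=
  ∀ l : V →ₗ[ℝ] ℝ, ∃ p : MvPolynomial (Fin n) ℝ,
    (if simplex then p.totalDegree ≤ m else ∀ i, p.degreeOf i ≤ m) ∧
    ∀ x ∈ D, l (f x) = MvPolynomial.eval (fun i => c x i) p

open Classical in
/-- The unit normal vector to `F ⊆ ∂K` oriented towards the exterior of the convex set `K`. -/
def outwardNormal (K F : Set (E d)) : E d :=
  if h : ∃ n : E d, ‖n‖ = 1 ∧ ∀ x ∈ F, ∀ y ∈ K, ⟪n, y - x⟫_ℝ ≤ 0 then h.choose else 0

namespace Mesh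

variable {P : Model d} (M : Mesh P)

open Classical in
/-- The set `F(K)` of edges/faces composing the element `K`. -/
def facesOf (K : Set (E d)) : Finset (Set (E d)) := M.faces.filter (fun F => F ⊆ frontier K)

/-- The integral over `F` for the surface measure. -/
def faceInt (F : Set (E d)) (g : E d → ℝ) : ℝ :=
  ∫ x in F, g x ∂(Measure.euclideanHausdorffMeasure (d - 1))

/-- `f ∈ P_m(T_h, V)`. -/
def IsPiecewisePoly (m : ℕ) (f : E d → V) : Prop :=
  ∀ K ∈ M.elems, IsPolyOn (IsSimplex d K) (M.elemCoord K) m (interior K) f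

/-- `g ∈ P_m(F_h^0, V)`: single-valued polynomials on the edges/faces, which vanish on the boundary
edges/faces. -/
def IsSkeletonPoly (m : ℕ) (g : Set (E d) → E d → V) : Prop :=
  (∀ F ∈ M.faces, IsPolyOn (IsSimplex (d - 1) F) (M.faceCoord F) m F (g F)) ∧
  ∀ F ∈ M.faces, IsBoundaryFace P.Ω M.elems F → ∀ x ∈ F, g F x = 0

/-- The skeleton component `u|_{F_h}` of `i(u) = (u, u|_{F_h})`, for `u ∈ H¹(Ω, ℝ^d)`. -/
def skeletonTrace (P : Model d) (u : E d → E d) : Set (E d) → E d → E d :=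
  fun F => trace P.Ω F u

/-- The jump `v|_{∂K} - v̂` on the edge/face `F` of `K`. -/
def jump (K F : Set (E d)) (v : E d → E d) (vh : Set (E d) → E d → E d) (x : E d) : E d :=
  trace (interior K) (frontier K) v x - vh F x

/-- `(f, v)_{T_h}` for vector fields. -/
def innerT (f v : E d → E d) : ℝ := ∑ K ∈ M.elems, ∫ x in interior K, ⟪f x, v x⟫_ℝ

/-- `B_h(τ, (v, v̂)) = (τ, ε(v))_{T_h} - ⟨τ n, ⟦(v, v̂)⟧⟩_{∂T_h}`. -/
def Bh (τ : E d → Sym d) (v : E d → E d) (vh : Set (E d) → E d → E d) : ℝ :=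
  (∑ K ∈ M.elems, ∫ x in interior K, ⟪τ x, strain (interior K) v x⟫_ℝ)
  - ∑ K ∈ M.elems, ∑ F ∈ M.facesOf K, faceInt F (fun x =>
      ⟪mulVec (trace (interior K) (frontier K) τ x) (outwardNormal K F), jump K F v vh x⟫_ℝ)

/-- `⟨(k+1)² / h_F ⟦(u, û)⟧, ⟦(v, v̂)⟧⟩_{∂T_h}`, where `h_F` is the diameter of `F`. -/
def stab (k : ℕ) (u : E d → E d) (uh : Set (E d) → E d → E d)
    (v : E d → E d) (vh : Set (E d) → E d → E d) : ℝ :=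
  ∑ K ∈ M.elems, ∑ F ∈ M.facesOf K, faceInt F (fun x =>
    ((k : ℝ) + 1) ^ 2 / Metric.diam F * ⟪jump K F u uh x, jump K F v vh x⟫_ℝ)

/-- `(σ, (u, û))`, with time derivatives `σ'`, `u'`, satisfies the equations of the HDG scheme of
degree `k`, with body force `F`, at a given time. -/
def SatisfiesHDG (k : ℕ) (F : E d → E d) (u' : E d → E d) (σ' σ : E d → Sym d)
    (u : E d → E d) (uh : Set (E d) → E d → E d) : Prop :=
  ∀ τ : E d → Sym d, M.IsPiecewisePoly k τ →
  ∀ (v : E d → E d) (vh : Set (E d) → E d → E d),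
    M.IsPiecewisePoly (k + 1) v → M.IsSkeletonPoly (k + 1) vh →
      M.innerT (fun x => P.ρ x • u' x) v + P.stressForm σ' σ τ
        + M.Bh σ v vh - M.Bh τ u uh + M.stab k u uh v vh
      = M.innerT F v

/-- All the traces and weak derivatives of `σ` and `u` that enter the scheme exist, those of `u`
being taken on each element and, on the skeleton, from `Ω`. -/
def WellDefined (σ : E d → Sym d) (u : E d → E d) : Prop :=
  (∀ K ∈ M.elems,
    (∃ g, HasTrace (interior K) (frontier K) σ g) ∧
    (∃ g, HasTrace (interior K) (frontier K) u g) ∧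
    ∀ j : Fin d, ∃ g, HasWeakDeriv (interior K) (fun _ : Fin 1 => j) u g) ∧
  ∀ F ∈ M.faces, ∃ g, HasTrace P.Ω F u g

/-- `σ ∈ C⁰_{[0,T]}(H^s(T_h, 𝕊) ∩ H(div, Ω, 𝕊))`. -/
def IsContHsHdiv (T s : ℝ) (σ : ℝ → L2 P.Ω (Sym d)) : Prop :=
  ContinuousOn σ (Icc 0 T) ∧
  (∀ K ∈ M.elems, ∀ t ∈ Icc 0 T, sobolevSq s (interior K) (σ t) < ⊤ ∧
    Tendsto (fun r => sobolevSq s (interior K) (fun x => σ r x - σ t x))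
      (𝓝[Icc 0 T] t) (𝓝 0)) ∧
  ∃ w : ℝ → L2 P.Ω (E d), ContinuousOn w (Icc 0 T) ∧ ∀ t ∈ Icc 0 T, IsWeakDiv P.Ω (σ t) (w t)

end Mesh

end HDG

end

set_option linter.unusedSectionVars false
noncomputable section
namespace HDG
variable {d : ℕ} {V : Type*} [NormedAddCommGroup V] [NormedSpace ℝ V]

/-! ### Preliminaries on lower integrals -/

/-! Fix a time at which both equations hold and `u` lies in `H¹₀`. Three facts give the identity.
(1) The trace of `u` from an element and its trace from `Ω` coincide on every face, since one smooth
sequence converging to `u` in `H^r(Ω)`, `1/2 < r < 1`, also converges on each element. Hence the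
jump of `i(u)` vanishes: the stabilization drops out and `B_h(τ, i(u))` reduces to `(ε(u), τ)`
(`jump_skeletonTrace_ae_eq_zero`, `Bh_skeletonTrace`). (2) Testing the constitutive equation with `φ
τ`, for a scalar test function `φ` and a constant tensor `τ`, shows that `A_s σ'` in the solid and
`A_f σ` in the fluid equal `ε(u)` almost everywhere (`compliance_ae_eq`). Being pointwise, this can
be paired with the discontinuous tensors of `H_h`, and the result cancels `B_h(τ, i(u))`. (3)
Green's formula on each element turns `B_h(σ, (v, v̂))` into `-(div σ, v)` plus the sum over all
element boundaries of `σ n · v̂` (`Bh_eq_neg_integral`). On boundary faces `v̂ = 0`. On an interior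
face the normal traces from the elements adding up there cancel, because `div σ` is an `L²` function
on all of `Ω` (`sum_normalTrace_eq_zero`). What is left is the momentum equation.

The analytic work lies in giving meaning to these traces and in Green's formula for tensors that are
only `H^s`, `s > 1/2`, on each element. A trace inequality in `H^r`, `r > 1/2`, is obtained on
bounded convex sets by telescoping the means of a function over homothetic copies of the set that
shrink to a boundary point (`trace_inequality`). Smooth approximation uses averages of `f(l x + (1 -
l) w)` over `w` in the convex set: no extension is needed, and the operation commutes with weak
derivatives and weak divergence up to the factor `l`. Boundedness in `H^θ` and convergence in `L²`
then give convergence in `H^r` for `r < θ` (`tendsto_slobodeckijSq_of_bounded`).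

The divergence theorem on a convex polytope comes from cutting it into cones over its faces. With
hanging nodes a face is an intersection `K ∩ K'` and need not be a facet of either element; that
distinct faces overlap in null sets follows from separation of convex bodies and from the relative
boundary of a flat convex set being null (`ae_mem_interior_union`, `surf_face_inter`). -/

theorem eLpNorm_two_sq {α W : Type*} [NormedAddCommGroup W] {mα : MeasurableSpace α}
    (μ : Measure α) (f : α → W) : eLpNorm f 2 μ ^ 2 = ∫⁻ x, ‖f x‖ₑ ^ 2 ∂μ := by
  have := eLpNorm_nnreal_pow_eq_lintegral (μ := μ) (f := f) (p := 2) (by norm_num)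
  simpa using this

/-- Cauchy–Schwarz for `f g = f^(1/2) · (f^(1/2) g)`. When `f` has integral one this is Jensen's
inequality for the square, the form in which it serves for mollifiers. -/
theorem sq_lintegral_mul_le {α : Type*} {mα : MeasurableSpace α} (μ : Measure α)
    {f g : α → ℝ≥0∞} (hf : AEMeasurable f μ) (hg : AEMeasurable g μ) :
    (∫⁻ x, f x * g x ∂μ) ^ 2 ≤ (∫⁻ x, f x ∂μ) * ∫⁻ x, f x * g x ^ 2 ∂μ := by
  have h2 : ∀ a : ℝ≥0∞, (a ^ (1 / 2 : ℝ)) ^ 2 = a := fun a => by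
    rw [← ENNReal.rpow_natCast, ← ENNReal.rpow_mul]; norm_num
  have h := ENNReal.lintegral_mul_le_Lp_mul_Lq μ (Real.HolderConjugate.two_two)
    (hf.pow_const (1 / 2 : ℝ)) ((hf.pow_const (1 / 2 : ℝ)).mul hg)
  have e1 : ∀ x, ((fun x => f x ^ (1 / 2 : ℝ)) * ((fun x => f x ^ (1 / 2 : ℝ)) * g)) x
      = f x * g x := fun x => by
    simp only [Pi.mul_apply]
    rw [← mul_assoc, ← sq, h2]
  have e2 : ∀ x, (f x ^ (1 / 2 : ℝ)) ^ (2 : ℝ) = f x := fun x => by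
    rw [← ENNReal.rpow_mul]; norm_num
  have e3 : ∀ x, (((fun x => f x ^ (1 / 2 : ℝ)) * g) x) ^ (2 : ℝ) = f x * g x ^ 2 := fun x => by
    rw [Pi.mul_apply, ENNReal.mul_rpow_of_nonneg _ _ (by norm_num), e2, ENNReal.rpow_two]
  simp_rw [e1, e2, e3] at h
  calc (∫⁻ x, f x * g x ∂μ) ^ 2 ≤ _ := pow_le_pow_left' h 2
    _ = _ := by rw [mul_pow, h2, h2]

theorem integrable_smul_of_memLp_two {α : Type*} {mα : MeasurableSpace α} {μ : Measure α}
    {f : α → ℝ} {g : α → V} (hf : MemLp f 2 μ) (hg : MemLp g 2 μ) :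
    Integrable (fun x => f x • g x) μ :=
  memLp_one_iff_integrable.1 (hg.smul hf)

theorem enorm_add_sq_le {W : Type*} [NormedAddCommGroup W] (a b : W) :
    ‖a + b‖ₑ ^ 2 ≤ 2 * (‖a‖ₑ ^ 2 + ‖b‖ₑ ^ 2) := by
  have h := enorm_add_le a b
  calc ‖a + b‖ₑ ^ 2 ≤ (‖a‖ₑ + ‖b‖ₑ) ^ 2 := by gcongr
    _ ≤ 2 * (‖a‖ₑ ^ 2 + ‖b‖ₑ ^ 2) := by
      have := ENNReal.rpow_add_le_mul_rpow_add_rpow ‖a‖ₑ ‖b‖ₑ (p := 2) (by norm_num)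
      norm_num at this
      simpa using this

theorem enorm_sub_sq_le {W : Type*} [NormedAddCommGroup W] (a b : W) :
    ‖a - b‖ₑ ^ 2 ≤ 2 * (‖a‖ₑ ^ 2 + ‖b‖ₑ ^ 2) := by
  simpa [sub_eq_add_neg] using enorm_add_sq_le a (-b)

theorem lintegral_comp_smul_add {c : ℝ} (hc : 0 < c) (b : E d) (φ : E d → ℝ≥0∞) :
    ∫⁻ x, φ (c • x + b) = ENNReal.ofReal (c ^ d)⁻¹ * ∫⁻ x, φ x := by
  have h1 : ∫⁻ x, φ (c • x + b) = ∫⁻ x, φ (c • x) := by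
    have := lintegral_add_right_eq_self (μ := (volume : Measure (E d))) (fun x => φ (c • x)) (c⁻¹ • b)
    rw [← this]
    refine lintegral_congr fun x => ?_
    rw [smul_add, smul_inv_smul₀ hc.ne']
  rw [h1]
  have h2 := Measure.map_addHaar_smul (volume : Measure (E d)) hc.ne'
  have h3 := MeasurableEmbedding.lintegral_map (μ := (volume : Measure (E d)))
    (Homeomorph.smulOfNeZero c hc.ne').measurableEmbedding φ
  have h4 : Measure.map (⇑(Homeomorph.smulOfNeZero c hc.ne')) (volume : Measure (E d)) =
    Measure.map (fun x => c • x) volume := rfl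
  rw [h4, show (fun x : E d => c • x) = (c • ·) from rfl, h2, lintegral_smul_measure] at h3
  simp only [Homeomorph.smulOfNeZero_apply, finrank_euclideanSpace, Fintype.card_fin,
    smul_eq_mul] at h3
  rw [← h3, abs_of_pos (by positivity)]

/-! ### The Gagliardo semi-norm and the norm of `H^θ`, `0 < θ < 1`. -/

/-- The integrand of the Gagliardo semi-norm. -/
def gagKernel (θ : ℝ) (f : E d → V) (p : E d × E d) : ℝ≥0∞ :=
  ‖f p.1 - f p.2‖ₑ ^ 2 / ‖p.1 - p.2‖ₑ ^ ((d : ℝ) + 2 * θ)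

theorem gagKernel_eq {θ : ℝ} (hθ : 0 < θ) (f : E d → V) (x y : E d) :
    gagKernel θ f (x, y) =
      ENNReal.ofReal (‖f x - f y‖ ^ 2 / ‖x - y‖ ^ ((d : ℝ) + 2 * θ)) := by
  have he : 0 < (d : ℝ) + 2 * θ := by positivity
  unfold gagKernel
  simp only
  rcases eq_or_ne x y with rfl | h
  -- On the diagonal both numerators vanish, and zero divided by anything is zero in `ℝ` and in
  -- `ℝ≥0∞`.
  · simp
  · have hp : 0 < ‖x - y‖ := norm_pos_iff.2 (sub_ne_zero.2 h)
    rw [ENNReal.ofReal_div_of_pos (by positivity), ← ofReal_norm, ← ofReal_norm,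
      ENNReal.ofReal_pow (norm_nonneg _), ENNReal.ofReal_rpow_of_pos hp]

theorem aemeasurable_gagKernel {D : Set (E d)} (θ : ℝ) {f : E d → V}
    (hf : AEStronglyMeasurable f (volume.restrict D)) :
    AEMeasurable (gagKernel θ f) ((volume.restrict D).prod (volume.restrict D)) := by
  have h1 : AEStronglyMeasurable (fun p : E d × E d => f p.1 - f p.2)
      ((volume.restrict D).prod (volume.restrict D)) := hf.comp_fst.sub hf.comp_snd
  have h2 : Measurable (fun p : E d × E d => ‖p.1 - p.2‖ₑ ^ ((d : ℝ) + 2 * θ)) := by fun_prop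
  exact (h1.enorm.pow_const 2).div h2.aemeasurable

theorem gagliardoSq_eq_lintegral_prod {D : Set (E d)} (θ : ℝ) {f : E d → V}
    (hf : AEStronglyMeasurable f (volume.restrict D)) :
    gagliardoSq θ D f
      = ∫⁻ p, gagKernel θ f p ∂((volume.restrict D).prod (volume.restrict D)) := by
  rw [lintegral_prod _ (aemeasurable_gagKernel θ hf)]
  rfl

theorem gagliardoSq_congr_ae {D : Set (E d)} (θ : ℝ) {f g : E d → V}
    (h : f =ᵐ[volume.restrict D] g) : gagliardoSq θ D f = gagliardoSq θ D g := by
  unfold gagliardoSq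
  refine lintegral_congr_ae ?_
  filter_upwards [h] with x hx
  refine lintegral_congr_ae ?_
  filter_upwards [h] with y hy
  rw [hx, hy]

theorem gagliardoSq_mono_set {D D' : Set (E d)} (h : D ⊆ D') (θ : ℝ) (f : E d → V) :
    gagliardoSq θ D f ≤ gagliardoSq θ D' f := by
  unfold gagliardoSq
  exact (lintegral_mono fun x => lintegral_mono_set h).trans (lintegral_mono_set h)

theorem gagliardoSq_add_le {D : Set (E d)} (θ : ℝ) {f g : E d → V}
    (hf : AEStronglyMeasurable f (volume.restrict D))
    (hg : AEStronglyMeasurable g (volume.restrict D)) :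
    gagliardoSq θ D (f + g) ≤ 2 * (gagliardoSq θ D f + gagliardoSq θ D g) := by
  rw [gagliardoSq_eq_lintegral_prod θ hf, gagliardoSq_eq_lintegral_prod θ hg,
    gagliardoSq_eq_lintegral_prod θ (hf.add hg), ← lintegral_add_left' (aemeasurable_gagKernel θ hf),
    ← lintegral_const_mul' _ _ (by norm_num)]
  refine lintegral_mono fun p => ?_
  unfold gagKernel
  rw [← ENNReal.add_div, ← mul_div_assoc]
  gcongr
  simp only [Pi.add_apply]
  rw [add_sub_add_comm]
  exact enorm_add_sq_le _ _

theorem gagliardoSq_neg {D : Set (E d)} (θ : ℝ) (f : E d → V) :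
    gagliardoSq θ D (-f) = gagliardoSq θ D f := by
  unfold gagliardoSq
  refine lintegral_congr fun x => lintegral_congr fun y => ?_
  rw [Pi.neg_apply, Pi.neg_apply, ← neg_sub', enorm_neg]

theorem gagliardoSq_sub_le {D : Set (E d)} (θ : ℝ) {f g : E d → V}
    (hf : AEStronglyMeasurable f (volume.restrict D))
    (hg : AEStronglyMeasurable g (volume.restrict D)) :
    gagliardoSq θ D (f - g) ≤ 2 * (gagliardoSq θ D f + gagliardoSq θ D g) := by
  have := gagliardoSq_add_le θ hf hg.neg
  rwa [gagliardoSq_neg, ← sub_eq_add_neg] at this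

/-- Fatou's lemma for the Gagliardo semi-norm. -/
theorem gagliardoSq_le_of_tendsto {D : Set (E d)} (θ : ℝ) {f : E d → V} {φ : ℕ → E d → V}
    (hf : AEStronglyMeasurable f (volume.restrict D))
    (hφ : ∀ n, AEStronglyMeasurable (φ n) (volume.restrict D))
    (h : Tendsto (fun n => eLpNorm (φ n - f) 2 (volume.restrict D)) atTop (𝓝 0))
    {M : ℝ≥0∞} (hM : ∀ n, gagliardoSq θ D (φ n) ≤ M) : gagliardoSq θ D f ≤ M := by
  obtain ⟨ns, -, hns⟩ := (tendstoInMeasure_of_tendsto_eLpNorm (by norm_num) hφ hf h).exists_seq_tendsto_ae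
  have h1 : ∀ᵐ p ∂((volume.restrict D).prod (volume.restrict D)),
      Tendsto (fun i => φ (ns i) p.1) atTop (𝓝 (f p.1)) :=
    Measure.quasiMeasurePreserving_fst.ae hns
  have h2 : ∀ᵐ p ∂((volume.restrict D).prod (volume.restrict D)),
      Tendsto (fun i => φ (ns i) p.2) atTop (𝓝 (f p.2)) :=
    Measure.quasiMeasurePreserving_snd.ae hns
  rw [gagliardoSq_eq_lintegral_prod θ hf]
  have h3 : ∀ᵐ p ∂((volume.restrict D).prod (volume.restrict D)),
      gagKernel θ f p ≤ liminf (fun i => gagKernel θ (φ (ns i)) p) atTop := by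
    filter_upwards [h1, h2] with p hp1 hp2
    refine le_of_eq (Tendsto.liminf_eq ?_).symm
    rcases eq_or_ne p.1 p.2 with hp | hp
    · simp [gagKernel, hp]
    · unfold gagKernel
      refine ENNReal.Tendsto.div_const (ENNReal.Tendsto.pow (hp1.sub hp2).enorm) (Or.inr ?_)
      have h0 : ‖p.1 - p.2‖ₑ ≠ 0 := by simpa [sub_eq_zero] using hp
      intro h
      rcases ENNReal.rpow_eq_zero_iff.1 h with ⟨a, -⟩ | ⟨a, -⟩
      · exact h0 a
      · exact enorm_ne_top a
  refine (lintegral_mono_ae h3).trans ((lintegral_liminf_le'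
    (fun i => aemeasurable_gagKernel θ (hφ _))).trans ?_)
  refine liminf_le_of_le (by isBoundedDefault) fun b hb => ?_
  obtain ⟨i, hi⟩ := hb.exists
  refine hi.trans ?_
  rw [← gagliardoSq_eq_lintegral_prod θ (hφ _)]
  exact hM _

/-- Split at distance `δ` from the diagonal: nearer, the two kernels differ by the factor `‖x -
y‖^(2(s-r)) ≤ δ^(2(s-r))`; farther away, the denominator is at least `δ^(d+2r)`. The first
coefficient is small with `δ`, which gives an interpolation between `L²` and `H^s`. -/
theorem gagKernel_le_add {r s δ : ℝ} (hr : 0 < r) (hrs : r ≤ s) (hδ : 0 < δ) (f : E d → V)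
    (p : E d × E d) :
    gagKernel r f p ≤ ENNReal.ofReal (δ ^ (2 * (s - r))) * gagKernel s f p +
      ENNReal.ofReal (2 * (δ ^ ((d : ℝ) + 2 * r))⁻¹) * (‖f p.1‖ₑ ^ 2 + ‖f p.2‖ₑ ^ 2) := by
  obtain ⟨x, y⟩ := p
  have hs : 0 < s := hr.trans_le hrs
  simp only
  rw [gagKernel_eq hr, gagKernel_eq hs, ← ofReal_norm, ← ofReal_norm,
    ← ENNReal.ofReal_mul (by positivity), ← ENNReal.ofReal_pow (norm_nonneg _),
    ← ENNReal.ofReal_pow (norm_nonneg _), ← ENNReal.ofReal_add (by positivity) (by positivity),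
    ← ENNReal.ofReal_mul (by positivity), ← ENNReal.ofReal_add (by positivity) (by positivity)]
  refine ENNReal.ofReal_le_ofReal ?_
  have her : 0 < (d : ℝ) + 2 * r := by positivity
  rcases eq_or_ne x y with rfl | h
  · simp only [sub_self, norm_zero]
    rw [zero_pow two_ne_zero, zero_div, zero_div, mul_zero]
    positivity
  have hp : 0 < ‖x - y‖ := norm_pos_iff.2 (sub_ne_zero.2 h)
  rcases le_total ‖x - y‖ δ with hle | hle
  · have h1 : ‖x - y‖ ^ (2 * (s - r)) ≤ δ ^ (2 * (s - r)) :=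
      Real.rpow_le_rpow hp.le hle (by linarith)
    have h2 : ‖x - y‖ ^ ((d : ℝ) + 2 * s)
        = ‖x - y‖ ^ (2 * (s - r)) * ‖x - y‖ ^ ((d : ℝ) + 2 * r) := by
      rw [← Real.rpow_add hp]; ring_nf
    have h3 : ‖f x - f y‖ ^ 2 / ‖x - y‖ ^ ((d : ℝ) + 2 * r)
        = ‖x - y‖ ^ (2 * (s - r)) * (‖f x - f y‖ ^ 2 / ‖x - y‖ ^ ((d : ℝ) + 2 * s)) := by
      rw [h2]; field_simp
    rw [h3]
    refine le_add_of_le_of_nonneg ?_ (by positivity)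
    gcongr
  · have h1 : δ ^ ((d : ℝ) + 2 * r) ≤ ‖x - y‖ ^ ((d : ℝ) + 2 * r) :=
      Real.rpow_le_rpow hδ.le hle her.le
    refine le_add_of_nonneg_of_le (by positivity) ?_
    have h2 : ‖f x - f y‖ ^ 2 ≤ 2 * (‖f x‖ ^ 2 + ‖f y‖ ^ 2) := by
      have := norm_sub_le (f x) (f y)
      nlinarith [norm_nonneg (f x - f y), sq_nonneg (‖f x‖ - ‖f y‖)]
    calc ‖f x - f y‖ ^ 2 / ‖x - y‖ ^ ((d : ℝ) + 2 * r)
        ≤ 2 * (‖f x‖ ^ 2 + ‖f y‖ ^ 2) / δ ^ ((d : ℝ) + 2 * r) := by gcongr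
      _ = _ := by ring

theorem gagliardoSq_le_add {D : Set (E d)} {r s δ : ℝ} (hr : 0 < r) (hrs : r ≤ s) (hδ : 0 < δ)
    {f : E d → V} (hf : AEStronglyMeasurable f (volume.restrict D)) :
    gagliardoSq r D f ≤ ENNReal.ofReal (δ ^ (2 * (s - r))) * gagliardoSq s D f +
      ENNReal.ofReal (2 * (δ ^ ((d : ℝ) + 2 * r))⁻¹) *
        (2 * volume D * ∫⁻ x in D, ‖f x‖ₑ ^ 2) := by
  have hm1 : AEMeasurable (fun p : E d × E d => ‖f p.1‖ₑ ^ 2)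
      ((volume.restrict D).prod (volume.restrict D)) := hf.comp_fst.enorm.pow_const 2
  have hm2 : AEMeasurable (fun p : E d × E d => ‖f p.2‖ₑ ^ 2)
      ((volume.restrict D).prod (volume.restrict D)) := hf.comp_snd.enorm.pow_const 2
  have hm : AEMeasurable (fun p : E d × E d => ‖f p.1‖ₑ ^ 2 + ‖f p.2‖ₑ ^ 2)
      ((volume.restrict D).prod (volume.restrict D)) := hm1.add hm2
  have e1 : ∫⁻ p, (‖f p.1‖ₑ ^ 2 + ‖f p.2‖ₑ ^ 2) ∂((volume.restrict D).prod (volume.restrict D))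
      = 2 * volume D * ∫⁻ x in D, ‖f x‖ₑ ^ 2 := by
    rw [lintegral_add_left' hm1, lintegral_prod _ hm1, lintegral_prod _ hm2]
    simp only [lintegral_const, Measure.restrict_apply_univ]
    rw [lintegral_mul_const'' _ (hf.enorm.pow_const 2)]
    ring
  rw [gagliardoSq_eq_lintegral_prod r hf, gagliardoSq_eq_lintegral_prod s hf, ← e1,
    ← lintegral_const_mul' _ _ ENNReal.ofReal_ne_top, ← lintegral_const_mul' _ _ ENNReal.ofReal_ne_top,
    ← lintegral_add_right' _ (hm.const_mul _)]
  exact lintegral_mono fun p => gagKernel_le_add hr hrs hδ f p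

/-- The squared norm of `H^θ(D)`, `0 < θ < 1`. -/
def slobodeckijSq (θ : ℝ) (D : Set (E d)) (f : E d → V) : ℝ≥0∞ :=
  (∫⁻ x in D, ‖f x‖ₑ ^ 2) + gagliardoSq θ D f

theorem slobodeckijSq_congr_ae {D : Set (E d)} (θ : ℝ) {f g : E d → V}
    (h : f =ᵐ[volume.restrict D] g) : slobodeckijSq θ D f = slobodeckijSq θ D g := by
  unfold slobodeckijSq
  rw [gagliardoSq_congr_ae θ h]
  congr 1
  exact lintegral_congr_ae (h.mono fun x hx => by simp only [hx])

theorem slobodeckijSq_mono_set {D D' : Set (E d)} (h : D ⊆ D') (θ : ℝ) (f : E d → V) :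
    slobodeckijSq θ D f ≤ slobodeckijSq θ D' f :=
  add_le_add (lintegral_mono_set h) (gagliardoSq_mono_set h θ f)

theorem slobodeckijSq_sub_le {D : Set (E d)} (θ : ℝ) {f g : E d → V}
    (hf : AEStronglyMeasurable f (volume.restrict D))
    (hg : AEStronglyMeasurable g (volume.restrict D)) :
    slobodeckijSq θ D (f - g) ≤ 2 * (slobodeckijSq θ D f + slobodeckijSq θ D g) := by
  unfold slobodeckijSq
  have h1 : ∫⁻ x in D, ‖(f - g) x‖ₑ ^ 2
      ≤ 2 * ((∫⁻ x in D, ‖f x‖ₑ ^ 2) + ∫⁻ x in D, ‖g x‖ₑ ^ 2) := by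
    rw [← lintegral_add_left' (hf.enorm.pow_const 2), ← lintegral_const_mul' _ _ (by norm_num)]
    exact lintegral_mono fun x => enorm_sub_sq_le _ _
  refine (add_le_add h1 (gagliardoSq_sub_le θ hf hg)).trans (le_of_eq ?_)
  ring

theorem slobodeckijSq_le_mul_of_le {D : Set (E d)} {r s : ℝ} (hr : 0 < r) (hrs : r ≤ s)
    (hD : volume D ≠ ⊤) : ∃ C : ℝ≥0∞, C ≠ ⊤ ∧ ∀ f : E d → V,
      AEStronglyMeasurable f (volume.restrict D) →
        slobodeckijSq r D f ≤ C * slobodeckijSq s D f := by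
  refine ⟨1 + ENNReal.ofReal 2 * (2 * volume D), ?_, fun f hf => ?_⟩
  · finiteness
  · have := gagliardoSq_le_add hr hrs one_pos hf
    simp only [Real.one_rpow, inv_one, mul_one, ENNReal.ofReal_one, one_mul] at this
    unfold slobodeckijSq
    calc _ ≤ (∫⁻ x in D, ‖f x‖ₑ ^ 2) + _ := add_le_add le_rfl this
      _ ≤ (∫⁻ x in D, ‖f x‖ₑ ^ 2) + (gagliardoSq s D f +
          ENNReal.ofReal 2 * (2 * volume D * ∫⁻ x in D, ‖f x‖ₑ ^ 2)) +
          ENNReal.ofReal 2 * (2 * volume D) * gagliardoSq s D f := le_self_add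
      _ = _ := by ring

/-- Bounded in `H^s` and convergent in `L²` implies convergent in `H^r` for `r < s`. -/
theorem tendsto_slobodeckijSq_of_bounded {D : Set (E d)} {r s : ℝ} (hr : 0 < r) (hrs : r < s)
    (hD : volume D ≠ ⊤) {f : E d → V} {φ : ℕ → E d → V}
    (hf : AEStronglyMeasurable f (volume.restrict D))
    (hφ : ∀ n, AEStronglyMeasurable (φ n) (volume.restrict D))
    (h : Tendsto (fun n => eLpNorm (φ n - f) 2 (volume.restrict D)) atTop (𝓝 0))
    {M : ℝ≥0∞} (hMt : M ≠ ⊤) (hM : ∀ n, gagliardoSq s D (φ n) ≤ M) :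
    Tendsto (fun n => slobodeckijSq r D (φ n - f)) atTop (𝓝 0) := by
  have hfM := gagliardoSq_le_of_tendsto s hf hφ h hM
  have hb : ∀ n, gagliardoSq s D (φ n - f) ≤ 4 * M := fun n => by
    refine (gagliardoSq_sub_le s (hφ n) hf).trans ?_
    calc _ ≤ 2 * (M + M) := by gcongr; exact hM n
      _ = 4 * M := by ring
  have h2 : Tendsto (fun n => ∫⁻ x in D, ‖(φ n - f) x‖ₑ ^ 2) atTop (𝓝 0) := by
    simp_rw [← eLpNorm_two_sq]
    simpa using ENNReal.Tendsto.pow (n := 2) h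
  unfold slobodeckijSq
  have key : Tendsto (fun n => gagliardoSq r D (φ n - f)) atTop (𝓝 0) := by
    rw [ENNReal.tendsto_nhds_zero]
    intro ε hε
    -- The distance `δ` is fixed first, so that the `H^s` part is at most `ε / 2` for every `n`; the
    -- `L²` part is then small for large `n`.
    have hδ : Tendsto (fun δ : ℝ => ENNReal.ofReal (δ ^ (2 * (s - r))) * (4 * M))
        (𝓝[>] 0) (𝓝 0) := by
      have h0 : Tendsto (fun δ : ℝ => δ ^ (2 * (s - r))) (𝓝[>] 0) (𝓝 0) := by
        have := (Real.continuousAt_rpow_const 0 (2 * (s - r)) (Or.inr (by linarith))).tendsto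
        rw [Real.zero_rpow (by linarith)] at this
        exact this.mono_left nhdsWithin_le_nhds
      have h1 := ENNReal.Tendsto.mul_const (ENNReal.tendsto_ofReal h0)
        (b := 4 * M) (Or.inr (by finiteness))
      simpa using h1
    have hε2 : 0 < ε / 2 := ENNReal.half_pos hε.ne'
    obtain ⟨δ, hδ1, hδ0⟩ := ((ENNReal.tendsto_nhds_zero.1 hδ (ε / 2) hε2).and
      self_mem_nhdsWithin).exists
    have h3 : Tendsto (fun n => ENNReal.ofReal (2 * (δ ^ ((d : ℝ) + 2 * r))⁻¹) *
        (2 * volume D * ∫⁻ x in D, ‖(φ n - f) x‖ₑ ^ 2)) atTop (𝓝 0) := by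
      have h4 := ENNReal.Tendsto.const_mul h2 (a := 2 * volume D) (Or.inr (by finiteness))
      have h5 := ENNReal.Tendsto.const_mul h4
        (a := ENNReal.ofReal (2 * (δ ^ ((d : ℝ) + 2 * r))⁻¹)) (Or.inr (by finiteness))
      simpa using h5
    filter_upwards [ENNReal.tendsto_nhds_zero.1 h3 (ε / 2) hε2] with n hn
    refine (gagliardoSq_le_add hr hrs.le hδ0 ((hφ n).sub hf)).trans ?_
    rw [← ENNReal.add_halves ε]
    refine add_le_add (le_trans ?_ hδ1) hn
    gcongr
    exact hb n
  simpa using h2.add key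

/-! ### The Sobolev norm of fractional order -/

/-- By the fundamental lemma of the calculus of variations. The infimum in `sobolevSq` also ranges
over the derivative of order zero, which is thereby pinned down up to null sets. -/
theorem HasWeakDeriv.ae_eq_of_zero {D : Set (E d)} (hD : IsOpen D) {I : Fin 0 → Fin d}
    {f g : E d → V} [CompleteSpace V] (h : HasWeakDeriv D I f g) : g =ᵐ[volume.restrict D] f := by
  obtain ⟨hf, hg, h⟩ := h
  have hloc : LocallyIntegrableOn (fun x => g x - f x) D volume := by
    refine LocallyIntegrableOn.sub ?_ ?_
    · exact locallyIntegrableOn_of_locallyIntegrable_restrict (hg.locallyIntegrable (by norm_num))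
    · exact locallyIntegrableOn_of_locallyIntegrable_restrict (hf.locallyIntegrable (by norm_num))
  have h0 := hD.ae_eq_zero_of_integral_contDiff_smul_eq_zero hloc (fun φ hφ hc hs => by
    have h1 := h φ ⟨hφ, hc, hs⟩
    simp only [iteratedFDeriv_zero_apply, pow_zero, one_smul] at h1
    have hb : MemLp φ 2 (volume.restrict D) :=
      (hφ.continuous.memLp_of_hasCompactSupport hc).restrict D
    have i1 : Integrable (fun x => φ x • g x) (volume.restrict D) := integrable_smul_of_memLp_two hb hg
    have i2 : Integrable (fun x => φ x • f x) (volume.restrict D) := integrable_smul_of_memLp_two hb hf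
    have e : ∫ x, φ x • (g x - f x) = ∫ x in D, φ x • (g x - f x) := by
      refine (setIntegral_eq_integral_of_forall_compl_eq_zero fun x hx => ?_).symm
      rw [image_eq_zero_of_notMem_tsupport (fun hx' => hx (hs hx')), zero_smul]
    rw [e]
    simp_rw [smul_sub]
    rw [integral_sub i1 i2, h1, sub_self])
  rw [Filter.EventuallyEq, ae_restrict_iff' hD.measurableSet]
  filter_upwards [h0] with x hx hxD
  exact sub_eq_zero.1 (hx hxD)

theorem sobolevSq_le_slobodeckijSq {D : Set (E d)} {r : ℝ} (hr : 0 < r) (hr1 : r < 1)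
    {f : E d → V} (hf : MemLp f 2 (volume.restrict D)) :
    sobolevSq r D f ≤ slobodeckijSq r D f := by
  have hfl : ⌊r⌋₊ = 0 := Nat.floor_eq_zero.2 hr1
  have hfr : Int.fract r = r := Int.fract_eq_self.2 ⟨hr.le, hr1⟩
  unfold sobolevSq
  refine (iInf₂_le (fun _ _ => f) ?_).trans ?_
  · intro j hj I
    rw [hfl] at hj
    obtain rfl := Nat.le_zero.1 hj
    exact ⟨hf, hf, fun φ _ => by simp⟩
  · rw [hfr, if_neg hr.ne', hfl]
    simp [slobodeckijSq, eLpNorm_two_sq]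

/-- Without a family of weak derivatives the infimum is `⊤`, so that no integrability of `f` has to
be assumed, in contrast to the opposite inequality. -/
theorem slobodeckijSq_le_sobolevSq {D : Set (E d)} (hD : IsOpen D) [CompleteSpace V] {r : ℝ}
    (hr : 0 < r) (hr1 : r < 1) (f : E d → V) :
    slobodeckijSq r D f ≤ sobolevSq r D f := by
  have hfl : ⌊r⌋₊ = 0 := Nat.floor_eq_zero.2 hr1
  have hfr : Int.fract r = r := Int.fract_eq_self.2 ⟨hr.le, hr1⟩
  unfold sobolevSq
  refine le_iInf₂ fun G hG => ?_
  rw [hfr, if_neg hr.ne', hfl]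
  have h0 : ∀ I, G 0 I =ᵐ[volume.restrict D] f := fun I => (hG 0 (Nat.zero_le _) I).ae_eq_of_zero hD
  simp only [zero_add, Finset.range_one, Finset.sum_singleton, Finset.univ_unique]
  rw [gagliardoSq_congr_ae r (h0 _), eLpNorm_two_sq, slobodeckijSq]
  refine le_of_eq ?_
  congr 1
  exact lintegral_congr_ae ((h0 default).mono fun x hx => by simp only [hx])

theorem sobolevSq_eq_slobodeckijSq {D : Set (E d)} (hD : IsOpen D) [CompleteSpace V] {r : ℝ}
    (hr : 0 < r) (hr1 : r < 1) {f : E d → V} (hf : MemLp f 2 (volume.restrict D)) :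
    sobolevSq r D f = slobodeckijSq r D f :=
  (sobolevSq_le_slobodeckijSq hr hr1 hf).antisymm (slobodeckijSq_le_sobolevSq hD hr hr1 f)

theorem memLp_of_sobolevSq_lt_top {D : Set (E d)} {r : ℝ} {f : E d → V}
    (h : sobolevSq r D f < ⊤) : MemLp f 2 (volume.restrict D) := by
  unfold sobolevSq at h
  obtain ⟨G, hG⟩ := iInf_lt_iff.1 h
  obtain ⟨hG', -⟩ := iInf_lt_iff.1 hG
  exact (hG' 0 (Nat.zero_le _) Fin.elim0).1

end HDG
end

noncomputable section
namespace HDG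
variable {d : ℕ} {V : Type*} [NormedAddCommGroup V] [NormedSpace ℝ V]

/-! ### The trace inequality -/

/-- Change of variables `p = ε x + (1 - ε) y`. By convexity the shrunken copy of `D` stays in `D`
even when `y` is a boundary point, and it lies within `ε R` of `y`. -/
theorem lintegral_comp_homothety_le {D : Set (E d)} (hDo : IsOpen D) (hDc : Convex ℝ D) {R : ℝ}
    (hR : ∀ x ∈ D, ∀ y ∈ closure D, ‖x - y‖ ≤ R) {ε : ℝ} (hε : 0 < ε) (hε1 : ε ≤ 1) {y : E d}
    (hy : y ∈ closure D) (φ : E d → ℝ≥0∞) :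
    ∫⁻ x in D, φ (ε • x + (1 - ε) • y) ≤
      ENNReal.ofReal (ε ^ d)⁻¹ * ∫⁻ p in D, (Metric.closedBall y (ε * R)).indicator φ p := by
  rw [← lintegral_indicator hDo.measurableSet, ← lintegral_indicator hDo.measurableSet,
    ← lintegral_comp_smul_add hε ((1 - ε) • y)]
  refine lintegral_mono fun x => ?_
  by_cases hx : x ∈ D
  · have h1 : ε • x + (1 - ε) • y ∈ D := by
      have := hDc.combo_interior_closure_mem_interior (a := ε) (b := 1 - ε)
        (by rwa [hDo.interior_eq]) hy hε (by linarith) (by ring)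
      rwa [hDo.interior_eq] at this
    have h2 : ε • x + (1 - ε) • y ∈ Metric.closedBall y (ε * R) := by
      rw [mem_closedBall_iff_norm, show ε • x + (1 - ε) • y - y = ε • (x - y) by module,
        norm_smul, Real.norm_of_nonneg hε.le]
      exact mul_le_mul_of_nonneg_left (hR x hx y hy) hε.le
    rw [indicator_of_mem hx, indicator_of_mem h1, indicator_of_mem h2]
  · rw [indicator_of_notMem hx]
    exact zero_le

theorem enorm_sub_sq_le_gagKernel {r : ℝ} (hr : 0 < r) (f : E d → V) {x y : E d} {ρ : ℝ}
    (h : ‖x - y‖ ≤ ρ) :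
    ‖f x - f y‖ₑ ^ 2 ≤ ENNReal.ofReal (ρ ^ ((d : ℝ) + 2 * r)) * gagKernel r f (x, y) := by
  have he : 0 < (d : ℝ) + 2 * r := by positivity
  have hρ : 0 ≤ ρ := (norm_nonneg _).trans h
  rw [gagKernel_eq hr, ← ofReal_norm, ← ENNReal.ofReal_pow (norm_nonneg _),
    ← ENNReal.ofReal_mul (by positivity)]
  refine ENNReal.ofReal_le_ofReal ?_
  rcases eq_or_ne x y with rfl | hxy
  · simp
  have hp : 0 < ‖x - y‖ := norm_pos_iff.2 (sub_ne_zero.2 hxy)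
  rw [mul_div_assoc', le_div_iff₀ (by positivity), mul_comm]
  gcongr

theorem measurable_gagKernel (r : ℝ) {f : E d → V} (hf : Continuous f) :
    Measurable (gagKernel r f) := by
  unfold gagKernel
  have h1 : Measurable (fun p : E d × E d => ‖f p.1 - f p.2‖ₑ ^ 2) :=
    (Continuous.enorm (by fun_prop)).measurable.pow_const 2
  exact h1.div (by fun_prop)

/-- Both evaluation points lie within `ε R` of `y`, so the squared difference is at most `(2 ε
R)^(d+2r)` times the Gagliardo kernel. Changing variables in `x` and `x'` brings the kernel into its
own coordinates, and Fubini leaves the `μ`-measure of a ball of radius `ε R`, of order `ε^(d-1)`. -/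
theorem lintegral_dyadic_difference_le (hd : 1 ≤ d) {D : Set (E d)} (hDo : IsOpen D)
    (hDc : Convex ℝ D) {R : ℝ} (hR0 : 0 < R) (hR : ∀ x ∈ D, ∀ y ∈ closure D, ‖x - y‖ ≤ R)
    {μ : Measure (E d)} [SFinite μ] (hμD : ∀ᵐ y ∂μ, y ∈ closure D) {A : ℝ≥0}
    (hμ : ∀ p ρ, 0 < ρ → μ (Metric.closedBall p ρ) ≤ A * ENNReal.ofReal (ρ ^ (d - 1)))
    {r : ℝ} (hr : 0 < r) :
    ∃ C : ℝ≥0, ∀ f : E d → V, Continuous f → ∀ ε : ℝ, 0 < ε → ε ≤ 1 →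
      ∫⁻ y, (∫⁻ x in D, ∫⁻ x' in D,
        ‖f (ε • x + (1 - ε) • y) - f ((ε / 2) • x' + (1 - ε / 2) • y)‖ₑ ^ 2) ∂μ
      ≤ C * ENNReal.ofReal (ε ^ (2 * r - 1)) * gagliardoSq r D f := by
  -- The powers of `ε` add up to `(d + 2r) - 2d + (d - 1) = 2r - 1`; this constant collects the
  -- remaining factors, `2 ^ d` coming from the halved scale.
  refine ⟨A * Real.toNNReal ((2 * R) ^ ((d : ℝ) + 2 * r) * 2 ^ d * R ^ (d - 1)), ?_⟩
  intro f hf ε hε hε1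
  have hG := measurable_gagKernel r hf
  set c1 := ENNReal.ofReal ((2 * ε * R) ^ ((d : ℝ) + 2 * r)) with hc1
  set c2 := ENNReal.ofReal ((ε / 2) ^ d)⁻¹ with hc2
  set c3 := ENNReal.ofReal (ε ^ d)⁻¹ with hc3
  set G : E d → ℝ≥0∞ := fun p => ∫⁻ q in D, gagKernel r f (p, q) with hGdef
  have hGm : Measurable G := hG.lintegral_prod_right'
  have key : ∀ y ∈ closure D, ∫⁻ x in D, ∫⁻ x' in D,
        ‖f (ε • x + (1 - ε) • y) - f ((ε / 2) • x' + (1 - ε / 2) • y)‖ₑ ^ 2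
      ≤ c1 * c2 * c3 * ∫⁻ p in D, (Metric.closedBall p (ε * R)).indicator (fun _ => G p) y := by
    intro y hy
    have hin : ∀ x ∈ D, ∫⁻ x' in D,
        ‖f (ε • x + (1 - ε) • y) - f ((ε / 2) • x' + (1 - ε / 2) • y)‖ₑ ^ 2
        ≤ c1 * c2 * G (ε • x + (1 - ε) • y) := by
      intro x hx
      calc _ ≤ ∫⁻ x' in D, c1 * gagKernel r f (ε • x + (1 - ε) • y,
              (ε / 2) • x' + (1 - ε / 2) • y) := by
            refine setLIntegral_mono' hDo.measurableSet fun x' hx' => ?_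
            refine enorm_sub_sq_le_gagKernel hr f ?_
            rw [show ε • x + (1 - ε) • y - ((ε / 2) • x' + (1 - ε / 2) • y)
              = ε • (x - y) - (ε / 2) • (x' - y) by module]
            refine (norm_sub_le _ _).trans ?_
            rw [norm_smul, norm_smul, Real.norm_of_nonneg hε.le, Real.norm_of_nonneg (by positivity)]
            have h1 := hR x hx y hy
            have h2 := hR x' hx' y hy
            nlinarith [norm_nonneg (x - y), norm_nonneg (x' - y)]
        _ = c1 * ∫⁻ x' in D, gagKernel r f (ε • x + (1 - ε) • y,
              (ε / 2) • x' + (1 - ε / 2) • y) := lintegral_const_mul' _ _ ENNReal.ofReal_ne_top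
        _ ≤ c1 * (c2 * ∫⁻ q in D, (Metric.closedBall y (ε / 2 * R)).indicator
              (fun q => gagKernel r f (ε • x + (1 - ε) • y, q)) q) := by
            gcongr
            exact lintegral_comp_homothety_le hDo hDc hR (by positivity) (by linarith) hy
              (fun q => gagKernel r f (ε • x + (1 - ε) • y, q))
        -- Only the outer variable needs to remember that it is close to `y`; the inner localization
        -- is dropped.
        _ ≤ _ := by
            rw [mul_assoc]
            gcongr
            refine lintegral_mono fun q => ?_
            exact indicator_le_self _ _ _
    calc _ ≤ ∫⁻ x in D, c1 * c2 * G (ε • x + (1 - ε) • y) :=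
          setLIntegral_mono' hDo.measurableSet hin
      _ = c1 * c2 * ∫⁻ x in D, G (ε • x + (1 - ε) • y) :=
          lintegral_const_mul' _ _ (by finiteness)
      _ ≤ c1 * c2 * (c3 * ∫⁻ p in D, (Metric.closedBall y (ε * R)).indicator G p) := by
          gcongr
          exact lintegral_comp_homothety_le hDo hDc hR hε hε1 hy G
      -- The roles of centre and point are exchanged, so that integrating over `y` first measures a
      -- ball around `p`.
      _ = _ := by
          rw [mul_assoc (c1 * c2)]
          congr 3
          funext p
          simp only [indicator, Metric.mem_closedBall, dist_comm]
  have hmeas : Measurable (fun z : E d × E d =>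
      (Metric.closedBall z.2 (ε * R)).indicator (fun _ => G z.2) z.1) := by
    have : (fun z : E d × E d => (Metric.closedBall z.2 (ε * R)).indicator (fun _ => G z.2) z.1)
        = {z : E d × E d | dist z.1 z.2 ≤ ε * R}.indicator (fun z => G z.2) := by
      funext z
      simp only [indicator, Metric.mem_closedBall, mem_ofPred_eq]
    rw [this]
    refine (hGm.comp measurable_snd).indicator ?_
    exact (isClosed_le (by fun_prop) continuous_const).measurableSet
  calc _ ≤ ∫⁻ y, c1 * c2 * c3 * (∫⁻ p in D,
          (Metric.closedBall p (ε * R)).indicator (fun _ => G p) y) ∂μ :=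
        lintegral_mono_ae (hμD.mono key)
    _ = c1 * c2 * c3 * ∫⁻ y, (∫⁻ p in D,
          (Metric.closedBall p (ε * R)).indicator (fun _ => G p) y) ∂μ :=
        lintegral_const_mul' _ _ (by finiteness)
    _ = c1 * c2 * c3 * ∫⁻ p in D, ∫⁻ y,
          (Metric.closedBall p (ε * R)).indicator (fun _ => G p) y ∂μ := by
        rw [lintegral_lintegral_swap hmeas.aemeasurable]
    _ ≤ c1 * c2 * c3 * ∫⁻ p in D, (A * ENNReal.ofReal ((ε * R) ^ (d - 1))) * G p := by
        gcongr with p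
        rw [lintegral_indicator_const Metric.isClosed_closedBall.measurableSet, mul_comm]
        gcongr
        exact hμ p _ (by positivity)
    _ = c1 * c2 * c3 * (A * ENNReal.ofReal ((ε * R) ^ (d - 1))) * gagliardoSq r D f := by
        rw [lintegral_const_mul' _ _ (by finiteness), ← mul_assoc]
        rfl
    _ = _ := by
        congr 1
        have hA : c1 * c2 * c3 * (A * ENNReal.ofReal ((ε * R) ^ (d - 1)))
            = A * (c1 * c2 * c3 * ENNReal.ofReal ((ε * R) ^ (d - 1))) := by ring
        rw [hA, ENNReal.coe_mul, mul_assoc (A : ℝ≥0∞)]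
        refine congrArg (fun z => (A : ℝ≥0∞) * z) ?_
        rw [hc1, hc2, hc3, ← ENNReal.ofReal_mul (by positivity), ← ENNReal.ofReal_mul (by positivity),
          ← ENNReal.ofReal_mul (by positivity)]
        change _ = ENNReal.ofReal _ * _
        rw [← ENNReal.ofReal_mul (by positivity)]
        congr 1
        have e1 : (2 * ε * R) ^ ((d : ℝ) + 2 * r)
            = ε ^ ((d : ℝ) + 2 * r) * (2 * R) ^ ((d : ℝ) + 2 * r) := by
          rw [← Real.mul_rpow hε.le (by positivity)]; ring_nf
        have e2 : ε ^ (2 * r - 1) * (ε ^ d * ε) = ε ^ ((d : ℝ) + 2 * r) := by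
          rw [← pow_succ, ← Real.rpow_natCast, ← Real.rpow_add hε]
          congr 1
          push_cast
          ring
        have e3 : ε ^ d = ε ^ (d - 1) * ε := by rw [← pow_succ]; congr 1; omega
        rw [e1, ← e2, div_pow, mul_pow, inv_div]
        have h0 : ε ^ d ≠ 0 := by positivity
        field_simp
        rw [e3]
        ring

/-- The mean value of `f` over the homothetic copy `y + ε (D - y)` of `D`. -/
def homothetyMean (D : Set (E d)) (f : E d → V) (ε : ℝ) (y : E d) : V :=
  ⨍ x in D, f (ε • x + (1 - ε) • y)

theorem Continuous.integrableOn_of_isBounded {D : Set (E d)} (hD : Bornology.IsBounded D)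
    {W : Type*} [NormedAddCommGroup W] {f : E d → W} (hf : Continuous f) :
    IntegrableOn f D :=
  (hf.continuousOn.integrableOn_compact hD.isCompact_closure).mono_set subset_closure

theorem memLp_two_of_isBounded {D : Set (E d)} (hD : Bornology.IsBounded D)
    {W : Type*} [NormedAddCommGroup W] {f : E d → W} (hf : Continuous f) :
    MemLp f 2 (volume.restrict D) := by
  obtain ⟨C, hC⟩ := hD.isCompact_closure.exists_bound_of_continuousOn hf.continuousOn
  have : IsFiniteMeasure (volume.restrict (closure D)) :=
    ⟨by simpa using hD.isCompact_closure.measure_lt_top⟩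
  have : MemLp f 2 (volume.restrict (closure D)) :=
    MemLp.of_bound hf.aestronglyMeasurable C
      ((ae_restrict_iff' isClosed_closure.measurableSet).2 (ae_of_all _ hC))
  exact this.mono_measure (Measure.restrict_mono subset_closure le_rfl)

theorem volume_ne_top_of_isBounded {D : Set (E d)} (hD : Bornology.IsBounded D) :
    volume D ≠ ⊤ := hD.measure_lt_top.ne

theorem sq_lintegral_le {α : Type*} {mα : MeasurableSpace α} (μ : Measure α)
    {g : α → ℝ≥0∞} (hg : AEMeasurable g μ) :
    (∫⁻ x, g x ∂μ) ^ 2 ≤ μ univ * ∫⁻ x, g x ^ 2 ∂μ := by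
  simpa using sq_lintegral_mul_le μ (f := fun _ => 1) aemeasurable_const hg

variable [CompleteSpace V]

theorem enorm_setAverage_sq_le {D : Set (E d)} (hD0 : volume D ≠ 0) (hDt : volume D ≠ ⊤)
    {g : E d → V} (hg : AEStronglyMeasurable g (volume.restrict D)) :
    ‖⨍ x in D, g x‖ₑ ^ 2 ≤ (volume D)⁻¹ * ∫⁻ x in D, ‖g x‖ₑ ^ 2 := by
  rw [setAverage_eq, enorm_smul, mul_pow]
  have h1 : ‖(volume.real D)⁻¹‖ₑ = (volume D)⁻¹ := by
    have hp : 0 < volume.real D := ENNReal.toReal_pos hD0 hDt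
    rw [Real.enorm_eq_ofReal (by positivity), ENNReal.ofReal_inv_of_pos hp, measureReal_def,
      ENNReal.ofReal_toReal hDt]
  have h2 : ‖∫ x in D, g x‖ₑ ^ 2 ≤ volume D * ∫⁻ x in D, ‖g x‖ₑ ^ 2 := by
    calc _ ≤ (∫⁻ x in D, ‖g x‖ₑ) ^ 2 := by gcongr; exact enorm_integral_le_lintegral_enorm _
      _ ≤ _ := by simpa using sq_lintegral_le (volume.restrict D) hg.enorm
  rw [h1]
  calc _ ≤ (volume D)⁻¹ ^ 2 * (volume D * ∫⁻ x in D, ‖g x‖ₑ ^ 2) := by gcongr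
    _ = ((volume D)⁻¹ * volume D) * ((volume D)⁻¹ * ∫⁻ x in D, ‖g x‖ₑ ^ 2) := by ring
    _ = _ := by rw [ENNReal.inv_mul_cancel hD0 hDt, one_mul]

/-- Jensen's inequality twice: for the mean at scale `ε` with the other mean as a constant, then for
the mean at scale `ε'` with the value at `x` as a constant. -/
theorem enorm_homothetyMean_sub_sq_le {D : Set (E d)} (hDb : Bornology.IsBounded D)
    (hD0 : volume D ≠ 0) {f : E d → V} (hf : Continuous f) (ε ε' : ℝ) (y : E d) :
    ‖homothetyMean D f ε y - homothetyMean D f ε' y‖ₑ ^ 2 ≤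
      (volume D)⁻¹ ^ 2 * ∫⁻ x in D, ∫⁻ x' in D,
        ‖f (ε • x + (1 - ε) • y) - f (ε' • x' + (1 - ε') • y)‖ₑ ^ 2 := by
  have hDt := volume_ne_top_of_isBounded hDb
  have hint : ∀ (δ : ℝ), IntegrableOn (fun x => f (δ • x + (1 - δ) • y)) D := fun δ =>
    Continuous.integrableOn_of_isBounded hDb (by fun_prop)
  have hconst : ∀ v : V, ⨍ _x in D, v = v := fun v => setAverage_const hD0 hDt v
  have hsub : ∀ (δ : ℝ) (v : V), ⨍ x in D, (f (δ • x + (1 - δ) • y) - v)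
      = homothetyMean D f δ y - v := fun δ v => by
    have hv : IntegrableOn (fun _ => v) D :=
      Continuous.integrableOn_of_isBounded hDb (continuous_const)
    conv_rhs => rw [← hconst v]
    unfold homothetyMean
    rw [setAverage_eq, setAverage_eq, setAverage_eq, ← smul_sub, integral_sub (hint δ) hv]
  rw [← hsub ε]
  have h1 := enorm_setAverage_sq_le hD0 hDt
    (g := fun x => f (ε • x + (1 - ε) • y) - homothetyMean D f ε' y)
    (Continuous.aestronglyMeasurable (by fun_prop))
  refine h1.trans ?_
  rw [sq, mul_assoc, ← lintegral_const_mul' ((volume D)⁻¹) (fun x => ∫⁻ x' in D,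
    ‖f (ε • x + (1 - ε) • y) - f (ε' • x' + (1 - ε') • y)‖ₑ ^ 2) (ENNReal.inv_ne_top.2 hD0)]
  gcongr with x
  have h2 := enorm_setAverage_sq_le hD0 hDt
    (g := fun x' => f (ε' • x' + (1 - ε') • y) - f (ε • x + (1 - ε) • y))
    (Continuous.aestronglyMeasurable (by fun_prop))
  rw [hsub, ← enorm_neg, neg_sub] at h2
  refine h2.trans ?_
  gcongr with x'
  rw [← enorm_neg, neg_sub]

theorem tendsto_homothetyMean {D : Set (E d)} (hDm : MeasurableSet D) (hDb : Bornology.IsBounded D)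
    (hD0 : volume D ≠ 0) {f : E d → V} (hf : Continuous f) {e : ℕ → ℝ}
    (he : Tendsto e atTop (𝓝 0)) (y : E d) :
    Tendsto (fun n => homothetyMean D f (e n) y) atTop (𝓝 (f y)) := by
  have hDt := volume_ne_top_of_isBounded hDb
  obtain ⟨R, hR⟩ := hDb.exists_norm_le
  rw [Metric.tendsto_nhds]
  intro η hη
  obtain ⟨δ, hδ, hδη⟩ := Metric.continuous_iff.1 hf y (η / 2) (by positivity)
  have hlim : Tendsto (fun n => |e n| * (|R| + ‖y‖)) atTop (𝓝 0) := by
    simpa using he.abs.mul_const (|R| + ‖y‖)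
  filter_upwards [hlim.eventually_lt_const hδ] with n hn
  have hmem := (convex_closedBall (f y) (η / 2)).set_average_mem Metric.isClosed_closedBall hD0 hDt
    (μ := volume) (t := D) (f := fun x => f (e n • x + (1 - e n) • y)) ?_
    (Continuous.integrableOn_of_isBounded hDb (by fun_prop))
  · exact lt_of_le_of_lt (Metric.mem_closedBall.1 hmem) (by linarith)
  · refine (ae_restrict_iff' hDm).2 (ae_of_all _ fun x hx => ?_)
    refine Metric.mem_closedBall.2 (hδη _ ?_).le
    rw [dist_eq_norm, show e n • x + (1 - e n) • y - y = e n • (x - y) by module, norm_smul,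
      Real.norm_eq_abs]
    refine lt_of_le_of_lt ?_ hn
    gcongr
    exact (norm_sub_le _ _).trans (add_le_add ((hR x hx).trans (le_abs_self R)) le_rfl)

theorem stronglyMeasurable_homothetyMean (D : Set (E d)) {f : E d → V} (hf : Continuous f)
    (ε : ℝ) : StronglyMeasurable (homothetyMean D f ε) := by
  have h : StronglyMeasurable (fun p : E d × E d => f (ε • p.2 + (1 - ε) • p.1)) :=
    Continuous.stronglyMeasurable (by fun_prop)
  have h2 := h.integral_prod_right' (ν := volume.restrict D)
  have h3 : homothetyMean D f ε = fun y => (volume.real D)⁻¹ •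
      ∫ x in D, f (ε • x + (1 - ε) • y) := by
    funext y
    simp only [homothetyMean, setAverage_eq]
  rw [h3]
  exact h2.const_smul _

theorem eLpNorm_le_of_sq_le {α W : Type*} [NormedAddCommGroup W] {mα : MeasurableSpace α}
    {μ : Measure α} {f : α → W} {a : ℝ≥0∞} (h : eLpNorm f 2 μ ^ 2 ≤ a ^ 2) :
    eLpNorm f 2 μ ≤ a := (ENNReal.pow_le_pow_left_iff two_ne_zero).1 h

/-- The means at scales `2^(-j)` tend to `f y`, and consecutive ones differ in `L²(μ)` by a multiple
of `2^(-j(r - 1/2))`. The telescoping sum converges because `r > 1/2`; the mean at scale one does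
not depend on `y`. -/
theorem exists_eLpNorm_sub_homothetyMean_le (hd : 1 ≤ d) {D : Set (E d)} (hDo : IsOpen D)
    (hDc : Convex ℝ D) (hDb : Bornology.IsBounded D) (hDn : D.Nonempty)
    {μ : Measure (E d)} [SFinite μ] (hμD : ∀ᵐ y ∂μ, y ∈ closure D) {A : ℝ≥0}
    (hμ : ∀ p ρ, 0 < ρ → μ (Metric.closedBall p ρ) ≤ A * ENNReal.ofReal (ρ ^ (d - 1)))
    {r : ℝ} (hr : 1 / 2 < r) :
    ∃ C : ℝ≥0∞, C ≠ ⊤ ∧ ∀ f : E d → V, Continuous f →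
      eLpNorm (fun y => f y - homothetyMean D f 1 y) 2 μ ≤
        C * gagliardoSq r D f ^ (1 / 2 : ℝ) := by
  have hD0 : volume D ≠ 0 := (hDo.measure_pos volume hDn).ne'
  have hDt := volume_ne_top_of_isBounded hDb
  obtain ⟨R0, hR0⟩ := (Metric.isBounded_iff.1 hDb.closure)
  have hR : ∀ x ∈ D, ∀ y ∈ closure D, ‖x - y‖ ≤ |R0| + 1 := fun x hx y hy => by
    have h1 := hR0 (subset_closure hx) hy
    rw [dist_eq_norm] at h1
    linarith [le_abs_self R0]
  obtain ⟨C, hC⟩ := lintegral_dyadic_difference_le (V := V) hd hDo hDc (by positivity) hR hμD hμ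
    (show 0 < r by linarith)
  -- The ratio of the geometric series, less than one exactly because `r > 1/2`.
  set q : ℝ := (1 / 2 : ℝ) ^ (r - 1 / 2) with hq
  have hq0 : 0 < q := by positivity
  have hq1 : q < 1 := Real.rpow_lt_one (by norm_num) (by norm_num) (by linarith)
  set B : ℝ≥0∞ := (volume D)⁻¹ * (C : ℝ≥0∞) ^ (1 / 2 : ℝ) with hB
  have hBt : B ≠ ⊤ := ENNReal.mul_ne_top (ENNReal.inv_ne_top.2 hD0) (by finiteness)
  have hsum : ∀ N, ∑ j ∈ Finset.range N, ENNReal.ofReal (q ^ j) ≤ ENNReal.ofReal (1 - q)⁻¹ := by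
    intro N
    rw [← ENNReal.ofReal_sum_of_nonneg (fun _ _ => by positivity)]
    refine ENNReal.ofReal_le_ofReal ?_
    rw [← tsum_geometric_of_lt_one hq0.le hq1]
    exact (summable_geometric_of_lt_one hq0.le hq1).sum_le_tsum _ (fun _ _ => by positivity)
  refine ⟨B * ENNReal.ofReal (1 - q)⁻¹, ENNReal.mul_ne_top hBt ENNReal.ofReal_ne_top, ?_⟩
  intro f hf
  set g := gagliardoSq r D f with hg
  set a : ℕ → E d → V := fun j => homothetyMean D f ((1 / 2) ^ j) with ha
  have hsq : ∀ z : ℝ≥0∞, (z ^ (1 / 2 : ℝ)) ^ 2 = z := fun z => by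
    rw [← ENNReal.rpow_natCast, ← ENNReal.rpow_mul]; norm_num
  have ham : ∀ j, StronglyMeasurable (a j) := fun j => stronglyMeasurable_homothetyMean D hf _
  have hstep : ∀ j, eLpNorm (a j - a (j + 1)) 2 μ
      ≤ B * ENNReal.ofReal (q ^ j) * g ^ (1 / 2 : ℝ) := by
    intro j
    refine eLpNorm_le_of_sq_le ?_
    have h1 := hC f hf ((1 / 2) ^ j) (by positivity) (pow_le_one₀ (by norm_num) (by norm_num))
    rw [eLpNorm_two_sq]
    calc _ ≤ ∫⁻ y, (volume D)⁻¹ ^ 2 * (∫⁻ x in D, ∫⁻ x' in D,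
          ‖f (((1 / 2 : ℝ) ^ j) • x + ((1 : ℝ) - (1 / 2) ^ j) • y)
            - f (((1 / 2) ^ j / 2 : ℝ) • x' + ((1 : ℝ) - (1 / 2) ^ j / 2) • y)‖ₑ ^ 2) ∂μ := by
          refine lintegral_mono fun y => ?_
          have h2 := enorm_homothetyMean_sub_sq_le hDb hD0 hf ((1 / 2) ^ j) ((1 / 2) ^ j / 2) y
          have h3 : (a j - a (j + 1)) y = homothetyMean D f ((1 / 2) ^ j) y
            - homothetyMean D f ((1 / 2) ^ j / 2) y := by
            simp only [ha, Pi.sub_apply]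
            rw [show ((1 / 2 : ℝ)) ^ (j + 1) = (1 / 2) ^ j / 2 by ring]
          rw [h3]
          exact h2
      _ = (volume D)⁻¹ ^ 2 * _ := lintegral_const_mul' _ _
          (ENNReal.pow_ne_top (ENNReal.inv_ne_top.2 hD0))
      _ ≤ (volume D)⁻¹ ^ 2 * (C * ENNReal.ofReal (((1 / 2 : ℝ) ^ j) ^ (2 * r - 1)) * g) := by
          gcongr
      _ = _ := by
          have e1 : ((1 / 2 : ℝ) ^ j) ^ (2 * r - 1) = (q ^ j) ^ 2 := by
            rw [hq, ← Real.rpow_natCast, ← Real.rpow_natCast, ← Real.rpow_natCast,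
              ← Real.rpow_mul (by positivity), ← Real.rpow_mul (by positivity),
              ← Real.rpow_mul (by positivity)]
            congr 1
            push_cast
            ring
          rw [e1, ENNReal.ofReal_pow (pow_pos hq0 j).le, mul_pow, mul_pow, hB, mul_pow, hsq, hsq]
          ring
  have htel : ∀ N, eLpNorm (a N - a 0) 2 μ ≤ B * ENNReal.ofReal (1 - q)⁻¹ * g ^ (1 / 2 : ℝ) := by
    intro N
    have h1 : a N - a 0 = - ∑ j ∈ Finset.range N, (a j - a (j + 1)) := by
      rw [Finset.sum_range_sub']
      abel
    rw [h1, eLpNorm_neg]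
    calc _ ≤ ∑ j ∈ Finset.range N, eLpNorm (a j - a (j + 1)) 2 μ :=
          eLpNorm_sum_le (fun j _ => ((ham j).sub (ham (j + 1))).aestronglyMeasurable) (by norm_num)
      _ ≤ ∑ j ∈ Finset.range N, B * ENNReal.ofReal (q ^ j) * g ^ (1 / 2 : ℝ) :=
          Finset.sum_le_sum fun j _ => hstep j
      _ = B * (∑ j ∈ Finset.range N, ENNReal.ofReal (q ^ j)) * g ^ (1 / 2 : ℝ) := by
          rw [Finset.mul_sum, Finset.sum_mul]
      _ ≤ _ := by gcongr; exact hsum N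
  have hlim : ∀ᵐ y ∂μ, Tendsto (fun N => (a N - a 0) y) atTop (𝓝 (f y - homothetyMean D f 1 y)) := by
    refine ae_of_all _ fun y => ?_
    simp only [Pi.sub_apply]
    have h0 : a 0 y = homothetyMean D f 1 y := by simp [ha]
    rw [h0]
    exact (tendsto_homothetyMean hDo.measurableSet hDb hD0 hf
      (tendsto_pow_atTop_nhds_zero_of_lt_one (by norm_num) (by norm_num)) y).sub_const _
  -- The bound on partial sums does not depend on their length, so lower semicontinuity of the norm
  -- under pointwise limits carries it to `f`.
  refine (Lp.eLpNorm_lim_le_liminf_eLpNorm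
    (fun N => ((ham N).sub (ham 0)).aestronglyMeasurable) _ hlim).trans ?_
  exact liminf_le_of_le (by isBoundedDefault) fun b hb => (hb.exists.choose_spec).trans (htel _)

/-- On the boundary `f` is its mean over `D` plus an oscillation. The oscillation is bounded by the
semi-norm, the mean by the `L²` norm over `D`, and `μ` is finite because it lives on a bounded set
and satisfies the growth bound. -/
theorem trace_inequality (hd : 1 ≤ d) {D : Set (E d)} (hDo : IsOpen D)
    (hDc : Convex ℝ D) (hDb : Bornology.IsBounded D) (hDn : D.Nonempty)
    {μ : Measure (E d)} [SFinite μ] (hμD : ∀ᵐ y ∂μ, y ∈ closure D) {A : ℝ≥0}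
    (hμ : ∀ p ρ, 0 < ρ → μ (Metric.closedBall p ρ) ≤ A * ENNReal.ofReal (ρ ^ (d - 1)))
    {r : ℝ} (hr : 1 / 2 < r) :
    ∃ C : ℝ≥0∞, C ≠ ⊤ ∧ ∀ f : E d → V, Continuous f →
      eLpNorm f 2 μ ^ 2 ≤ C * slobodeckijSq r D f := by
  have hD0 : volume D ≠ 0 := (hDo.measure_pos volume hDn).ne'
  have hDt := volume_ne_top_of_isBounded hDb
  obtain ⟨C, hCt, hC⟩ := exists_eLpNorm_sub_homothetyMean_le (V := V) hd hDo hDc hDb hDn hμD hμ hr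
  obtain ⟨R, hR0, hR⟩ := hDb.closure.subset_closedBall_lt 0 0
  have hμf : μ univ ≠ ⊤ := by
    have h1 : μ univ ≤ μ (Metric.closedBall 0 R) := by
      refine measure_mono_ae ?_
      filter_upwards [hμD] with y hy _
      exact hR hy
    exact (h1.trans_lt ((hμ 0 R hR0).trans_lt (by finiteness))).ne
  refine ⟨2 * (C ^ 2 + (volume D)⁻¹ * μ univ), ?_, fun f hf => ?_⟩
  · have := ENNReal.inv_ne_top.2 hD0
    finiteness
  set m : V := ⨍ x in D, f x with hm
  have h1 : homothetyMean D f 1 = fun _ => m := by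
    funext y
    simp [homothetyMean, hm]
  have h2 := hC f hf
  rw [h1] at h2
  have h3 : eLpNorm (fun y => f y - m) 2 μ ^ 2 ≤ C ^ 2 * gagliardoSq r D f := by
    calc _ ≤ _ := pow_le_pow_left' h2 2
      _ = _ := by
        rw [mul_pow, ← ENNReal.rpow_natCast (_ ^ (1 / 2 : ℝ)), ← ENNReal.rpow_mul]
        norm_num
  have h4 : ‖m‖ₑ ^ 2 ≤ (volume D)⁻¹ * ∫⁻ x in D, ‖f x‖ₑ ^ 2 :=
    enorm_setAverage_sq_le hD0 hDt hf.aestronglyMeasurable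
  have hmeas : Measurable (fun y => ‖f y - m‖ₑ ^ 2) :=
    (Continuous.enorm (by fun_prop)).measurable.pow_const 2
  rw [eLpNorm_two_sq] at h3 ⊢
  calc ∫⁻ y, ‖f y‖ₑ ^ 2 ∂μ ≤ ∫⁻ y, 2 * (‖f y - m‖ₑ ^ 2 + ‖m‖ₑ ^ 2) ∂μ := by
        refine lintegral_mono fun y => ?_
        simpa using enorm_add_sq_le (f y - m) m
    _ = 2 * ((∫⁻ y, ‖f y - m‖ₑ ^ 2 ∂μ) + ‖m‖ₑ ^ 2 * μ univ) := by
        rw [lintegral_const_mul' _ _ (by norm_num), lintegral_add_left hmeas, lintegral_const]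
    _ ≤ 2 * (C ^ 2 * gagliardoSq r D f
          + ((volume D)⁻¹ * ∫⁻ x in D, ‖f x‖ₑ ^ 2) * μ univ) := by gcongr
    -- The cross terms are added only to make the right-hand side factor into a constant and
    -- `slobodeckijSq`.
    _ ≤ 2 * (C ^ 2 * gagliardoSq r D f
          + ((volume D)⁻¹ * ∫⁻ x in D, ‖f x‖ₑ ^ 2) * μ univ)
        + 2 * (C ^ 2 * (∫⁻ x in D, ‖f x‖ₑ ^ 2) + (volume D)⁻¹ * μ univ * gagliardoSq r D f) :=
        le_self_add
    _ = _ := by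
        unfold slobodeckijSq
        ring

end HDG
end

noncomputable section
namespace HDG
variable {d : ℕ} {V : Type*} [NormedAddCommGroup V] [NormedSpace ℝ V]

/-! ### Existence and uniqueness of traces -/

/-- The `(d-1)`-dimensional surface measure. -/
abbrev surf (d : ℕ) : Measure (E d) := Measure.euclideanHausdorffMeasure (d - 1)

/-- The trace inequality of `H^r(D)` on `Γ` for `1/2 < r < 1`. -/
def TraceInequality (V : Type*) [NormedAddCommGroup V] [NormedSpace ℝ V] (D Γ : Set (E d)) : Prop :=
  ∀ r : ℝ, 1 / 2 < r → r < 1 → ∃ C : ℝ≥0∞, C ≠ ⊤ ∧ ∀ f : E d → V, Continuous f →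
    eLpNorm f 2 ((surf d).restrict Γ) ^ 2 ≤ C * slobodeckijSq r D f

theorem TraceInequality.mono {D D' Γ Γ' : Set (E d)} (h : TraceInequality V D Γ) (hD : D ⊆ D')
    (hΓ : Γ' ⊆ Γ) : TraceInequality V D' Γ' := by
  intro r hr hr1
  obtain ⟨C, hC, h⟩ := h r hr hr1
  refine ⟨C, hC, fun f hf => ?_⟩
  calc _ ≤ eLpNorm f 2 ((surf d).restrict Γ) ^ 2 :=
        pow_le_pow_left' (eLpNorm_mono_measure _ (Measure.restrict_mono hΓ le_rfl)) 2
    _ ≤ _ := (h f hf).trans (by gcongr; exact slobodeckijSq_mono_set hD r f)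

theorem memLp_surf {Γ : Set (E d)} (hΓ : Bornology.IsBounded Γ) (hΓm : MeasurableSet Γ)
    (hΓf : surf d Γ ≠ ⊤) {f : E d → V} (hf : Continuous f) : MemLp f 2 ((surf d).restrict Γ) := by
  obtain ⟨C, hC⟩ := hΓ.isCompact_closure.exists_bound_of_continuousOn hf.continuousOn
  have : IsFiniteMeasure ((surf d).restrict Γ) := ⟨by simpa using lt_top_iff_ne_top.2 hΓf⟩
  exact MemLp.of_bound hf.aestronglyMeasurable C
    ((ae_restrict_iff' hΓm).2 (ae_of_all _ fun x hx => hC x (subset_closure hx)))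

theorem sobolevSq_mono_set {D D' : Set (E d)} (h : D' ⊆ D) (hD : IsOpen D) [CompleteSpace V]
    {r : ℝ} (hr : 0 < r) (hr1 : r < 1) (f : E d → V) : sobolevSq r D' f ≤ sobolevSq r D f := by
  rcases eq_or_ne (sobolevSq r D f) ⊤ with ht | ht
  · rw [ht]; exact le_top
  · have hf := memLp_of_sobolevSq_lt_top (lt_top_iff_ne_top.2 ht)
    rw [sobolevSq_eq_slobodeckijSq hD hr hr1 hf]
    exact (sobolevSq_le_slobodeckijSq hr hr1
      (hf.mono_measure (Measure.restrict_mono h le_rfl))).trans (slobodeckijSq_mono_set h r f)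

/-- The same approximating sequence serves the smaller sets. This is what makes the trace of `u`
from `Ω` comparable with its trace from an element. -/
theorem HasTrace.mono {D D' Γ Γ' : Set (E d)} [CompleteSpace V] {f g : E d → V}
    (h : HasTrace D Γ f g) (hD : IsOpen D) (hDD : D' ⊆ D) (hΓ : Γ' ⊆ Γ) : HasTrace D' Γ' f g := by
  obtain ⟨hg, r, hr, hr1, φ, hφ, h1, h2⟩ := h
  refine ⟨hg.mono_measure (Measure.restrict_mono hΓ le_rfl), r, hr, hr1, φ, hφ, ?_, ?_⟩
  · exact tendsto_of_tendsto_of_tendsto_of_le_of_le tendsto_const_nhds h1 (fun _ => zero_le)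
      (fun n => sobolevSq_mono_set hDD hD (by linarith) hr1 _)
  · exact tendsto_of_tendsto_of_tendsto_of_le_of_le tendsto_const_nhds h2 (fun _ => zero_le)
      (fun n => eLpNorm_mono_measure _ (Measure.restrict_mono hΓ le_rfl))

theorem tendsto_eLpNorm_of_sq {ι α W : Type*} [NormedAddCommGroup W] {mα : MeasurableSpace α}
    {μ : Measure α} {l : Filter ι} {f : ι → α → W}
    (h : Tendsto (fun n => eLpNorm (f n) 2 μ ^ 2) l (𝓝 0)) :
    Tendsto (fun n => eLpNorm (f n) 2 μ) l (𝓝 0) := by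
  have := (ENNReal.continuous_rpow_const (y := 1 / 2)).tendsto 0 |>.comp h
  simp only [one_div, inv_pos, Nat.ofNat_pos, ENNReal.zero_rpow_of_pos] at this
  refine this.congr fun n => ?_
  simp only [Function.comp]
  rw [← ENNReal.rpow_natCast, ← ENNReal.rpow_mul]
  norm_num

/-- The trace inequality, applied to differences of the approximations, makes their boundary values
a Cauchy sequence in `L²(Γ)`. The convergence of the given sequence is recorded as well, since
limits in Green's formula are taken along it. -/
theorem hasTrace_of_tendsto {D Γ : Set (E d)} [CompleteSpace V] (hDb : Bornology.IsBounded D)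
    (hΓ : Bornology.IsBounded Γ) (hΓm : MeasurableSet Γ) (hΓf : surf d Γ ≠ ⊤)
    (hT : TraceInequality V D Γ) {r : ℝ} (hr : 1 / 2 < r) (hr1 : r < 1) {φ : ℕ → E d → V}
    (hφ : ∀ n, ContDiff ℝ ∞ (φ n)) {f : E d → V} (hf : MemLp f 2 (volume.restrict D))
    (h : Tendsto (fun n => slobodeckijSq r D (φ n - f)) atTop (𝓝 0)) :
    ∃ g, HasTrace D Γ f g ∧
      Tendsto (fun n => eLpNorm (φ n - g) 2 ((surf d).restrict Γ)) atTop (𝓝 0) := by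
  obtain ⟨C, hC, hT⟩ := hT r hr hr1
  have hφD : ∀ n, MemLp (φ n) 2 (volume.restrict D) := fun n =>
    memLp_two_of_isBounded hDb (hφ n).continuous
  have hφL : ∀ n, MemLp (φ n) 2 ((surf d).restrict Γ) := fun n =>
    memLp_surf hΓ hΓm hΓf (hφ n).continuous
  set F : ℕ → Lp V 2 ((surf d).restrict Γ) := fun n => (hφL n).toLp (φ n) with hF
  have hdist : ∀ m n, edist (F m) (F n) ^ 2
      ≤ C * (2 * (slobodeckijSq r D (φ m - f) + slobodeckijSq r D (φ n - f))) := by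
    intro m n
    rw [hF, Lp.edist_toLp_toLp]
    refine (hT _ ((hφ m).continuous.sub (hφ n).continuous)).trans ?_
    gcongr
    have := slobodeckijSq_sub_le r ((hφD m).1.sub hf.1) ((hφD n).1.sub hf.1)
    rwa [sub_sub_sub_cancel_right] at this
  have hcau : CauchySeq F := by
    rw [EMetric.cauchySeq_iff]
    intro ε hε
    have hlim : Tendsto (fun n => C * (4 * slobodeckijSq r D (φ n - f))) atTop (𝓝 0) := by
      have h1 := ENNReal.Tendsto.const_mul (a := 4) h (Or.inr (by norm_num))
      have h2 := ENNReal.Tendsto.const_mul (a := C) h1 (Or.inr hC)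
      simpa using h2
    have hε2 : 0 < ε ^ 2 := by positivity
    obtain ⟨N, hN⟩ := eventually_atTop.1 (hlim.eventually_lt_const hε2)
    refine ⟨N, fun m hm n hn => ?_⟩
    refine lt_of_not_ge fun hcon => ?_
    refine (lt_irrefl _ ((pow_le_pow_left' hcon 2).trans_lt ((hdist m n).trans_lt ?_)))
    rcases le_total (slobodeckijSq r D (φ m - f)) (slobodeckijSq r D (φ n - f)) with hle | hle
    · refine lt_of_le_of_lt (mul_le_mul' le_rfl ?_) (hN n hn)
      calc _ ≤ 2 * (slobodeckijSq r D (φ n - f) + slobodeckijSq r D (φ n - f)) := by gcongr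
        _ = _ := by ring
    · refine lt_of_le_of_lt (mul_le_mul' le_rfl ?_) (hN m hm)
      calc _ ≤ 2 * (slobodeckijSq r D (φ m - f) + slobodeckijSq r D (φ m - f)) := by gcongr
        _ = _ := by ring
  obtain ⟨G, hG⟩ := cauchySeq_tendsto_of_complete hcau
  have hGt : Tendsto (fun n => eLpNorm (φ n - (G : E d → V)) 2 ((surf d).restrict Γ)) atTop (𝓝 0) := by
    rw [Lp.tendsto_Lp_iff_tendsto_eLpNorm'] at hG
    refine hG.congr fun n => eLpNorm_congr_ae ?_
    filter_upwards [(hφL n).coeFn_toLp] with x hx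
    simp only [Pi.sub_apply, hF, hx]
  refine ⟨G, ⟨Lp.memLp G, r, hr, hr1, φ, hφ, ?_, hGt⟩, hGt⟩
  exact tendsto_of_tendsto_of_tendsto_of_le_of_le tendsto_const_nhds h (fun _ => zero_le)
    (fun n => sobolevSq_le_slobodeckijSq (by linarith) hr1 ((hφD n).sub hf))

/-- The two defining sequences may use different exponents. Both converge in the weaker norm, of
order the minimum of the two, where the trace inequality bounds the difference of their boundary
values. -/
theorem HasTrace.ae_eq {D Γ : Set (E d)} [CompleteSpace V] (hDo : IsOpen D)
    (hDb : Bornology.IsBounded D) (hT : TraceInequality V D Γ) {f g g' : E d → V}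
    (h : HasTrace D Γ f g) (h' : HasTrace D Γ f g') : g =ᵐ[(surf d).restrict Γ] g' := by
  obtain ⟨hg, r, hr, hr1, φ, hφ, h1, h2⟩ := h
  obtain ⟨hg', r', hr', hr1', φ', hφ', h1', h2'⟩ := h'
  set q := min r r' with hq
  have hq1 : q < 1 := (min_le_left _ _).trans_lt hr1
  have hq2 : 1 / 2 < q := lt_min hr hr'
  have hq0 : 0 < q := by linarith
  obtain ⟨C, hC, hT⟩ := hT q hq2 hq1
  have hvol := volume_ne_top_of_isBounded hDb
  obtain ⟨B, hB, hBq⟩ := slobodeckijSq_le_mul_of_le (V := V) hq0 (min_le_left r r') hvol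
  obtain ⟨B', hB', hBq'⟩ := slobodeckijSq_le_mul_of_le (V := V) hq0 (min_le_right r r') hvol
  have e1 : ∀ᶠ n in atTop, eLpNorm (φ n - φ' n) 2 ((surf d).restrict Γ) ^ 2
      ≤ C * (2 * (B * sobolevSq r D (φ n - f) + B' * sobolevSq r' D (φ' n - f))) := by
    -- Measurability of `φ n - f` is only known where its Sobolev norm is finite, that is, for large
    -- `n`.
    filter_upwards [h1.eventually_lt_const (ENNReal.zero_lt_top),
      h1'.eventually_lt_const (ENNReal.zero_lt_top)] with n hn hn'
    have m1 := (memLp_of_sobolevSq_lt_top hn).1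
    have m2 := (memLp_of_sobolevSq_lt_top hn').1
    refine (hT _ ((hφ n).continuous.sub (hφ' n).continuous)).trans ?_
    gcongr
    have h3 := slobodeckijSq_sub_le q m1 m2
    rw [sub_sub_sub_cancel_right] at h3
    refine h3.trans ?_
    gcongr
    · exact (hBq _ m1).trans (by gcongr; exact slobodeckijSq_le_sobolevSq hDo (by linarith) hr1 _)
    · exact (hBq' _ m2).trans (by gcongr; exact slobodeckijSq_le_sobolevSq hDo (by linarith) hr1' _)
  have e2 : Tendsto (fun n => eLpNorm (φ n - φ' n) 2 ((surf d).restrict Γ)) atTop (𝓝 0) := by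
    refine tendsto_eLpNorm_of_sq ?_
    refine tendsto_of_tendsto_of_tendsto_of_le_of_le' tendsto_const_nhds ?_
      (Eventually.of_forall fun _ => zero_le) e1
    have t1 := ENNReal.Tendsto.const_mul (a := B) h1 (Or.inr hB)
    have t2 := ENNReal.Tendsto.const_mul (a := B') h1' (Or.inr hB')
    have t3 := ENNReal.Tendsto.const_mul (a := 2) (t1.add t2) (Or.inr (by norm_num))
    simpa using ENNReal.Tendsto.const_mul (a := C) t3 (Or.inr hC)
  have e3 : eLpNorm (g - g') 2 ((surf d).restrict Γ) ≤ 0 := by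
    refine ge_of_tendsto (x := atTop) (f := fun n => eLpNorm (φ n - g) 2 ((surf d).restrict Γ)
      + (eLpNorm (φ n - φ' n) 2 ((surf d).restrict Γ)
      + eLpNorm (φ' n - g') 2 ((surf d).restrict Γ))) ?_ (Eventually.of_forall fun n => ?_)
    · simpa using h2.add (e2.add h2')
    · have c1 := (hφ n).continuous.aestronglyMeasurable (μ := (surf d).restrict Γ)
      have c2 := (hφ' n).continuous.aestronglyMeasurable (μ := (surf d).restrict Γ)
      have e : g - g' = -(φ n - g) + ((φ n - φ' n) + (φ' n - g')) := by abel
      rw [e]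
      refine (eLpNorm_add_le (c1.sub hg.1).neg ((c1.sub c2).add (c2.sub hg'.1)) (by norm_num)).trans ?_
      rw [eLpNorm_neg]
      gcongr
      exact eLpNorm_add_le (c1.sub c2) (c2.sub hg'.1) (by norm_num)
  have e4 := (eLpNorm_eq_zero_iff (hg.1.sub hg'.1) (by norm_num)).1 (nonpos_iff_eq_zero.1 e3)
  filter_upwards [e4] with x hx
  exact sub_eq_zero.1 hx

theorem hasTrace_trace {D Γ : Set (E d)} {f : E d → V} (h : ∃ g, HasTrace D Γ f g) :
    HasTrace D Γ f (trace D Γ f) := by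
  unfold trace
  rw [dif_pos h]
  exact h.choose_spec

/-- A smooth function is its own trace. -/
theorem hasTrace_of_contDiff {D Γ : Set (E d)} (hDm : MeasurableSet D)
    (hΓ : Bornology.IsBounded Γ) (hΓm : MeasurableSet Γ) (hΓf : surf d Γ ≠ ⊤) {f p : E d → V}
    (hp : ContDiff ℝ ∞ p) (h : EqOn f p D) : HasTrace D Γ f p := by
  refine ⟨memLp_surf hΓ hΓm hΓf hp.continuous, 3 / 4, by norm_num, by norm_num, fun _ => p,
    fun _ => hp, ?_, by simp⟩
  have e : p - f =ᵐ[volume.restrict D] (0 : E d → V) := by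
    refine (ae_restrict_iff' hDm).2 (ae_of_all _ fun x hx => ?_)
    simp [h hx]
  have hm : MemLp (p - f) 2 (volume.restrict D) := (memLp_congr_ae e).2 MemLp.zero
  have h0 : sobolevSq (3 / 4) D (p - f) = 0 := by
    refine le_antisymm ((sobolevSq_le_slobodeckijSq (by norm_num) (by norm_num) hm).trans ?_)
      zero_le
    rw [slobodeckijSq_congr_ae _ e]
    simp [slobodeckijSq, gagliardoSq]
  simp only [h0]
  exact tendsto_const_nhds

end HDG
end

noncomputable section
namespace HDG
variable {d : ℕ} {V : Type*} [NormedAddCommGroup V] [NormedSpace ℝ V]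

/-! ### The Gagliardo semi-norm is controlled by the gradient -/

/-- In polar coordinates the integrand is `y^(1-2θ)` near zero, integrable as `θ < 1`, and
`y^(-1-2θ)` at infinity, integrable as `θ > 0`. -/
theorem integrable_min_norm_div_rpow (hd : 1 ≤ d) {θ : ℝ} (hθ : 0 < θ) (hθ1 : θ < 1) :
    Integrable (fun z : E d => min (‖z‖ ^ 2) 1 / ‖z‖ ^ ((d : ℝ) + 2 * θ)) := by
  have : Nontrivial (E d) := by
    have : Nonempty (Fin d) := ⟨⟨0, hd⟩⟩
    infer_instance
  rw [integrable_fun_norm_addHaar volume (f := fun y => min (y ^ 2) 1 / y ^ ((d : ℝ) + 2 * θ))]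
  simp only [finrank_euclideanSpace, Fintype.card_fin, smul_eq_mul]
  rw [← Ioc_union_Ioi_eq_Ioi (zero_le_one (α := ℝ))]
  refine IntegrableOn.union ?_ ?_
  · have h := (intervalIntegral.intervalIntegrable_rpow' (a := 0) (b := 1)
      (show -1 < 1 - 2 * θ by linarith)).1
    refine h.congr_fun (fun y hy => ?_) measurableSet_Ioc
    have hy0 : 0 < y := hy.1
    have h1 : min (y ^ 2) 1 = y ^ 2 := min_eq_left (pow_le_one₀ hy0.le hy.2)
    simp only [h1]
    rw [mul_div_assoc', ← pow_add, ← Real.rpow_natCast, ← Real.rpow_sub hy0]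
    congr 1
    push_cast [Nat.cast_sub hd]
    ring
  · have h := integrableOn_Ioi_rpow_of_lt (show -1 - 2 * θ < -1 by linarith) one_pos
    refine h.congr_fun (fun y hy => ?_) measurableSet_Ioi
    have hy1 : 1 < y := hy
    have hy0 : 0 < y := by linarith
    have h1 : min (y ^ 2) 1 = 1 := min_eq_right (one_le_pow₀ hy1.le)
    simp only [h1]
    rw [mul_one_div, ← Real.rpow_natCast, ← Real.rpow_sub hy0]
    congr 1
    push_cast [Nat.cast_sub hd]
    ring

theorem enorm_sub_sq_le_lintegral_fderiv [CompleteSpace V] {φ : E d → V} (hφ : ContDiff ℝ 1 φ)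
    (x z : E d) :
    ‖φ x - φ (x + z)‖ₑ ^ 2 ≤ ‖z‖ₑ ^ 2 * ∫⁻ t in Ioc (0 : ℝ) 1, ‖fderiv ℝ φ (x + t • z)‖ₑ ^ 2 := by
  have hc : Continuous (fun t : ℝ => fderiv ℝ φ (x + t • z)) :=
    (hφ.continuous_fderiv one_ne_zero).comp (by fun_prop)
  have h1 : ∫ t in (0 : ℝ)..1, fderiv ℝ φ (x + t • z) z = φ (x + z) - φ x := by
    have := intervalIntegral.integral_eq_sub_of_hasDerivAt (a := 0) (b := 1)
      (f := fun t : ℝ => φ (x + t • z)) (f' := fun t => fderiv ℝ φ (x + t • z) z)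
      (fun t _ => by
        have h2 : HasDerivAt (fun t : ℝ => x + t • z) z t := by
          simpa using ((hasDerivAt_id t).smul_const z).const_add x
        exact ((hφ.differentiable one_ne_zero) _).hasFDerivAt.comp_hasDerivAt t h2)
      ((hc.clm_apply continuous_const).intervalIntegrable _ _)
    simpa using this
  have h2 : ‖φ x - φ (x + z)‖ₑ ≤ ∫⁻ t in Ioc (0 : ℝ) 1, ‖fderiv ℝ φ (x + t • z)‖ₑ * ‖z‖ₑ := by
    rw [← enorm_neg, neg_sub, ← h1, intervalIntegral.integral_of_le zero_le_one]
    refine (enorm_integral_le_lintegral_enorm _).trans (lintegral_mono fun t => ?_)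
    exact ContinuousLinearMap.le_opENorm _ _
  have hm : Measurable (fun t : ℝ => ‖fderiv ℝ φ (x + t • z)‖ₑ) := hc.enorm.measurable
  calc _ ≤ (∫⁻ t in Ioc (0 : ℝ) 1, ‖fderiv ℝ φ (x + t • z)‖ₑ * ‖z‖ₑ) ^ 2 := by gcongr
    _ ≤ 1 * ∫⁻ t in Ioc (0 : ℝ) 1, (‖fderiv ℝ φ (x + t • z)‖ₑ * ‖z‖ₑ) ^ 2 := by
      simpa using sq_lintegral_le (volume.restrict (Ioc (0 : ℝ) 1)) (hm.mul_const ‖z‖ₑ).aemeasurable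
    _ = _ := by
      simp_rw [mul_pow]
      rw [lintegral_mul_const' _ _ (by finiteness), one_mul, mul_comm]

theorem lintegral_translate_difference_le {D : Set (E d)} (hDm : MeasurableSet D)
    {φ : E d → V} (hφ : Continuous φ) (z : E d) :
    ∫⁻ x in D, D.indicator 1 (x + z) * ‖φ x - φ (x + z)‖ₑ ^ 2 ≤ 4 * ∫⁻ x in D, ‖φ x‖ₑ ^ 2 := by
  have hm : Measurable (fun x => ‖φ x‖ₑ ^ 2) := hφ.enorm.measurable.pow_const 2
  calc _ ≤ ∫⁻ x in D, 2 * (‖φ x‖ₑ ^ 2 + D.indicator (fun y => ‖φ y‖ₑ ^ 2) (x + z)) := by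
        refine lintegral_mono fun x => ?_
        by_cases hx : x + z ∈ D
        · simp only [indicator_of_mem hx, Pi.one_apply, one_mul]
          exact enorm_sub_sq_le _ _
        · simp only [indicator_of_notMem hx, zero_mul]
          exact zero_le
    _ = 2 * ((∫⁻ x in D, ‖φ x‖ₑ ^ 2) + ∫⁻ x in D, D.indicator (fun y => ‖φ y‖ₑ ^ 2) (x + z)) := by
        rw [lintegral_const_mul' _ _ (by norm_num), lintegral_add_left hm]
    _ ≤ 2 * ((∫⁻ x in D, ‖φ x‖ₑ ^ 2) + ∫⁻ x in D, ‖φ x‖ₑ ^ 2) := by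
        gcongr 2 * (_ + ?_)
        refine (setLIntegral_le_lintegral _ _).trans ?_
        rw [lintegral_add_right_eq_self (fun x => D.indicator (fun y => ‖φ y‖ₑ ^ 2) x) z,
          lintegral_indicator hDm]
    _ = _ := by ring

/-- Convexity keeps the segment from `x` to `x + z` inside `D`, so the difference is an integral of
the gradient over points of `D`; after Fubini each translate contributes at most the full integral.
The indicator restricts to those `x` whose translate is in `D`. -/
theorem lintegral_translate_difference_le_fderiv [CompleteSpace V] {D : Set (E d)}
    (hDm : MeasurableSet D) (hDc : Convex ℝ D) {φ : E d → V} (hφ : ContDiff ℝ 1 φ) (z : E d) :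
    ∫⁻ x in D, D.indicator 1 (x + z) * ‖φ x - φ (x + z)‖ₑ ^ 2
      ≤ ‖z‖ₑ ^ 2 * ∫⁻ x in D, ‖fderiv ℝ φ x‖ₑ ^ 2 := by
  have hc : Continuous (fun p : E d × ℝ => fderiv ℝ φ (p.1 + p.2 • z)) :=
    (hφ.continuous_fderiv one_ne_zero).comp (by fun_prop)
  have hm : Measurable (fun p : E d × ℝ =>
      D.indicator (fun y => ‖fderiv ℝ φ y‖ₑ ^ 2) (p.1 + p.2 • z)) := by
    have h1 : Measurable (D.indicator (fun y => ‖fderiv ℝ φ y‖ₑ ^ 2)) :=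
      ((hφ.continuous_fderiv one_ne_zero).enorm.measurable.pow_const 2).indicator hDm
    exact h1.comp (by fun_prop)
  calc _ ≤ ∫⁻ x in D, ‖z‖ₑ ^ 2 * ∫⁻ t in Ioc (0 : ℝ) 1,
          D.indicator (fun y => ‖fderiv ℝ φ y‖ₑ ^ 2) (x + t • z) := by
        refine setLIntegral_mono' hDm fun x hx => ?_
        by_cases hxz : x + z ∈ D
        · simp only [indicator_of_mem hxz, Pi.one_apply, one_mul]
          refine (enorm_sub_sq_le_lintegral_fderiv hφ x z).trans (le_of_eq ?_)
          congr 1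
          refine setLIntegral_congr_fun measurableSet_Ioc fun t ht => ?_
          have : x + t • z ∈ D := by
            have := hDc hx hxz (a := 1 - t) (b := t) (by linarith [ht.2]) ht.1.le (by ring)
            rwa [show (1 - t) • x + t • (x + z) = x + t • z by module] at this
          simp only [indicator_of_mem this]
        · simp only [indicator_of_notMem hxz, zero_mul]
          exact zero_le
    _ = ‖z‖ₑ ^ 2 * ∫⁻ t in Ioc (0 : ℝ) 1, ∫⁻ x in D,
          D.indicator (fun y => ‖fderiv ℝ φ y‖ₑ ^ 2) (x + t • z) := by
        rw [lintegral_const_mul' _ _ (by finiteness), lintegral_lintegral_swap hm.aemeasurable]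
    _ ≤ ‖z‖ₑ ^ 2 * ∫⁻ t in Ioc (0 : ℝ) 1, ∫⁻ x in D, ‖fderiv ℝ φ x‖ₑ ^ 2 := by
        refine mul_le_mul' le_rfl (lintegral_mono fun t => ?_)
        refine (setLIntegral_le_lintegral _ _).trans ?_
        rw [lintegral_add_right_eq_self
          (fun x => D.indicator (fun y => ‖fderiv ℝ φ y‖ₑ ^ 2) x) (t • z), lintegral_indicator hDm]
    _ = _ := by simp

/-- With `y = x + z` the semi-norm becomes an integral over `z` of squared translation differences.
These are at most `4 min(‖z‖², 1)` times the squared `H¹` norm, and `min(‖z‖², 1) / ‖z‖^(d+2θ)` is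
integrable. Boundedness of `D` is not needed, so the whole space is allowed. -/
theorem gagliardoSq_le_fderiv (hd : 1 ≤ d) [CompleteSpace V] {D : Set (E d)}
    (hDm : MeasurableSet D) (hDc : Convex ℝ D) {θ : ℝ} (hθ : 0 < θ) (hθ1 : θ < 1) :
    ∃ C : ℝ≥0∞, C ≠ ⊤ ∧ ∀ φ : E d → V, ContDiff ℝ 1 φ → gagliardoSq θ D φ ≤
      C * ((∫⁻ x in D, ‖φ x‖ₑ ^ 2) + ∫⁻ x in D, ‖fderiv ℝ φ x‖ₑ ^ 2) := by
  set k : E d → ℝ := fun z => min (‖z‖ ^ 2) 1 / ‖z‖ ^ ((d : ℝ) + 2 * θ) with hk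
  have hkint : ∫⁻ z, ENNReal.ofReal (k z) ≠ ⊤ := by
    have h := (integrable_min_norm_div_rpow hd hθ hθ1).lintegral_lt_top
    exact h.ne
  refine ⟨(∫⁻ z, ENNReal.ofReal (k z)) * 4, by finiteness, fun φ hφ => ?_⟩
  set L := ∫⁻ x in D, ‖φ x‖ₑ ^ 2
  set S := ∫⁻ x in D, ‖fderiv ℝ φ x‖ₑ ^ 2
  have he : 0 < (d : ℝ) + 2 * θ := by positivity
  have hc := hφ.continuous
  have hm1 : Measurable (fun p : E d × E d => D.indicator (1 : E d → ℝ≥0∞) (p.1 + p.2) *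
      ‖φ p.1 - φ (p.1 + p.2)‖ₑ ^ 2) := by
    have h1 : Measurable (D.indicator (1 : E d → ℝ≥0∞)) := measurable_one.indicator hDm
    have h2 : Measurable (fun p : E d × E d => ‖φ p.1 - φ (p.1 + p.2)‖ₑ ^ 2) :=
      (Continuous.enorm (by fun_prop)).measurable.pow_const 2
    exact (h1.comp (by fun_prop)).mul h2
  have hm2 : Measurable (fun p : E d × E d => (D.indicator (1 : E d → ℝ≥0∞) (p.1 + p.2) *
      ‖φ p.1 - φ (p.1 + p.2)‖ₑ ^ 2) / ‖p.2‖ₑ ^ ((d : ℝ) + 2 * θ)) := hm1.div (by fun_prop)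
  have e1 : gagliardoSq θ D φ = ∫⁻ x in D, ∫⁻ z, (D.indicator (1 : E d → ℝ≥0∞) (x + z) *
      ‖φ x - φ (x + z)‖ₑ ^ 2) / ‖z‖ₑ ^ ((d : ℝ) + 2 * θ) := by
    unfold gagliardoSq
    refine lintegral_congr fun x => ?_
    rw [← lintegral_indicator hDm, ← lintegral_add_left_eq_self _ x]
    refine lintegral_congr fun z => ?_
    by_cases hz : x + z ∈ D
    · simp only [indicator_of_mem hz, Pi.one_apply, one_mul]
      rw [show x - (x + z) = -z by abel, enorm_neg]
    · simp only [indicator_of_notMem hz, zero_mul, ENNReal.zero_div]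
  have hkm : Measurable (fun z => ENNReal.ofReal (k z)) := by
    refine ENNReal.measurable_ofReal.comp ?_
    exact (Measurable.min (by fun_prop) measurable_const).div (by fun_prop)
  rw [e1, lintegral_lintegral_swap hm2.aemeasurable, mul_assoc, ← lintegral_mul_const _ hkm]
  refine lintegral_mono fun z => ?_
  rcases eq_or_ne z 0 with rfl | hz
  · simp
  have hz0 : 0 < ‖z‖ := norm_pos_iff.2 hz
  have e2 : (‖z‖ₑ ^ ((d : ℝ) + 2 * θ))⁻¹ = ENNReal.ofReal (‖z‖ ^ ((d : ℝ) + 2 * θ))⁻¹ := by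
    rw [ENNReal.ofReal_inv_of_pos (by positivity), ← ofReal_norm, ENNReal.ofReal_rpow_of_pos hz0]
  simp_rw [div_eq_mul_inv]
  rw [e2, lintegral_mul_const' _ _ ENNReal.ofReal_ne_top]
  have e3 : ENNReal.ofReal (k z) = ENNReal.ofReal (min (‖z‖ ^ 2) 1)
      * ENNReal.ofReal (‖z‖ ^ ((d : ℝ) + 2 * θ))⁻¹ := by
    rw [← ENNReal.ofReal_mul (by positivity)]
    rfl
  rw [e3, mul_right_comm]
  gcongr
  rcases le_total (‖z‖ ^ 2) 1 with h | h
  · rw [min_eq_left h]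
    refine (lintegral_translate_difference_le_fderiv hDm hDc hφ z).trans ?_
    rw [ENNReal.ofReal_pow (norm_nonneg _), ofReal_norm]
    gcongr
    calc S ≤ S + L := le_self_add
      _ = 1 * (L + S) := by ring
      _ ≤ 4 * (L + S) := by gcongr; norm_num
  · rw [min_eq_right h, ENNReal.ofReal_one, one_mul]
    refine (lintegral_translate_difference_le hDm hc z).trans ?_
    gcongr
    exact le_self_add

theorem enorm_clm_sq_le (L : E d →L[ℝ] V) :
    ‖L‖ₑ ^ 2 ≤ d * ∑ j, ‖L (unitVec j)‖ₑ ^ 2 := by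
  have h1 : ‖L‖ ≤ ∑ j, ‖L (unitVec j)‖ := by
    refine L.opNorm_le_bound (Finset.sum_nonneg fun _ _ => norm_nonneg _) fun v => ?_
    have hv : v = ∑ j, v j • unitVec j := by
      simpa [unitVec] using ((EuclideanSpace.basisFun (Fin d) ℝ).sum_repr v).symm
    conv_lhs => rw [hv]
    rw [map_sum, Finset.sum_mul]
    refine (norm_sum_le _ _).trans (Finset.sum_le_sum fun j _ => ?_)
    rw [map_smul, norm_smul, mul_comm]
    gcongr
    exact PiLp.norm_apply_le v j
  have h2 : ‖L‖ ^ 2 ≤ d * ∑ j, ‖L (unitVec j)‖ ^ 2 := by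
    calc _ ≤ (∑ j, ‖L (unitVec j)‖) ^ 2 := by gcongr
      _ ≤ _ := by
        simpa using sq_sum_le_card_mul_sum_sq (s := Finset.univ) (f := fun j => ‖L (unitVec j)‖)
  have h3 := ENNReal.ofReal_le_ofReal h2
  rw [ENNReal.ofReal_mul (by positivity), ENNReal.ofReal_sum_of_nonneg (fun _ _ => by positivity),
    ENNReal.ofReal_pow (norm_nonneg _), ofReal_norm] at h3
  simpa [ENNReal.ofReal_pow, ofReal_norm] using h3

end HDG
end

noncomputable section
namespace HDG
variable {d : ℕ} {V : Type*} [NormedAddCommGroup V] [NormedSpace ℝ V]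

/-! ### Smoothing on convex sets -/

/-- A mollifier supported in `D`. -/
structure IsMollifier (D : Set (E d)) (η : E d → ℝ) : Prop where
  contDiff : ContDiff ℝ ∞ η
  compact : HasCompactSupport η
  supp : tsupport η ⊆ D
  nonneg : ∀ x, 0 ≤ η x
  integral : ∫ x, η x = 1

theorem exists_isMollifier {D : Set (E d)} (hD : IsOpen D) (hn : D.Nonempty) :
    ∃ η : E d → ℝ, IsMollifier D η := by
  obtain ⟨c, hc⟩ := hn
  obtain ⟨ε, hε, hball⟩ := Metric.isOpen_iff.1 hD c hc
  let b : ContDiffBump c := ⟨ε / 4, ε / 2, by positivity, by linarith⟩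
  refine ⟨b.normed volume, b.contDiff_normed, b.hasCompactSupport_normed, ?_,
    b.nonneg_normed, b.integral_normed⟩
  rw [b.tsupport_normed_eq]
  exact (Metric.closedBall_subset_ball (by change ε / 2 < ε; linarith)).trans hball

/-- The kernel `p ↦ (1-l)^{-d} η((p - l x) / (1 - l))`. -/
def smoothKernel (η : E d → ℝ) (l : ℝ) (y p : E d) : ℝ :=
  ((1 - l) ^ d)⁻¹ * η ((1 - l)⁻¹ • (p - y))

/-- The average of `f(l x + (1 - l) w)` with weight `η(w) dw`. -/
def smoothing (D : Set (E d)) (η : E d → ℝ) (l : ℝ) (f : E d → V) (x : E d) : V :=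
  ∫ p in D, smoothKernel η l (l • x) p • f p

variable {D : Set (E d)} {η : E d → ℝ} {l : ℝ}

theorem IsMollifier.eq_zero (hη : IsMollifier D η) {x : E d} (hx : x ∉ D) : η x = 0 :=
  image_eq_zero_of_notMem_tsupport fun h => hx (hη.supp h)

theorem IsMollifier.lintegral (hη : IsMollifier D η) : ∫⁻ x, ENNReal.ofReal (η x) = 1 := by
  rw [← ofReal_integral_eq_lintegral_ofReal
    (hη.contDiff.continuous.integrable_of_hasCompactSupport hη.compact) (ae_of_all _ hη.nonneg),
    hη.integral, ENNReal.ofReal_one]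

theorem combo_mem (hDc : Convex ℝ D) (hl : 0 < l) (hl1 : l < 1) {x w : E d}
    (hx : x ∈ D) (hw : w ∈ D) : l • x + (1 - l) • w ∈ D :=
  hDc hx hw hl.le (by linarith) (by ring)

/-- Its support consists of points `l x + (1 - l) w` with `w` in the support of `η`, which convexity
places in `D`. Weak derivatives on `D` can therefore be tested with it directly, for every `x ∈ D`,
and no extension of `f` across the boundary enters. -/
theorem isTest_smoothKernel (hDc : Convex ℝ D) (hη : IsMollifier D η)
    (hl : 0 < l) (hl1 : l < 1) {x : E d} (hx : x ∈ D) : IsTest D (smoothKernel η l (l • x)) := by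
  have hk : 0 < 1 - l := by linarith
  have hsub : Function.support (smoothKernel η l (l • x))
      ⊆ (fun w => l • x + (1 - l) • w) '' tsupport η := by
    intro p hp
    refine ⟨(1 - l)⁻¹ • (p - l • x), subset_tsupport _ ?_, ?_⟩
    · intro h
      exact hp (by simp [smoothKernel, h])
    · simp only
      rw [smul_inv_smul₀ hk.ne']
      abel
  have hcomp : IsCompact ((fun w => l • x + (1 - l) • w) '' tsupport η) :=
    hη.compact.image (by fun_prop)
  have hts : tsupport (smoothKernel η l (l • x)) ⊆ (fun w => l • x + (1 - l) • w) '' tsupport η :=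
    closure_minimal hsub hcomp.isClosed
  refine ⟨?_, hcomp.of_isClosed_subset (isClosed_tsupport _) hts, hts.trans ?_⟩
  · unfold smoothKernel
    exact contDiff_const.mul (hη.contDiff.comp (by fun_prop))
  · rintro _ ⟨w, hw, rfl⟩
    exact hDc hx (hη.supp hw) hl.le hk.le (by ring)

/-- This form, with `f` extended by zero, yields smoothness and the formula for the derivative; the
estimates use `smoothing_eq_average` instead. -/
theorem smoothing_eq_convolution (hDm : MeasurableSet D) (f : E d → V) (x : E d) :
    smoothing D η l f x = convolution (fun y => smoothKernel η l y 0) (D.indicator f)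
      (ContinuousLinearMap.lsmul ℝ ℝ) volume (l • x) := by
  rw [convolution_eq_swap, smoothing, ← integral_indicator hDm]
  refine integral_congr_ae (ae_of_all _ fun p => ?_)
  simp only [ContinuousLinearMap.lsmul_apply, smoothKernel]
  rw [show (0 : E d) - (l • x - p) = p - l • x by abel]
  by_cases hp : p ∈ D
  · simp only [indicator_of_mem hp]
  · simp only [indicator_of_notMem hp, smul_zero]

theorem contDiff_kernel (hη : IsMollifier D η) : ContDiff ℝ ∞ (fun y => smoothKernel η l y 0) := by
  unfold smoothKernel
  exact contDiff_const.mul (hη.contDiff.comp (by fun_prop))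

theorem hasCompactSupport_kernel (hη : IsMollifier D η) (hl1 : l < 1) :
    HasCompactSupport (fun y => smoothKernel η l y 0) := by
  have hk : 0 < 1 - l := by linarith
  refine HasCompactSupport.of_support_subset_isCompact
    (hη.compact.image (f := fun w => -((1 - l) • w)) (by fun_prop)) ?_
  intro y hy
  refine ⟨(1 - l)⁻¹ • (0 - y), subset_tsupport _ ?_, ?_⟩
  · intro h
    exact hy (by simp only [smoothKernel, h, mul_zero])
  · simp only
    rw [smul_inv_smul₀ hk.ne']
    abel

theorem integrable_indicator_of_memLp (hDm : MeasurableSet D) (hDb : Bornology.IsBounded D)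
    {f : E d → V} (hf : MemLp f 2 (volume.restrict D)) : Integrable (D.indicator f) := by
  have : IsFiniteMeasure (volume.restrict D) :=
    ⟨by simpa using lt_top_iff_ne_top.2 (volume_ne_top_of_isBounded hDb)⟩
  exact (integrable_indicator_iff hDm).2 (hf.integrable (by norm_num))

theorem contDiff_smoothing (hDm : MeasurableSet D) (hDb : Bornology.IsBounded D)
    (hη : IsMollifier D η) (hl1 : l < 1) {f : E d → V} (hf : MemLp f 2 (volume.restrict D)) :
    ContDiff ℝ ∞ (smoothing D η l f) := by
  have h1 := (hasCompactSupport_kernel hη hl1).contDiff_convolution_left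
    (μ := volume) (ContinuousLinearMap.lsmul ℝ ℝ) (n := ⊤) (contDiff_kernel hη)
    (integrable_indicator_of_memLp hDm hDb hf).locallyIntegrable
  have h2 : smoothing D η l f = (convolution (fun y => smoothKernel η l y 0) (D.indicator f)
      (ContinuousLinearMap.lsmul ℝ ℝ) volume) ∘ (fun x => l • x) := by
    funext x
    exact smoothing_eq_convolution hDm f x
  rw [h2]
  exact h1.comp (by fun_prop)

/-- The kernel depends only on `l x - p`, so a derivative in `x` is `-l` times one in `p`. In this
shape the definition of a weak derivative of `f` applies. -/
theorem fderiv_smoothing [CompleteSpace V] (hDm : MeasurableSet D) (hDb : Bornology.IsBounded D)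
    (hη : IsMollifier D η) (hl1 : l < 1) {f : E d → V} (hf : MemLp f 2 (volume.restrict D))
    (x v : E d) :
    fderiv ℝ (smoothing D η l f) x v
      = - l • ∫ p in D, fderiv ℝ (smoothKernel η l (l • x)) p v • f p := by
  set k : E d → ℝ := fun y => smoothKernel η l y 0 with hk
  have hkc : ContDiff ℝ ∞ k := contDiff_kernel hη
  have hks : HasCompactSupport k := hasCompactSupport_kernel hη hl1
  have hfi := integrable_indicator_of_memLp hDm hDb hf
  have h1 := hks.hasFDerivAt_convolution_left (μ := volume) (ContinuousLinearMap.lsmul ℝ ℝ)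
    (hkc.of_le (by exact_mod_cast le_top)) hfi.locallyIntegrable (l • x)
  have h2 : HasFDerivAt (fun x : E d => l • x) (l • ContinuousLinearMap.id ℝ (E d)) x :=
    (hasFDerivAt_id x).const_smul l
  have h3 := h1.comp x h2
  have h4 : smoothing D η l f = (convolution k (D.indicator f)
      (ContinuousLinearMap.lsmul ℝ ℝ) volume) ∘ (fun x => l • x) := by
    funext x
    exact smoothing_eq_convolution hDm f x
  rw [h4, h3.fderiv]
  simp only [ContinuousLinearMap.comp_smul, ContinuousLinearMap.comp_id,
    smul_apply]
  rw [neg_smul, ← smul_neg, ← integral_neg]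
  congr 1
  rw [convolution_eq_swap, ← integral_indicator hDm]
  have hint : Integrable (fun t => ((ContinuousLinearMap.lsmul ℝ ℝ).precompL (E d)
      (fderiv ℝ k (l • x - t))) (D.indicator f t)) := by
    have hdk : Continuous (fderiv ℝ k) := hkc.continuous_fderiv (by simp)
    exact ((hks.fderiv (𝕜 := ℝ)).convolutionExists_left
      ((ContinuousLinearMap.lsmul ℝ ℝ).precompL (E d)) hdk hfi.locallyIntegrable
      (l • x)).integrable_swap
  rw [ContinuousLinearMap.integral_apply hint]
  refine integral_congr_ae (ae_of_all _ fun p => ?_)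
  have hder : fderiv ℝ (smoothKernel η l (l • x)) p v = - fderiv ℝ k (l • x - p) v := by
    have e : smoothKernel η l (l • x) = fun p => k (l • x - p) := by
      funext p
      simp only [hk, smoothKernel]
      rw [show (0 : E d) - (l • x - p) = p - l • x by abel]
    have hd1 : HasFDerivAt (fun p : E d => l • x - p) (-ContinuousLinearMap.id ℝ (E d)) p := by
      simpa using (hasFDerivAt_id p).const_sub (l • x)
    have hd2 := ((hkc.differentiable (by simp)) (l • x - p)).hasFDerivAt.comp p hd1
    rw [e]
    change fderiv ℝ (k ∘ fun p => l • x - p) p v = _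
    rw [hd2.fderiv]
    simp
  by_cases hp : p ∈ D
  · simp only [indicator_of_mem hp, hder, neg_smul, neg_neg]
    rfl
  · simp only [indicator_of_notMem hp, map_zero, zero_apply]

theorem integral_comp_smul_add {c : ℝ} (hc : 0 < c) (b : E d) (F : E d → V) :
    ∫ w, F (c • w + b) = (c ^ d)⁻¹ • ∫ p, F p := by
  have h1 := Measure.integral_comp_smul (μ := (volume : Measure (E d))) (fun w => F (w + b)) c
  rw [h1, integral_add_right_eq_self (fun p => F p) b]
  simp only [finrank_euclideanSpace, Fintype.card_fin]
  rw [abs_of_pos (by positivity)]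

theorem smoothing_eq_average (hDc : Convex ℝ D)
    (hη : IsMollifier D η) (hl : 0 < l) (hl1 : l < 1) (f : E d → V) {x : E d} (hx : x ∈ D) :
    smoothing D η l f x = ∫ w, η w • f (l • x + (1 - l) • w) := by
  have hk : 0 < 1 - l := by linarith
  have h1 : smoothing D η l f x = ∫ p, smoothKernel η l (l • x) p • f p := by
    refine setIntegral_eq_integral_of_forall_compl_eq_zero fun p hp => ?_
    rw [image_eq_zero_of_notMem_tsupport
      (fun h => hp ((isTest_smoothKernel hDc hη hl hl1 hx).2.2 h)), zero_smul]
  rw [h1]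
  have h2 := integral_comp_smul_add hk (l • x) (fun p => η ((1 - l)⁻¹ • (p - l • x)) • f p)
  simp only [add_sub_cancel_right, inv_smul_smul₀ hk.ne'] at h2
  simp only [smoothKernel, mul_smul, integral_smul]
  rw [← h2]
  simp only [add_comm]

end HDG
end

/-! ### Bounds for the smoothing and its convergence in `L²`. -/

noncomputable section
namespace HDG
variable {d : ℕ} {V : Type*} [NormedAddCommGroup V] [NormedSpace ℝ V]
variable {D : Set (E d)} {η : E d → ℝ} {l : ℝ}

theorem lintegral_comp_combo_le (hDm : MeasurableSet D) (hDc : Convex ℝ D) (hl : 0 < l)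
    (hl1 : l < 1) {w : E d} (hw : w ∈ D) (φ : E d → ℝ≥0∞) :
    ∫⁻ x in D, φ (l • x + (1 - l) • w) ≤ ENNReal.ofReal (l ^ d)⁻¹ * ∫⁻ p in D, φ p := by
  rw [← lintegral_indicator hDm, ← lintegral_indicator hDm,
    ← lintegral_comp_smul_add hl ((1 - l) • w)]
  refine lintegral_mono fun x => ?_
  by_cases hx : x ∈ D
  · rw [indicator_of_mem hx, indicator_of_mem (combo_mem hDc hl hl1 hx hw)]
  · rw [indicator_of_notMem hx]
    exact zero_le

theorem enorm_integral_smul_sq_le (hη : IsMollifier D η) {F : E d → V}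
    (hF : StronglyMeasurable F) :
    ‖∫ w, η w • F w‖ₑ ^ 2 ≤ ∫⁻ w, ENNReal.ofReal (η w) * ‖F w‖ₑ ^ 2 := by
  have hηm : AEMeasurable (fun w => ENNReal.ofReal (η w)) :=
    (ENNReal.measurable_ofReal.comp hη.contDiff.continuous.measurable).aemeasurable
  have h1 : ‖∫ w, η w • F w‖ₑ ≤ ∫⁻ w, ENNReal.ofReal (η w) * ‖F w‖ₑ := by
    refine (enorm_integral_le_lintegral_enorm _).trans (le_of_eq (lintegral_congr fun w => ?_))
    rw [enorm_smul, Real.enorm_eq_ofReal (hη.nonneg w)]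
  calc _ ≤ _ := pow_le_pow_left' h1 2
    _ ≤ _ := sq_lintegral_mul_le volume hηm hF.enorm.aemeasurable
    _ = _ := by rw [hη.lintegral, one_mul]

theorem lintegral_smoothing_sq_le (hDm : MeasurableSet D) (hDc : Convex ℝ D)
    (hη : IsMollifier D η) (hl : 0 < l) (hl1 : l < 1) {f : E d → V} (hf : StronglyMeasurable f) :
    ∫⁻ x in D, ‖smoothing D η l f x‖ₑ ^ 2
      ≤ ENNReal.ofReal (l ^ d)⁻¹ * ∫⁻ x in D, ‖f x‖ₑ ^ 2 := by
  have hm : Measurable (fun p : E d × E d =>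
      ENNReal.ofReal (η p.2) * ‖f (l • p.1 + (1 - l) • p.2)‖ₑ ^ 2) := by
    have h1 : Measurable (fun x => ‖f x‖ₑ ^ 2) := hf.enorm.pow_const 2
    have h2 : Measurable (fun x => ENNReal.ofReal (η x)) :=
      ENNReal.measurable_ofReal.comp hη.contDiff.continuous.measurable
    exact (h2.comp measurable_snd).mul (h1.comp (by fun_prop))
  calc _ ≤ ∫⁻ x in D, ∫⁻ w, ENNReal.ofReal (η w) * ‖f (l • x + (1 - l) • w)‖ₑ ^ 2 := by
        refine setLIntegral_mono' hDm fun x hx => ?_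
        rw [smoothing_eq_average hDc hη hl hl1 f hx]
        exact enorm_integral_smul_sq_le hη (hf.comp_measurable (by fun_prop))
    _ = ∫⁻ w, ∫⁻ x in D, ENNReal.ofReal (η w) * ‖f (l • x + (1 - l) • w)‖ₑ ^ 2 :=
        lintegral_lintegral_swap hm.aemeasurable
    _ ≤ ∫⁻ w, ENNReal.ofReal (η w) * (ENNReal.ofReal (l ^ d)⁻¹ * ∫⁻ x in D, ‖f x‖ₑ ^ 2) := by
        refine lintegral_mono fun w => ?_
        simp only
        rw [lintegral_const_mul' _ _ ENNReal.ofReal_ne_top]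
        by_cases hw : w ∈ D
        · gcongr
          exact lintegral_comp_combo_le hDm hDc hl hl1 hw (fun p => ‖f p‖ₑ ^ 2)
        · rw [hη.eq_zero hw, ENNReal.ofReal_zero, zero_mul, zero_mul]
    _ = _ := by
        have h2 : Measurable (fun x => ENNReal.ofReal (η x)) :=
          ENNReal.measurable_ofReal.comp hη.contDiff.continuous.measurable
        rw [lintegral_mul_const _ h2, hη.lintegral, one_mul]

theorem integrable_smul_comp_combo (hDm : MeasurableSet D) (hDb : Bornology.IsBounded D)
    (hDc : Convex ℝ D) (hη : IsMollifier D η) (hl : 0 < l) (hl1 : l < 1) {f : E d → V}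
    (hf : MemLp f 2 (volume.restrict D)) {x : E d} (hx : x ∈ D) :
    Integrable (fun w => η w • f (l • x + (1 - l) • w)) := by
  have hk : 0 < 1 - l := by linarith
  have h0 := integrable_indicator_of_memLp hDm hDb hf
  have h1 : Integrable (fun w => D.indicator f (l • x + (1 - l) • w)) := by
    have := ((h0.comp_add_left (l • x)).comp_smul hk.ne')
    exact this
  obtain ⟨C, hC⟩ := hη.compact.exists_bound_of_continuous hη.contDiff.continuous
  have h2 : Integrable (fun w => η w • D.indicator f (l • x + (1 - l) • w)) :=
    h1.bdd_smul C hη.contDiff.continuous.aestronglyMeasurable (ae_of_all _ hC)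
  refine h2.congr (ae_of_all _ fun w => ?_)
  by_cases hw : w ∈ D
  · simp only [indicator_of_mem (combo_mem hDc hl hl1 hx hw)]
  · simp only [hη.eq_zero hw, zero_smul]

/-- For fixed `w` the map `x ↦ l x + (1 - l) w` sends `D` into `D` and contracts distances, so it
can only increase the kernel's weight. Jensen's inequality in `w` reduces to this case, and the
change of variables costs `l^(-d)` once for each of the two points. -/
theorem gagliardoSq_smoothing_le (hDm : MeasurableSet D) (hDb : Bornology.IsBounded D)
    (hDc : Convex ℝ D) (hη : IsMollifier D η) (hl : 0 < l) (hl1 : l < 1) {θ : ℝ} (hθ : 0 < θ)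
    {f : E d → V} (hf : StronglyMeasurable f) (hf2 : MemLp f 2 (volume.restrict D)) :
    gagliardoSq θ D (smoothing D η l f) ≤ ENNReal.ofReal (l ^ d)⁻¹ ^ 2 * gagliardoSq θ D f := by
  have hηm : Measurable (fun x => ENNReal.ofReal (η x)) :=
    ENNReal.measurable_ofReal.comp hη.contDiff.continuous.measurable
  have hgm : Measurable (gagKernel θ f) := by
    have h1 : StronglyMeasurable (fun p : E d × E d => f p.1 - f p.2) :=
      (hf.comp_measurable measurable_fst).sub (hf.comp_measurable measurable_snd)
    exact (h1.enorm.pow_const 2).div (by fun_prop)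
  have he : 0 < (d : ℝ) + 2 * θ := by positivity
  set K : E d → E d → E d → ℝ≥0∞ := fun x y w => ENNReal.ofReal (η w) *
    gagKernel θ f (l • x + (1 - l) • w, l • y + (1 - l) • w) with hK
  have hKm : Measurable (fun p : (E d × E d) × E d => K p.1.1 p.2 p.1.2) := by
    refine (hηm.comp (measurable_snd.comp measurable_fst)).mul (hgm.comp ?_)
    fun_prop
  have hKm' : ∀ x, Measurable (fun p : E d × E d => K x p.1 p.2) := fun x => by
    refine (hηm.comp measurable_snd).mul (hgm.comp ?_)
    fun_prop
  have hpt : ∀ x ∈ D, ∀ y ∈ D, ‖smoothing D η l f x - smoothing D η l f y‖ₑ ^ 2 /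
      ‖x - y‖ₑ ^ ((d : ℝ) + 2 * θ) ≤ ∫⁻ w, K x y w := by
    intro x hx y hy
    rw [smoothing_eq_average hDc hη hl hl1 f hx, smoothing_eq_average hDc hη hl hl1 f hy,
      ← integral_sub (integrable_smul_comp_combo hDm hDb hDc hη hl hl1 hf2 hx)
        (integrable_smul_comp_combo hDm hDb hDc hη hl hl1 hf2 hy)]
    simp_rw [← smul_sub]
    have hFm : StronglyMeasurable
        (fun w => f (l • x + (1 - l) • w) - f (l • y + (1 - l) • w)) :=
      (hf.comp_measurable (by fun_prop)).sub (hf.comp_measurable (by fun_prop))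
    calc _ ≤ (∫⁻ w, ENNReal.ofReal (η w) *
            ‖f (l • x + (1 - l) • w) - f (l • y + (1 - l) • w)‖ₑ ^ 2) /
            ‖x - y‖ₑ ^ ((d : ℝ) + 2 * θ) := by
          gcongr
          exact enorm_integral_smul_sq_le hη hFm
      _ = ∫⁻ w, ENNReal.ofReal (η w) *
            ‖f (l • x + (1 - l) • w) - f (l • y + (1 - l) • w)‖ₑ ^ 2 *
            (‖x - y‖ₑ ^ ((d : ℝ) + 2 * θ))⁻¹ := by
          have hm : Measurable (fun w => ENNReal.ofReal (η w) *
            ‖f (l • x + (1 - l) • w) - f (l • y + (1 - l) • w)‖ₑ ^ 2) :=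
            hηm.mul (hFm.enorm.pow_const 2)
          rw [lintegral_mul_const _ hm, div_eq_mul_inv]
      _ ≤ _ := by
          refine lintegral_mono fun w => ?_
          simp only [hK, gagKernel]
          rw [mul_assoc, ← div_eq_mul_inv]
          gcongr
          rw [show l • x + (1 - l) • w - (l • y + (1 - l) • w) = l • (x - y) by module, enorm_smul]
          refine mul_le_of_le_one_left' ?_
          rw [Real.enorm_eq_ofReal hl.le]
          exact ENNReal.ofReal_le_one.2 hl1.le
  calc _ ≤ ∫⁻ x in D, ∫⁻ y in D, ∫⁻ w, K x y w := by
        refine setLIntegral_mono' hDm fun x hx => setLIntegral_mono' hDm fun y hy => hpt x hx y hy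
    _ = ∫⁻ x in D, ∫⁻ w, ∫⁻ y in D, K x y w :=
        lintegral_congr fun x => lintegral_lintegral_swap (hKm' x).aemeasurable
    _ = ∫⁻ w, ∫⁻ x in D, ∫⁻ y in D, K x y w := by
        refine lintegral_lintegral_swap (Measurable.aemeasurable ?_)
        exact hKm.lintegral_prod_right'
    _ ≤ ∫⁻ w, ENNReal.ofReal (η w) *
          (ENNReal.ofReal (l ^ d)⁻¹ ^ 2 * gagliardoSq θ D f) := by
        refine lintegral_mono fun w => ?_
        by_cases hw : w ∈ D
        · calc _ = ENNReal.ofReal (η w) * ∫⁻ x in D, ∫⁻ y in D,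
                gagKernel θ f (l • x + (1 - l) • w, l • y + (1 - l) • w) := by
                simp only [hK]
                rw [← lintegral_const_mul' _ _ ENNReal.ofReal_ne_top]
                refine lintegral_congr fun x => ?_
                rw [lintegral_const_mul' _ _ ENNReal.ofReal_ne_top]
            _ ≤ ENNReal.ofReal (η w) * ∫⁻ x in D, ENNReal.ofReal (l ^ d)⁻¹ * ∫⁻ q in D,
                gagKernel θ f (l • x + (1 - l) • w, q) := by
                gcongr with x
                exact lintegral_comp_combo_le hDm hDc hl hl1 hw
                  (fun q => gagKernel θ f (l • x + (1 - l) • w, q))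
            _ = ENNReal.ofReal (η w) * (ENNReal.ofReal (l ^ d)⁻¹ * ∫⁻ x in D, ∫⁻ q in D,
                gagKernel θ f (l • x + (1 - l) • w, q)) := by
                rw [lintegral_const_mul' _ _ ENNReal.ofReal_ne_top]
            _ ≤ ENNReal.ofReal (η w) * (ENNReal.ofReal (l ^ d)⁻¹ *
                (ENNReal.ofReal (l ^ d)⁻¹ * gagliardoSq θ D f)) := by
                gcongr
                exact lintegral_comp_combo_le hDm hDc hl hl1 hw
                  (fun p => ∫⁻ q in D, gagKernel θ f (p, q))
            _ = _ := by ring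
        · simp only [hK, hη.eq_zero hw, ENNReal.ofReal_zero, zero_mul, lintegral_zero, le_refl]
    _ = _ := by rw [lintegral_mul_const _ hηm, hη.lintegral, one_mul]

theorem smoothing_congr_ae {f g : E d → V} (h : f =ᵐ[volume.restrict D] g) :
    smoothing D η l f = smoothing D η l g := by
  funext x
  exact integral_congr_ae (h.mono fun p hp => by simp only [hp])

theorem eLpNorm_smoothing_le (hDm : MeasurableSet D) (hDc : Convex ℝ D)
    (hη : IsMollifier D η) (hl : 1 / 2 ≤ l) (hl1 : l < 1) {f : E d → V}
    (hf : MemLp f 2 (volume.restrict D)) :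
    eLpNorm (smoothing D η l f) 2 (volume.restrict D)
      ≤ ENNReal.ofReal (2 ^ d) * eLpNorm f 2 (volume.restrict D) := by
  have hl0 : 0 < l := by linarith
  refine eLpNorm_le_of_sq_le ?_
  obtain ⟨g, hg, hfg⟩ := hf.1
  rw [mul_pow, eLpNorm_two_sq, smoothing_congr_ae hfg, eLpNorm_congr_ae hfg, eLpNorm_two_sq]
  refine (lintegral_smoothing_sq_le hDm hDc hη hl0 hl1 hg).trans ?_
  gcongr
  rw [← ENNReal.ofReal_pow (by positivity)]
  refine ENNReal.ofReal_le_ofReal ?_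
  calc (l ^ d)⁻¹ ≤ ((1 / 2) ^ d)⁻¹ := by gcongr
    _ = 2 ^ d := by rw [one_div, inv_pow, inv_inv]
    -- The factor `2^(d/2)` would suffice for the norm; `2 ^ d` avoids the root.
    _ ≤ (2 ^ d) ^ 2 := by
      have : (1 : ℝ) ≤ 2 ^ d := one_le_pow₀ (by norm_num)
      nlinarith

theorem smoothing_sub (hDb : Bornology.IsBounded D)
    (hη : IsMollifier D η) {f g : E d → V}
    (hf : MemLp f 2 (volume.restrict D)) (hg : MemLp g 2 (volume.restrict D)) (x : E d) :
    smoothing D η l (f - g) x = smoothing D η l f x - smoothing D η l g x := by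
  have hc : Continuous (smoothKernel η l (l • x)) := by
    unfold smoothKernel
    exact continuous_const.mul (hη.contDiff.continuous.comp (by fun_prop))
  have hk : MemLp (smoothKernel η l (l • x)) 2 (volume.restrict D) :=
    memLp_two_of_isBounded hDb hc
  unfold smoothing
  rw [← integral_sub (integrable_smul_of_memLp_two hk hf) (integrable_smul_of_memLp_two hk hg)]
  simp only [Pi.sub_apply, smul_sub]

theorem eLpNorm_smoothing_sub_le_of_continuous [CompleteSpace V] (hDm : MeasurableSet D)
    (hDc : Convex ℝ D) (hη : IsMollifier D η) (hl : 0 < l) (hl1 : l < 1)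
    {g : E d → V} (hg : Continuous g) {δ : ℝ}
    (hδ : ∀ x ∈ D, ∀ w ∈ D, ‖g (l • x + (1 - l) • w) - g x‖ ≤ δ) :
    eLpNorm (smoothing D η l g - g) 2 (volume.restrict D)
      ≤ volume D ^ (1 / 2 : ℝ) * ENNReal.ofReal δ := by
  have hpt : ∀ᵐ x ∂(volume.restrict D), ‖(smoothing D η l g - g) x‖ ≤ δ := by
    refine (ae_restrict_iff' hDm).2 (ae_of_all _ fun x hx => ?_)
    have i0 : Integrable η := hη.contDiff.continuous.integrable_of_hasCompactSupport hη.compact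
    have i1 : Integrable (fun w => η w • g (l • x + (1 - l) • w)) :=
      Continuous.integrable_of_hasCompactSupport
        (hη.contDiff.continuous.smul (hg.comp (by fun_prop))) hη.compact.smul_right
    have i2 : Integrable (fun w => η w • g x) := i0.smul_const _
    have h1 : ∫ w, η w • g x = g x := by rw [integral_smul_const, hη.integral, one_smul]
    rw [Pi.sub_apply, smoothing_eq_average hDc hη hl hl1 g hx]
    conv_lhs => rw [← h1]
    rw [← integral_sub i1 i2]
    calc _ ≤ ∫ w, η w * δ := by
          refine norm_integral_le_of_norm_le (i0.mul_const δ) (ae_of_all _ fun w => ?_)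
          rw [← smul_sub, norm_smul, Real.norm_of_nonneg (hη.nonneg w)]
          by_cases hw : w ∈ D
          · exact mul_le_mul_of_nonneg_left (hδ x hx w hw) (hη.nonneg w)
          · simp [hη.eq_zero hw]
      _ = δ := by rw [integral_mul_const, hη.integral, one_mul]
  refine (eLpNorm_le_of_ae_bound hpt).trans (le_of_eq ?_)
  norm_num

/-- Density argument: the smoothings are uniformly bounded on `L²(D)`, and for a continuous function
of compact support they converge uniformly on `D`, since `l x + (1 - l) w` is at distance at most
`(1 - l) · 2R` from `x`. -/
theorem tendsto_smoothing [CompleteSpace V] (hDo : IsOpen D) (hDb : Bornology.IsBounded D)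
    (hDc : Convex ℝ D) (hη : IsMollifier D η) {a : ℕ → ℝ} (ha : ∀ n, 1 / 2 ≤ a n)
    (ha1 : ∀ n, a n < 1) (hat : Tendsto a atTop (𝓝 1)) {f : E d → V}
    (hf : MemLp f 2 (volume.restrict D)) :
    Tendsto (fun n => eLpNorm (smoothing D η (a n) f - f) 2 (volume.restrict D)) atTop (𝓝 0) := by
  have hDm := hDo.measurableSet
  have hvol := volume_ne_top_of_isBounded hDb
  rw [ENNReal.tendsto_nhds_zero]
  intro ε hε
  -- Three errors are added below: the smoothing of `f - g`, which costs `2 ^ d`, the error for the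
  -- continuous `g`, and `f - g` itself.
  set A : ℝ≥0∞ := ENNReal.ofReal (2 ^ d) + 2 with hA
  have hA0 : A ≠ 0 := by simp [hA]
  have hAt : A ≠ ⊤ := by finiteness
  have hε' : ε / A ≠ 0 := (ENNReal.div_pos hε.ne' hAt).ne'
  have : (volume.restrict D).Regular := Measure.Regular.restrict_of_measure_ne_top hvol
  obtain ⟨g, hgs, hfg, hgc, hg⟩ := hf.exists_hasCompactSupport_eLpNorm_sub_le (by norm_num) hε'
  have hlim : Tendsto (fun n => eLpNorm (smoothing D η (a n) g - g) 2 (volume.restrict D))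
      atTop (𝓝 0) := by
    have huc := hgc.uniformContinuous_of_tendsto_cocompact hgs.is_zero_at_infty
    obtain ⟨R, hR⟩ := hDb.exists_norm_le
    have key : ∀ δ : ℝ, 0 < δ → ∀ᶠ n in atTop,
        eLpNorm (smoothing D η (a n) g - g) 2 (volume.restrict D)
          ≤ volume D ^ (1 / 2 : ℝ) * ENNReal.ofReal δ := by
      intro δ hδ
      obtain ⟨r, hr, hrδ⟩ := Metric.uniformContinuous_iff.1 huc δ hδ
      have h1 : Tendsto (fun n => (1 - a n) * (2 * R)) atTop (𝓝 0) := by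
        simpa using (hat.const_sub 1).mul_const (2 * R)
      filter_upwards [h1.eventually_lt_const hr] with n hn
      refine eLpNorm_smoothing_sub_le_of_continuous hDm hDc hη (by linarith [ha n]) (ha1 n) hgc
        fun x hx w hw => ?_
      rw [← dist_eq_norm]
      refine (hrδ ?_).le
      rw [dist_eq_norm, show a n • x + (1 - a n) • w - x = (1 - a n) • (w - x) by module,
        norm_smul, Real.norm_of_nonneg (by linarith [ha1 n])]
      refine lt_of_le_of_lt ?_ hn
      have := ha1 n
      refine mul_le_mul_of_nonneg_left ?_ (by linarith)
      exact (norm_sub_le _ _).trans (by linarith [hR x hx, hR w hw])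
    rw [ENNReal.tendsto_nhds_zero]
    intro ε2 hε2
    have h2 : Tendsto (fun δ : ℝ => volume D ^ (1 / 2 : ℝ) * ENNReal.ofReal δ) (𝓝[>] 0) (𝓝 0) := by
      have h3 : Tendsto (fun δ : ℝ => ENNReal.ofReal δ) (𝓝[>] 0) (𝓝 0) := by
        have := (ENNReal.continuous_ofReal.tendsto 0).mono_left
          (nhdsWithin_le_nhds (s := Ioi (0 : ℝ)))
        simpa using this
      simpa using ENNReal.Tendsto.const_mul h3
        (Or.inr (ENNReal.rpow_ne_top_of_nonneg (by norm_num) hvol))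
    obtain ⟨δ, hδ, hδ0⟩ := ((ENNReal.tendsto_nhds_zero.1 h2 ε2 hε2).and self_mem_nhdsWithin).exists
    filter_upwards [key δ hδ0] with n hn
    exact hn.trans hδ
  filter_upwards [ENNReal.tendsto_nhds_zero.1 hlim (ε / A) (pos_iff_ne_zero.2 hε')] with n hn
  have hsm : ∀ {h : E d → V}, MemLp h 2 (volume.restrict D) →
      AEStronglyMeasurable (smoothing D η (a n) h) (volume.restrict D) := fun {h} hh =>
    (contDiff_smoothing hDm hDb hη (ha1 n) hh).continuous.aestronglyMeasurable
  have e : smoothing D η (a n) f - f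
      = smoothing D η (a n) (f - g) + ((smoothing D η (a n) g - g) - (f - g)) := by
    funext x
    simp only [Pi.add_apply, Pi.sub_apply, smoothing_sub hDb hη hf hg]
    abel
  rw [e]
  calc _ ≤ eLpNorm (smoothing D η (a n) (f - g)) 2 (volume.restrict D)
        + (eLpNorm (smoothing D η (a n) g - g) 2 (volume.restrict D)
          + eLpNorm (f - g) 2 (volume.restrict D)) := by
        refine (eLpNorm_add_le (hsm (hf.sub hg))
          (((hsm hg).sub hg.1).sub (hf.sub hg).1) (by norm_num)).trans ?_
        gcongr
        exact eLpNorm_sub_le ((hsm hg).sub hg.1) (hf.sub hg).1 (by norm_num)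
    _ ≤ ENNReal.ofReal (2 ^ d) * (ε / A) + (ε / A + ε / A) := by
        gcongr
        refine (eLpNorm_smoothing_le hDm hDc hη (ha n) (ha1 n) (hf.sub hg)).trans ?_
        gcongr
    _ = A * (ε / A) := by rw [hA]; ring
    _ = ε := ENNReal.mul_div_cancel hA0 hAt

end HDG
end

noncomputable section
namespace HDG
variable {d : ℕ} {V : Type*} [NormedAddCommGroup V] [NormedSpace ℝ V]
variable {D : Set (E d)} {η : E d → ℝ} {l : ℝ}

/-! ### Smooth approximation in Sobolev spaces -/

theorem fderiv_smoothing_of_hasWeakDeriv [CompleteSpace V] (hDm : MeasurableSet D)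
    (hDb : Bornology.IsBounded D) (hDc : Convex ℝ D) (hη : IsMollifier D η) (hl : 0 < l)
    (hl1 : l < 1) {f g : E d → V} {j : Fin d} (h : HasWeakDeriv D (fun _ : Fin 1 => j) f g)
    {x : E d} (hx : x ∈ D) :
    fderiv ℝ (smoothing D η l f) x (unitVec j) = l • smoothing D η l g x := by
  have h1 := h.2.2 _ (isTest_smoothKernel hDc hη hl hl1 hx)
  simp only [iteratedFDeriv_one_apply, pow_one, neg_smul, one_smul] at h1
  rw [fderiv_smoothing hDm hDb hη hl1 h.1, h1, smoothing, neg_smul, smul_neg, neg_neg]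

/-- The entry `τ_{ij}` as a continuous linear functional. -/
def entryL (i j : Fin d) : Sym d →L[ℝ] ℝ :=
  (EuclideanSpace.proj (i, j)).comp (symSubmodule d).subtypeL

/-- The coordinate `v_i` as a continuous linear functional. -/
def coordL (i : Fin d) : E d →L[ℝ] ℝ := EuclideanSpace.proj i

@[simp] theorem coordL_apply (i : Fin d) (v : E d) : coordL i v = v i := rfl

@[simp] theorem entryL_apply (i j : Fin d) (τ : Sym d) : entryL i j τ = entry τ i j := rfl

/-- `w` is the weak row-wise divergence on `D` of `σ`. -/
def HasWeakDiv (D : Set (E d)) (σ : E d → Sym d) (w : E d → E d) : Prop :=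
  MemLp σ 2 (volume.restrict D) ∧ MemLp w 2 (volume.restrict D) ∧
  ∀ φ : E d → ℝ, IsTest D φ → ∀ i : Fin d,
    ∫ x in D, ∑ j, entry (σ x) i j * fderiv ℝ φ x (unitVec j) = - ∫ x in D, w x i * φ x

theorem IsTest.memLp_fderiv {D' : Set (E d)} {φ : E d → V} (h : IsTest D' φ) (v : E d) :
    MemLp (fun x => fderiv ℝ φ x v) 2 (volume.restrict D) :=
  (Continuous.memLp_of_hasCompactSupport
    ((h.1.continuous_fderiv (by simp)).clm_apply continuous_const)
    ((h.2.1.fderiv (𝕜 := ℝ)).comp_left (g := fun L : E d →L[ℝ] V => L v) rfl)).restrict D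

theorem IsTest.memLp {W : Type*} [NormedAddCommGroup W] [NormedSpace ℝ W] {D' : Set (E d)}
    {φ : E d → W} (h : IsTest D' φ) : MemLp φ 2 (volume.restrict D) :=
  (h.1.continuous.memLp_of_hasCompactSupport h.2.1).restrict D

/-- The kernel is an admissible test function in the definition of the weak divergence, so the
divergence of the smoothing is `l` times the smoothing of the divergence, although the individual
derivatives of `σ` need not exist. -/
theorem div_smoothing_of_hasWeakDiv (hDm : MeasurableSet D)
    (hDb : Bornology.IsBounded D) (hDc : Convex ℝ D) (hη : IsMollifier D η) (hl : 0 < l)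
    (hl1 : l < 1) {σ : E d → Sym d} {w : E d → E d} (h : HasWeakDiv D σ w)
    {x : E d} (hx : x ∈ D) (i : Fin d) :
    ∑ j, entry (fderiv ℝ (smoothing D η l σ) x (unitVec j)) i j
      = l * smoothing D η l w x i := by
  have ht := isTest_smoothKernel hDc hη hl hl1 hx
  have h1 := h.2.2 _ ht i
  have hint : ∀ j, Integrable (fun p => fderiv ℝ (smoothKernel η l (l • x)) p (unitVec j) • σ p)
      (volume.restrict D) := fun j =>
    integrable_smul_of_memLp_two (ht.memLp_fderiv (D := D) _) h.1
  have hint2 : Integrable (fun p => smoothKernel η l (l • x) p • w p) (volume.restrict D) :=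
    integrable_smul_of_memLp_two (ht.memLp (D := D)) h.2.1
  have e1 : ∀ j, entry (fderiv ℝ (smoothing D η l σ) x (unitVec j)) i j
      = -l * ∫ p in D, entry (σ p) i j * fderiv ℝ (smoothKernel η l (l • x)) p (unitVec j) := by
    intro j
    rw [fderiv_smoothing hDm hDb hη hl1 h.1, ← entryL_apply, map_smul,
      ← ContinuousLinearMap.integral_comp_comm _ (hint j), smul_eq_mul]
    congr 1
    refine integral_congr_ae (ae_of_all _ fun p => ?_)
    simp only [map_smul, entryL_apply, smul_eq_mul, mul_comm]
  have hint3 : ∀ j, Integrable (fun p => entry (σ p) i j *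
      fderiv ℝ (smoothKernel η l (l • x)) p (unitVec j)) (volume.restrict D) := fun j => by
    refine ((entryL i j).integrable_comp (hint j)).congr (ae_of_all _ fun p => ?_)
    simp only [map_smul, entryL_apply, smul_eq_mul, mul_comm]
  have e2 : smoothing D η l w x i = ∫ p in D, w p i * smoothKernel η l (l • x) p := by
    have := (coordL i).integral_comp_comm hint2
    simp only [map_smul, coordL_apply, smul_eq_mul] at this
    rw [smoothing, ← this]
    simp only [mul_comm]
  simp_rw [e1]
  rw [← Finset.mul_sum, ← integral_finsetSum _ (fun j _ => hint3 j), h1, e2]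
  ring

/-- Smoothing parameters tending to `1`. -/
def smoothParam (n : ℕ) : ℝ := 1 - 1 / ((n : ℝ) + 2)

theorem smoothParam_lt_one (n : ℕ) : smoothParam n < 1 := by
  unfold smoothParam
  have : (0 : ℝ) < 1 / ((n : ℝ) + 2) := by positivity
  linarith

theorem half_le_smoothParam (n : ℕ) : 1 / 2 ≤ smoothParam n := by
  unfold smoothParam
  have : 1 / ((n : ℝ) + 2) ≤ 1 / 2 := by
    gcongr
    have : (0 : ℝ) ≤ n := by positivity
    linarith
  linarith

theorem smoothParam_pos (n : ℕ) : 0 < smoothParam n := by linarith [half_le_smoothParam n]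

theorem tendsto_smoothParam : Tendsto smoothParam atTop (𝓝 1) := by
  unfold smoothParam
  have h : Tendsto (fun n : ℕ => 1 / ((n : ℝ) + 2)) atTop (𝓝 0) := by
    have := (tendsto_const_nhds (x := (1 : ℝ))).div_atTop
      (tendsto_atTop_add_const_right atTop (2 : ℝ) (tendsto_natCast_atTop_atTop (R := ℝ)))
    exact this
  simpa using h.const_sub 1

/-- The embedding of `H¹` in `H^θ` on a convex set: the gradient of the smoothing is `l` times the
smoothing of the gradient, hence bounded in `L²`, and the resulting bound on the semi-norm passes to
the limit by Fatou. -/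
theorem gagliardoSq_lt_top_of_hasWeakDeriv [CompleteSpace V] (hd : 1 ≤ d) (hDo : IsOpen D)
    (hDb : Bornology.IsBounded D) (hDc : Convex ℝ D) (hDn : D.Nonempty) {θ : ℝ} (hθ : 0 < θ)
    (hθ1 : θ < 1) {f : E d → V} {g : Fin d → E d → V}
    (hf : MemLp f 2 (volume.restrict D))
    (hg : ∀ j, HasWeakDeriv D (fun _ : Fin 1 => j) f (g j)) : gagliardoSq θ D f < ⊤ := by
  obtain ⟨η, hη⟩ := exists_isMollifier hDo hDn
  have hDm := hDo.measurableSet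
  obtain ⟨C, hC, hCφ⟩ := gagliardoSq_le_fderiv (V := V) hd hDm hDc hθ hθ1
  set A : ℝ≥0∞ := ENNReal.ofReal (2 ^ d) with hA
  have hsm : ∀ n, ContDiff ℝ ∞ (smoothing D η (smoothParam n) f) := fun n =>
    contDiff_smoothing hDm hDb hη (smoothParam_lt_one n) hf
  refine lt_of_le_of_lt (gagliardoSq_le_of_tendsto θ hf.1
    (fun n => (hsm n).continuous.aestronglyMeasurable)
    (tendsto_smoothing hDo hDb hDc hη half_le_smoothParam smoothParam_lt_one
      tendsto_smoothParam hf)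
    (M := C * ((A * eLpNorm f 2 (volume.restrict D)) ^ 2 +
      d * ∑ j, (A * eLpNorm (g j) 2 (volume.restrict D)) ^ 2)) fun n => ?_) ?_
  · refine (hCφ _ ((hsm n).of_le (by exact_mod_cast le_top))).trans ?_
    gcongr
    · rw [← eLpNorm_two_sq]
      gcongr
      exact eLpNorm_smoothing_le hDm hDc hη (half_le_smoothParam n) (smoothParam_lt_one n) hf
    · calc _ ≤ ∫⁻ x in D, d * ∑ j, ‖smoothing D η (smoothParam n) (g j) x‖ₑ ^ 2 := by
            refine setLIntegral_mono' hDm fun x hx => (enorm_clm_sq_le _).trans ?_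
            gcongr with j
            rw [fderiv_smoothing_of_hasWeakDeriv hDm hDb hDc hη (smoothParam_pos n)
              (smoothParam_lt_one n) (hg j) hx, enorm_smul]
            refine mul_le_of_le_one_left' ?_
            rw [Real.enorm_eq_ofReal (smoothParam_pos n).le]
            exact ENNReal.ofReal_le_one.2 (smoothParam_lt_one n).le
        _ = d * ∑ j, ∫⁻ x in D, ‖smoothing D η (smoothParam n) (g j) x‖ₑ ^ 2 := by
            rw [lintegral_const_mul' _ _ (by finiteness), lintegral_finsetSum]
            intro j _
            exact (contDiff_smoothing hDm hDb hη (smoothParam_lt_one n)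
              (hg j).2.1).continuous.enorm.measurable.pow_const 2
        _ ≤ _ := by
            gcongr with j
            rw [← eLpNorm_two_sq]
            gcongr
            exact eLpNorm_smoothing_le hDm hDc hη (half_le_smoothParam n) (smoothParam_lt_one n)
              (hg j).2.1
  · refine ENNReal.mul_lt_top (lt_top_iff_ne_top.2 hC) (ENNReal.add_lt_top.2 ⟨?_, ?_⟩)
    · exact ENNReal.pow_lt_top (ENNReal.mul_lt_top ENNReal.ofReal_lt_top hf.2)
    · refine ENNReal.mul_lt_top (by finiteness) (ENNReal.sum_lt_top.2 fun j _ => ?_)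
      exact ENNReal.pow_lt_top (ENNReal.mul_lt_top ENNReal.ofReal_lt_top (hg j).2.1.2)

/-- Reduces every `s > 1/2` to one exponent in `(1/2, 1)`: `s` itself if it is less than one;
otherwise first derivatives are available and any exponent, such as `3/4`, will do. -/
theorem exists_gagliardoSq_lt_top_of_sobolevSq [CompleteSpace V] (hd : 1 ≤ d) (hDo : IsOpen D)
    (hDb : Bornology.IsBounded D) (hDc : Convex ℝ D) (hDn : D.Nonempty) {s : ℝ} (hs : 1 / 2 < s)
    {f : E d → V} (h : sobolevSq s D f < ⊤) :
    ∃ θ : ℝ, 1 / 2 < θ ∧ θ < 1 ∧ gagliardoSq θ D f < ⊤ := by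
  rcases lt_or_ge s 1 with hs1 | hs1
  · refine ⟨s, hs, hs1, lt_of_le_of_lt ?_ h⟩
    exact le_add_self.trans (slobodeckijSq_le_sobolevSq hDo (by linarith) hs1 f)
  · refine ⟨3 / 4, by norm_num, by norm_num, ?_⟩
    have hf := memLp_of_sobolevSq_lt_top h
    unfold sobolevSq at h
    obtain ⟨G, hG⟩ := iInf_lt_iff.1 h
    obtain ⟨hG', -⟩ := iInf_lt_iff.1 hG
    exact gagliardoSq_lt_top_of_hasWeakDeriv hd hDo hDb hDc hDn (by norm_num) (by norm_num) hf
      (fun j => hG' 1 (Nat.one_le_floor_iff _ |>.2 hs1) (fun _ => j))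

/-- The smoothings are bounded in `H^θ` and converge in `L²`, hence converge in `H^r` for the
midpoint `r` of `1/2` and `θ`, which is still enough for the trace inequality. -/
theorem exists_hasTrace_of_gagliardoSq [CompleteSpace V] (hDo : IsOpen D)
    (hDb : Bornology.IsBounded D) (hDc : Convex ℝ D) (hη : IsMollifier D η) {Γ : Set (E d)}
    (hΓ : Bornology.IsBounded Γ) (hΓm : MeasurableSet Γ) (hΓf : surf d Γ ≠ ⊤)
    (hT : TraceInequality V D Γ) {θ : ℝ} (hθ : 1 / 2 < θ) (hθ1 : θ < 1) {f : E d → V}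
    (hfm : StronglyMeasurable f) (hf : MemLp f 2 (volume.restrict D))
    (hfθ : gagliardoSq θ D f < ⊤) :
    ∃ g, HasTrace D Γ f g ∧
      Tendsto (fun n => eLpNorm (smoothing D η (smoothParam n) f - g) 2 ((surf d).restrict Γ))
        atTop (𝓝 0) := by
  have hDm := hDo.measurableSet
  have hsm : ∀ n, ContDiff ℝ ∞ (smoothing D η (smoothParam n) f) := fun n =>
    contDiff_smoothing hDm hDb hη (smoothParam_lt_one n) hf
  refine hasTrace_of_tendsto hDb hΓ hΓm hΓf hT (r := (1 / 2 + θ) / 2) (by linarith) (by linarith)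
    hsm hf ?_
  refine tendsto_slobodeckijSq_of_bounded (s := θ) (by linarith) (by linarith)
    (volume_ne_top_of_isBounded hDb) hf.1 (fun n => (hsm n).continuous.aestronglyMeasurable)
    (tendsto_smoothing hDo hDb hDc hη half_le_smoothParam smoothParam_lt_one
      tendsto_smoothParam hf) (M := ENNReal.ofReal (2 ^ d) ^ 2 * gagliardoSq θ D f)
    (ENNReal.mul_ne_top (by finiteness) hfθ.ne) fun n => ?_
  refine (gagliardoSq_smoothing_le hDm hDb hDc hη (smoothParam_pos n) (smoothParam_lt_one n)
    (by linarith) hfm hf).trans ?_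
  gcongr
  calc ((smoothParam n) ^ d)⁻¹ ≤ ((1 / 2) ^ d)⁻¹ := by
        gcongr
        exact half_le_smoothParam n
    _ = 2 ^ d := by rw [one_div, inv_pow, inv_inv]

/-! ### Functions in `H¹₀` -/

theorem tendsto_integral_of_norm_sub_le {α W W' : Type*} {mα : MeasurableSpace α} {μ : Measure α}
    [NormedAddCommGroup W] [NormedAddCommGroup W'] [NormedSpace ℝ W]
    {F : ℕ → α → W} {F0 : α → W} (hF : ∀ n, Integrable (F n) μ) (hF0 : Integrable F0 μ)
    {f : ℕ → α → W'} (hf : ∀ n, AEStronglyMeasurable (f n) μ)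
    (hft : Tendsto (fun n => eLpNorm (f n) 2 μ) atTop (𝓝 0)) {c : α → ℝ} (hc : MemLp c 2 μ)
    (h : ∀ n, ∀ᵐ x ∂μ, ‖F n x - F0 x‖ ≤ c x * ‖f n x‖) :
    Tendsto (fun n => ∫ x, F n x ∂μ) atTop (𝓝 (∫ x, F0 x ∂μ)) := by
  refine tendsto_integral_of_L1 _ hF0.1 (Eventually.of_forall hF) ?_
  have h1 : Tendsto (fun n => eLpNorm c 2 μ * eLpNorm (f n) 2 μ) atTop (𝓝 0) := by
    simpa using ENNReal.Tendsto.const_mul hft (Or.inr hc.2.ne)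
  refine tendsto_of_tendsto_of_tendsto_of_le_of_le tendsto_const_nhds h1 (fun _ => zero_le)
    fun n => ?_
  calc ∫⁻ x, ‖F n x - F0 x‖ₑ ∂μ ≤ ∫⁻ x, ‖c x * ‖f n x‖‖ₑ ∂μ := by
        refine lintegral_mono_ae ((h n).mono fun x hx => ?_)
        rw [← ofReal_norm, ← ofReal_norm]
        exact ENNReal.ofReal_le_ofReal (hx.trans (Real.le_norm_self _))
    _ = eLpNorm (c • fun x => ‖f n x‖) 1 μ := by
        rw [eLpNorm_one_eq_lintegral_enorm]
        rfl
    _ ≤ eLpNorm c 2 μ * eLpNorm (fun x => ‖f n x‖) 2 μ :=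
        eLpNorm_smul_le_mul_eLpNorm (hf n).norm hc.1
    _ = _ := by rw [eLpNorm_norm]

theorem tendsto_integral_smul {α : Type*} {mα : MeasurableSpace α} {μ : Measure α}
    {a : α → ℝ} (ha : MemLp a 2 μ) {f : ℕ → α → V} {f0 : α → V} (hf : ∀ n, MemLp (f n) 2 μ)
    (hf0 : MemLp f0 2 μ) (h : Tendsto (fun n => eLpNorm (fun x => f n x - f0 x) 2 μ) atTop (𝓝 0)) :
    Tendsto (fun n => ∫ x, a x • f n x ∂μ) atTop (𝓝 (∫ x, a x • f0 x ∂μ)) := by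
  refine tendsto_integral_of_norm_sub_le (fun n => integrable_smul_of_memLp_two ha (hf n))
    (integrable_smul_of_memLp_two ha hf0) (fun n => ((hf n).sub hf0).1) h ha.norm
    (fun n => ae_of_all _ fun x => ?_)
  rw [← smul_sub, norm_smul, Pi.sub_apply]

theorem IsTest.integral_smul_fderiv {Ω : Set (E d)} {ψ : E d → ℝ} {φ : E d → V}
    (hψ : IsTest Ω ψ) (hφ : IsTest Ω φ) (v : E d) :
    ∫ x in Ω, fderiv ℝ ψ x v • φ x = - ∫ x in Ω, ψ x • fderiv ℝ φ x v := by
  have i1 := integrable_smul_of_memLp_two (hψ.memLp_fderiv (D := univ) v) (hφ.memLp (D := univ))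
  have i2 := integrable_smul_of_memLp_two (hψ.memLp (D := univ)) (hφ.memLp_fderiv (D := univ) v)
  have i3 := integrable_smul_of_memLp_two (hψ.memLp (D := univ)) (hφ.memLp (D := univ))
  rw [Measure.restrict_univ] at i1 i2 i3
  have h := integral_smul_fderiv_eq_neg_fderiv_smul_of_integrable i1 i2 i3
    (fun x _ => (hψ.1.differentiable (by simp)) x) (fun x _ => (hφ.1.differentiable (by simp)) x)
  have e1 : ∫ x in Ω, fderiv ℝ ψ x v • φ x = ∫ x, fderiv ℝ ψ x v • φ x :=
    setIntegral_eq_integral_of_forall_compl_eq_zero fun x hx => by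
      rw [image_eq_zero_of_notMem_tsupport (fun h => hx (hφ.2.2 h)), smul_zero]
  have e2 : ∫ x in Ω, ψ x • fderiv ℝ φ x v = ∫ x, ψ x • fderiv ℝ φ x v :=
    setIntegral_eq_integral_of_forall_compl_eq_zero fun x hx => by
      rw [image_eq_zero_of_notMem_tsupport (fun h => hx (hψ.2.2 h)), zero_smul]
  rw [e1, e2, h, neg_neg]

theorem IsH10.hasWeakDeriv {Ω : Set (E d)} {v : L2 Ω (E d)} {g : Fin d → L2 Ω (E d)}
    (h : IsH10 Ω v g) (j : Fin d) : HasWeakDeriv Ω (fun _ : Fin 1 => j) v (g j) := by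
  obtain ⟨φ, hφ, h1, h2⟩ := h
  refine ⟨Lp.memLp v, Lp.memLp (g j), fun ψ hψ => ?_⟩
  simp only [iteratedFDeriv_one_apply, pow_one, neg_smul, one_smul]
  have t1 := tendsto_integral_smul (hψ.memLp_fderiv (D := Ω) (unitVec j))
    (fun n => (hφ n).memLp (D := Ω)) (Lp.memLp v) h1
  have t2 := tendsto_integral_smul (hψ.memLp (D := Ω))
    (fun n => (hφ n).memLp_fderiv (D := Ω) (unitVec j)) (Lp.memLp (g j)) (h2 j)
  have e : ∀ n, ∫ x in Ω, fderiv ℝ ψ x (unitVec j) • φ n x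
      = - ∫ x in Ω, ψ x • fderiv ℝ (φ n) x (unitVec j) := fun n =>
    hψ.integral_smul_fderiv (hφ n) _
  simp_rw [e] at t1
  exact tendsto_nhds_unique t1 t2.neg

/-- `Ω` need not be convex, but a test function vanishes outside `Ω`, so the gradient bound can be
applied on the whole space. -/
theorem IsTest.gagliardoSq_le (hd : 1 ≤ d) [CompleteSpace V] (Ω : Set (E d)) (hΩ : IsOpen Ω)
    {θ : ℝ} (hθ : 0 < θ) (hθ1 : θ < 1) :
    ∃ C : ℝ≥0∞, C ≠ ⊤ ∧ ∀ φ : E d → V, IsTest Ω φ → gagliardoSq θ Ω φ ≤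
      C * (eLpNorm φ 2 (volume.restrict Ω) ^ 2 +
        d * ∑ j, eLpNorm (fun x => fderiv ℝ φ x (unitVec j)) 2 (volume.restrict Ω) ^ 2) := by
  obtain ⟨C, hC, hCφ⟩ := gagliardoSq_le_fderiv (V := V) hd MeasurableSet.univ convex_univ hθ hθ1
  refine ⟨C, hC, fun φ hφ => ?_⟩
  have hm := hΩ.measurableSet
  have key : ∀ F : E d → ℝ≥0∞, (∀ x ∉ Ω, F x = 0) → ∫⁻ x in univ, F x = ∫⁻ x in Ω, F x := by
    intro F hF
    rw [Measure.restrict_univ, ← lintegral_indicator hm]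
    refine lintegral_congr fun x => ?_
    by_cases hx : x ∈ Ω
    · rw [indicator_of_mem hx]
    · rw [indicator_of_notMem hx, hF x hx]
  refine (gagliardoSq_mono_set (subset_univ Ω) θ φ).trans
    ((hCφ φ (hφ.1.of_le (by exact_mod_cast le_top))).trans ?_)
  rw [key _ (fun x hx => by
      rw [image_eq_zero_of_notMem_tsupport (fun h => hx (hφ.2.2 h))]; simp),
    key _ (fun x hx => by
      rw [image_eq_zero_of_notMem_tsupport (fun h => hx (hφ.2.2 (tsupport_fderiv_subset ℝ h)))]
      exact (pow_eq_zero_iff two_ne_zero).2 (by rw [← ofReal_norm]; simp)), eLpNorm_two_sq]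
  gcongr
  calc _ ≤ ∫⁻ x in Ω, d * ∑ j, ‖fderiv ℝ φ x (unitVec j)‖ₑ ^ 2 :=
        lintegral_mono fun x => enorm_clm_sq_le _
    _ = _ := by
        rw [lintegral_const_mul' _ _ (by finiteness), lintegral_finsetSum]
        · simp_rw [eLpNorm_two_sq]
        · intro j _
          exact ((hφ.1.continuous_fderiv (by simp)).clm_apply
            continuous_const).enorm.measurable.pow_const 2

theorem eLpNorm_le_of_sub_le_one {α W : Type*} [NormedAddCommGroup W] {mα : MeasurableSpace α}
    {μ : Measure α} {f g : α → W} (hf : AEStronglyMeasurable f μ) (hg : AEStronglyMeasurable g μ)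
    (h : eLpNorm (fun x => f x - g x) 2 μ ≤ 1) : eLpNorm f 2 μ ≤ 1 + eLpNorm g 2 μ := by
  calc eLpNorm f 2 μ = eLpNorm ((fun x => f x - g x) + g) 2 μ := by
        congr 1; funext x; simp
    _ ≤ _ := (eLpNorm_add_le (hf.sub hg) hg (by norm_num)).trans (by gcongr; exact h)

/-- The test functions of the definition are bounded in `H¹`, hence in `H^((r+1)/2)`, and converge
in `L²`. The convergence takes place on all of `Ω`, thus at once on every element. -/
theorem IsH10.tendsto_slobodeckijSq (hd : 1 ≤ d) {Ω : Set (E d)} (hΩ : IsOpen Ω)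
    (hΩb : Bornology.IsBounded Ω) {v : L2 Ω (E d)} {g : Fin d → L2 Ω (E d)}
    (h : IsH10 Ω v g) {r : ℝ} (hr : 0 < r) (hr1 : r < 1) :
    ∃ φ : ℕ → E d → E d, (∀ n, ContDiff ℝ ∞ (φ n)) ∧
      Tendsto (fun n => slobodeckijSq r Ω (φ n - (v : E d → E d))) atTop (𝓝 0) := by
  obtain ⟨φ, hφ, h1, h2⟩ := h
  obtain ⟨C, hC, hCφ⟩ := IsTest.gagliardoSq_le (V := E d) hd Ω hΩ (θ := (r + 1) / 2)
    (by linarith) (by linarith)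
  have ev : ∀ᶠ n in atTop, eLpNorm (fun x => φ n x - v x) 2 (volume.restrict Ω) ≤ 1 ∧
      ∀ j, eLpNorm (fun x => fderiv ℝ (φ n) x (unitVec j) - g j x) 2 (volume.restrict Ω) ≤ 1 := by
    refine (h1.eventually_le_const zero_lt_one).and (eventually_all.2 fun j => ?_)
    exact (h2 j).eventually_le_const zero_lt_one
  obtain ⟨N, hN⟩ := eventually_atTop.1 ev
  -- Dropping the first `N` terms makes the bound hold for every index.
  refine ⟨fun n => φ (n + N), fun n => (hφ _).1, ?_⟩
  refine tendsto_slobodeckijSq_of_bounded (s := (r + 1) / 2) hr (by linarith)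
    (volume_ne_top_of_isBounded hΩb) (Lp.memLp v).1 (fun n => ((hφ _).memLp (D := Ω)).1)
    ((tendsto_add_atTop_iff_nat N).2 h1)
    (M := C * ((1 + eLpNorm v 2 (volume.restrict Ω)) ^ 2 +
      d * ∑ j, (1 + eLpNorm (g j) 2 (volume.restrict Ω)) ^ 2)) ?_ fun n => ?_
  · have a1 : eLpNorm v 2 (volume.restrict Ω) ≠ ⊤ := (Lp.memLp v).2.ne
    refine ENNReal.mul_ne_top hC (ENNReal.add_ne_top.2 ⟨by finiteness, ?_⟩)
    refine ENNReal.mul_ne_top (by finiteness) (ENNReal.sum_ne_top.2 fun j _ => ?_)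
    have a2 : eLpNorm (g j) 2 (volume.restrict Ω) ≠ ⊤ := (Lp.memLp (g j)).2.ne
    finiteness
  · obtain ⟨b1, b2⟩ := hN (n + N) (Nat.le_add_left _ _)
    refine (hCφ _ (hφ _)).trans ?_
    gcongr with j
    · exact eLpNorm_le_of_sub_le_one ((hφ _).memLp (D := Ω)).1 (Lp.memLp v).1 b1
    · exact eLpNorm_le_of_sub_le_one ((hφ _).memLp_fderiv (D := Ω) _).1 (Lp.memLp (g j)).1 (b2 j)

theorem IsH10.exists_hasTrace (hd : 1 ≤ d) {Ω : Set (E d)} (hΩ : IsOpen Ω)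
    (hΩb : Bornology.IsBounded Ω) {v : L2 Ω (E d)} {g : Fin d → L2 Ω (E d)}
    (h : IsH10 Ω v g) {D' Γ : Set (E d)} (hD : D' ⊆ Ω) (hΓ : Bornology.IsBounded Γ)
    (hΓm : MeasurableSet Γ) (hΓf : surf d Γ ≠ ⊤) (hT : TraceInequality (E d) D' Γ) :
    ∃ g, HasTrace D' Γ v g := by
  obtain ⟨φ, hφ, h1⟩ := h.tendsto_slobodeckijSq hd hΩ hΩb (r := 3 / 4) (by norm_num) (by norm_num)
  obtain ⟨g, hg, -⟩ := hasTrace_of_tendsto (hΩb.subset hD) hΓ hΓm hΓf hT (r := 3 / 4) (by norm_num)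
    (by norm_num) hφ ((Lp.memLp v).mono_measure (Measure.restrict_mono hD le_rfl))
    (tendsto_of_tendsto_of_tendsto_of_le_of_le tendsto_const_nhds h1 (fun _ => zero_le)
      (fun n => slobodeckijSq_mono_set hD _ _))
  exact ⟨g, hg⟩

end HDG
end

noncomputable section
namespace HDG
variable {d : ℕ} {V : Type*} [NormedAddCommGroup V] [NormedSpace ℝ V]

/-! ### Surface measure on hyperplanes -/

/-- The hyperplane `⟪n, x⟫ = c`. -/
def hyperplane (n : E d) (c : ℝ) : Set (E d) := {x | ⟪n, x⟫_ℝ = c}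

theorem mem_hyperplane {n x : E d} {c : ℝ} : x ∈ hyperplane n c ↔ ⟪n, x⟫_ℝ = c := Iff.rfl

theorem isClosed_hyperplane (n : E d) (c : ℝ) : IsClosed (hyperplane n c) :=
  isClosed_eq (by fun_prop) continuous_const

theorem inner_self_unit {n : E d} (hn : ‖n‖ = 1) : ⟪n, n⟫_ℝ = 1 := by
  rw [real_inner_self_eq_norm_sq, hn, one_pow]

/-- Fubini along the normal, with the distance to the base point measured in units of `h`. For a
cone of height `h` the slice at `x` is then the homothetic copy of ratio `x` of the base. -/
theorem volume_eq_lintegral_slice {n : E d} (hn : ‖n‖ = 1) {h : ℝ} (hh : 0 < h) (p : E d)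
    {t : Set (E d)} (ht : MeasurableSet t) :
    volume t = ENNReal.ofReal h * ∫⁻ x : ℝ, surf d (t ∩ {z | ⟪n, z - p⟫_ℝ = x * h}) := by
  have hn0 : n ≠ 0 := by
    rintro rfl
    simp at hn
  have hv : h • n ≠ 0 := smul_ne_zero hh.ne' hn0
  have key := EuclideanGeometry.euclideanHausdorffMeasure_eq_lintegral p hv ht
  rw [InnerProductSpace.euclideanHausdorffMeasure_eq_volume, finrank_euclideanSpace_fin] at key
  rw [key, enorm_smul, ← ofReal_norm n, hn, ENNReal.ofReal_one, mul_one,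
    Real.enorm_eq_ofReal hh.le]
  congr 1
  refine lintegral_congr fun x => ?_
  congr 2
  ext z
  rw [SetLike.mem_coe, AffineSubspace.mem_mk', Submodule.mem_orthogonal_singleton_iff_inner_right,
    mem_ofPred_eq, vsub_eq_sub, vadd_eq_add, real_inner_smul_left, mul_eq_zero,
    or_iff_right hh.ne', show z - (x • h • n + p) = (z - p) - (x * h) • n by module, inner_sub_right,
    real_inner_smul_right, inner_self_unit hn, mul_one, sub_eq_zero]

theorem surf_image_add (v : E d) (s : Set (E d)) : surf d ((fun x => x + v) '' s) = surf d s :=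
  (IsometryEquiv.addRight v).isometry.euclideanHausdorffMeasure_image s

/-- The open prism of height `a` in direction `n` above the subset `F` of `hyperplane n c`. -/
def prism (n : E d) (c a : ℝ) (F : Set (E d)) : Set (E d) :=
  {z | ⟪n, z⟫_ℝ - c ∈ Ioo 0 a ∧ z - (⟪n, z⟫_ℝ - c) • n ∈ F}

theorem measurableSet_prism {n : E d} {c a : ℝ} {F : Set (E d)} (hF : MeasurableSet F) :
    MeasurableSet (prism n c a F) :=
  (measurableSet_Ioo.preimage (by fun_prop : Measurable fun z : E d => ⟪n, z⟫_ℝ - c)).inter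
    (hF.preimage (by fun_prop : Measurable fun z : E d => z - (⟪n, z⟫_ℝ - c) • n))

/-- Every slice is a translate of `F`. Questions about the surface measure of flat sets thus become
questions about volume, both for the growth on balls and for the null relative boundary of convex
sets. -/
theorem volume_prism {n : E d} (hn : ‖n‖ = 1) {c a : ℝ} {F : Set (E d)}
    (hF : MeasurableSet F) (hFc : F ⊆ hyperplane n c) :
    volume (prism n c a F) = ENNReal.ofReal a * surf d F := by
  rw [volume_eq_lintegral_slice hn one_pos (c • n) (measurableSet_prism hF), ENNReal.ofReal_one,
    one_mul]
  have e : ∀ x : ℝ, surf d (prism n c a F ∩ {z | ⟪n, z - c • n⟫_ℝ = x * 1})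
      = (Ioo 0 a).indicator (fun _ => surf d F) x := by
    intro x
    have hs : ∀ z : E d, ⟪n, z - c • n⟫_ℝ = ⟪n, z⟫_ℝ - c := fun z => by
      rw [inner_sub_right, real_inner_smul_right, inner_self_unit hn, mul_one]
    simp only [hs, mul_one]
    by_cases hx : x ∈ Ioo 0 a
    · rw [indicator_of_mem hx, ← surf_image_add (x • n) F]
      congr 1
      ext z
      constructor
      · rintro ⟨⟨-, hz⟩, hzx⟩
        rw [mem_ofPred_eq] at hzx
        rw [hzx] at hz
        exact ⟨_, hz, by simp⟩
      · rintro ⟨y, hy, rfl⟩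
        have e1 : ⟪n, y + x • n⟫_ℝ - c = x := by
          rw [inner_add_right, real_inner_smul_right, inner_self_unit hn, mem_hyperplane.1 (hFc hy)]
          ring
        refine ⟨⟨?_, ?_⟩, e1⟩
        · rwa [e1]
        · simpa [e1] using hy
    · rw [indicator_of_notMem hx]
      convert measure_empty (μ := surf d)
      refine eq_empty_of_forall_notMem ?_
      rintro z ⟨⟨hz, -⟩, hzx⟩
      rw [mem_ofPred_eq] at hzx
      exact hx (hzx ▸ hz)
  simp_rw [e]
  rw [lintegral_indicator measurableSet_Ioo, lintegral_const, Measure.restrict_apply_univ,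
    Real.volume_Ioo, sub_zero, mul_comm]

/-- The growth constant of the surface measure on hyperplanes. -/
theorem exists_surf_inter_closedBall_le (hd : 1 ≤ d) :
    ∃ A : ℝ≥0, ∀ (n : E d) (c : ℝ) (F : Set (E d)), ‖n‖ = 1 → MeasurableSet F →
      F ⊆ hyperplane n c → ∀ (p : E d) (ρ : ℝ), 0 < ρ →
        surf d (F ∩ Metric.closedBall p ρ) ≤ A * ENNReal.ofReal (ρ ^ (d - 1)) := by
  have hB : volume (Metric.ball (0 : E d) 1) ≠ ⊤ := Metric.isBounded_ball.measure_lt_top.ne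
  -- The prism of height `ρ` over the part of `F` in the ball of radius `ρ` fits into the ball of
  -- radius `2 ρ`; dividing volumes by `ρ` gives this constant.
  refine ⟨2 ^ d * (volume (Metric.ball (0 : E d) 1)).toNNReal, fun n c F hn hF hFc p ρ hρ => ?_⟩
  have h1 := volume_prism hn (a := ρ) (hF.inter (Metric.isClosed_closedBall (x := p)
    (ε := ρ)).measurableSet) (inter_subset_left.trans hFc)
  have h2 : prism n c ρ (F ∩ Metric.closedBall p ρ) ⊆ Metric.closedBall p (2 * ρ) := by
    rintro z ⟨⟨hz1, hz2⟩, -, hz⟩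
    rw [Metric.mem_closedBall, dist_eq_norm] at hz ⊢
    calc ‖z - p‖ = ‖(z - (⟪n, z⟫_ℝ - c) • n - p) + (⟪n, z⟫_ℝ - c) • n‖ := by
          congr 1; abel
      _ ≤ ρ + |⟪n, z⟫_ℝ - c| * 1 := by
          refine (norm_add_le _ _).trans (add_le_add hz ?_)
          rw [norm_smul, hn, Real.norm_eq_abs]
      _ ≤ 2 * ρ := by
          rw [abs_of_pos hz1]; linarith
  have h3 := measure_mono (μ := volume) h2
  rw [h1, Measure.addHaar_closedBall _ _ (by positivity), finrank_euclideanSpace_fin] at h3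
  have h4 : ENNReal.ofReal ρ ≠ 0 := by simpa using hρ
  refine (ENNReal.mul_le_mul_iff_right h4 ENNReal.ofReal_ne_top).1 (h3.trans_eq ?_)
  obtain ⟨m, rfl⟩ := Nat.exists_eq_add_of_le' hd
  rw [ENNReal.coe_mul, ENNReal.coe_toNNReal hB, Nat.add_sub_cancel, mul_pow, pow_succ ρ,
    ENNReal.ofReal_mul (by positivity), ENNReal.ofReal_mul (by positivity),
    ENNReal.ofReal_pow (by positivity)]
  simp only [ENNReal.ofReal_ofNat, ENNReal.coe_pow, ENNReal.coe_ofNat]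
  ring

theorem convex_prism {n : E d} {c a : ℝ} {F : Set (E d)} (hF : Convex ℝ F) :
    Convex ℝ (prism n c a F) := by
  intro x hx y hy s t hs ht hst
  have e : ⟪n, s • x + t • y⟫_ℝ - c = s • (⟪n, x⟫_ℝ - c) + t • (⟪n, y⟫_ℝ - c) := by
    rw [inner_add_right, real_inner_smul_right, real_inner_smul_right, smul_eq_mul, smul_eq_mul]
    linear_combination c * hst
  refine ⟨?_, ?_⟩
  · rw [e]
    exact convex_Ioo 0 a hx.1 hy.1 hs ht hst
  · convert hF hx.2 hy.2 hs ht hst using 1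
    rw [e]
    module

/-- The interior relative to the hyperplane, written as an ordinary interior; its measurability is
then evident. -/
theorem mem_interior_union_compl_hyperplane {n y : E d} {c : ℝ} {C : Set (E d)} :
    y ∈ interior (C ∪ (hyperplane n c)ᶜ) ↔
      ∃ ε > 0, ∀ z ∈ Metric.ball y ε, z ∈ hyperplane n c → z ∈ C := by
  rw [mem_interior_iff_mem_nhds, Metric.mem_nhds_iff]
  refine exists_congr fun ε => and_congr Iff.rfl (forall_congr' fun z => ?_)
  refine imp_congr Iff.rfl ?_
  rw [mem_union, mem_compl_iff]
  tauto

/-- The prism over the points of `C` that are not relatively interior lies in the frontier of the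
convex prism over `C`, which has volume zero; `volume_prism` at height one brings this back to the
surface measure. -/
theorem ae_mem_relative_interior {n : E d} (hn : ‖n‖ = 1) {c : ℝ} {C : Set (E d)}
    (hCc : Convex ℝ C) (hCm : MeasurableSet C) (hC : C ⊆ hyperplane n c) :
    ∀ᵐ y ∂((surf d).restrict C), ∃ ε > 0, ∀ z ∈ Metric.ball y ε, z ∈ hyperplane n c → z ∈ C := by
  simp_rw [← mem_interior_union_compl_hyperplane]
  rw [ae_restrict_iff' hCm, ae_iff]
  set N := {y | ¬ (y ∈ C → y ∈ interior (C ∪ (hyperplane n c)ᶜ))} with hN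
  have hNC : N = C \ interior (C ∪ (hyperplane n c)ᶜ) := by
    ext y
    simp [hN]
  have hNm : MeasurableSet N := hNC ▸ hCm.diff isOpen_interior.measurableSet
  have h1 := volume_prism hn (a := 1) hNm (hNC ▸ sdiff_subset.trans hC)
  rw [ENNReal.ofReal_one, one_mul] at h1
  rw [← h1]
  refine measure_mono_null ?_ ((convex_prism (n := n) (c := c) (a := 1) hCc).addHaar_frontier volume)
  rintro z ⟨hz1, hz⟩
  rw [hNC] at hz
  refine ⟨subset_closure ⟨hz1, hz.1⟩, fun hzi => hz.2 ?_⟩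
  rw [mem_interior_union_compl_hyperplane]
  obtain ⟨ε, hε, hb⟩ := Metric.mem_nhds_iff.1 (mem_interior_iff_mem_nhds.1 hzi)
  refine ⟨ε, hε, fun y hy hyc => ?_⟩
  set s := ⟪n, z⟫_ℝ - c with hs
  have hy' : y + s • n ∈ prism n c 1 C := by
    refine hb ?_
    rw [Metric.mem_ball, dist_eq_norm] at hy ⊢
    rwa [show y + s • n - z = y - (z - s • n) by abel]
  have e : ⟪n, y + s • n⟫_ℝ - c = s := by
    rw [inner_add_right, real_inner_smul_right, inner_self_unit hn, mem_hyperplane.1 hyc]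
    ring
  have := hy'.2
  rwa [e, add_sub_cancel_right] at this

end HDG
end

noncomputable section
namespace HDG
variable {d : ℕ} {V : Type*} [NormedAddCommGroup V] [NormedSpace ℝ V]

/-! ### Cones and the divergence theorem on polytopes -/

/-- The open cone with apex `x0` and base `F ⊆ hyperplane n c`, where `h = c - ⟪n, x0⟫`. -/
def openCone (n x0 : E d) (h : ℝ) (F : Set (E d)) : Set (E d) :=
  {z | ⟪n, z - x0⟫_ℝ / h ∈ Ioo 0 1 ∧ x0 + (⟪n, z - x0⟫_ℝ / h)⁻¹ • (z - x0) ∈ F}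

section cone

variable {n x0 : E d} {h : ℝ} {F : Set (E d)}

theorem measurableSet_openCone (hF : MeasurableSet F) : MeasurableSet (openCone n x0 h F) :=
  (measurableSet_Ioo.preimage (by fun_prop : Measurable fun z : E d => ⟪n, z - x0⟫_ℝ / h)).inter
    (hF.preimage (by fun_prop :
      Measurable fun z : E d => x0 + (⟪n, z - x0⟫_ℝ / h)⁻¹ • (z - x0)))

theorem inner_combo_div (hh : 0 < h) (hF : F ⊆ hyperplane n (⟪n, x0⟫_ℝ + h)) {y : E d}
    (hy : y ∈ F) (l : ℝ) : ⟪n, x0 + l • (y - x0) - x0⟫_ℝ / h = l := by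
  rw [add_sub_cancel_left, real_inner_smul_right, inner_sub_right, mem_hyperplane.1 (hF hy)]
  field_simp
  ring

theorem mem_openCone (hh : 0 < h) (hF : F ⊆ hyperplane n (⟪n, x0⟫_ℝ + h)) {z : E d} :
    z ∈ openCone n x0 h F ↔ ∃ l ∈ Ioo (0 : ℝ) 1, ∃ y ∈ F, z = x0 + l • (y - x0) := by
  constructor
  · rintro ⟨hl, hz⟩
    refine ⟨_, hl, _, hz, ?_⟩
    rw [add_sub_cancel_left, smul_inv_smul₀ hl.1.ne', add_sub_cancel]
  · rintro ⟨l, hl, y, hy, rfl⟩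
    have e := inner_combo_div hh hF hy l
    refine ⟨by rwa [e], ?_⟩
    rw [e, add_sub_cancel_left, inv_smul_smul₀ hl.1.ne', add_sub_cancel]
    exact hy

/-- The slice at height `l h` is the homothetic copy of ratio `l` of part of the base, which scales
the surface measure by `l^(d-1)`. -/
theorem volume_openCone_inter (hn : ‖n‖ = 1) (hh : 0 < h) (hFm : MeasurableSet F)
    (hF : F ⊆ hyperplane n (⟪n, x0⟫_ℝ + h)) {t : Set (E d)} (ht : MeasurableSet t) :
    volume (openCone n x0 h F ∩ t) = ∫⁻ l in Ioo (0 : ℝ) 1,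
      ENNReal.ofReal (h * l ^ (d - 1)) * surf d (F ∩ {y | x0 + l • (y - x0) ∈ t}) := by
  rw [volume_eq_lintegral_slice hn hh x0 ((measurableSet_openCone hFm).inter ht),
    ← lintegral_const_mul' _ _ ENNReal.ofReal_ne_top, ← lintegral_indicator measurableSet_Ioo]
  refine lintegral_congr fun l => ?_
  by_cases hl : l ∈ Ioo (0 : ℝ) 1
  · rw [indicator_of_mem hl, ENNReal.ofReal_mul hh.le, mul_assoc]
    congr 1
    have := euclideanHausdorffMeasure_homothety_image (d - 1) x0 hl.1.ne'
      (F ∩ {y | x0 + l • (y - x0) ∈ t})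
    have e : ENNReal.ofReal (l ^ (d - 1)) = ((‖l‖₊ ^ (d - 1) : ℝ≥0) : ℝ≥0∞) := by
      rw [← ENNReal.ofReal_coe_nnreal, NNReal.coe_pow, coe_nnnorm, Real.norm_of_nonneg hl.1.le]
    rw [e]
    refine Eq.trans ?_ this
    congr 1
    ext z
    have hom : ∀ y : E d, AffineMap.homothety x0 l y = x0 + l • (y - x0) := fun y => by
      rw [AffineMap.homothety_apply, vsub_eq_sub, vadd_eq_add, add_comm]
    constructor
    · rintro ⟨⟨hz, hzt⟩, hzl⟩
      obtain ⟨m, hm, y, hy, rfl⟩ := (mem_openCone hh hF).1 hz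
      have e1 := inner_combo_div hh hF hy m
      rw [mem_ofPred_eq, ← div_eq_iff hh.ne', e1] at hzl
      subst hzl
      exact ⟨y, ⟨hy, hzt⟩, hom y⟩
    · rintro ⟨y, ⟨hy, hyt⟩, rfl⟩
      rw [hom]
      refine ⟨⟨(mem_openCone hh hF).2 ⟨l, hl, y, hy, rfl⟩, hyt⟩, ?_⟩
      rw [mem_ofPred_eq, ← div_eq_iff hh.ne', inner_combo_div hh hF hy]
  · rw [indicator_of_notMem hl]
    convert mul_zero (ENNReal.ofReal h)
    convert measure_empty (μ := surf d)
    refine eq_empty_of_forall_notMem ?_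
    rintro z ⟨⟨⟨hz, -⟩, -⟩, hzl⟩
    rw [mem_ofPred_eq] at hzl
    rw [hzl, mul_div_cancel_right₀ _ hh.ne'] at hz
    exact hl hz

theorem restrict_openCone (hn : ‖n‖ = 1) (hh : 0 < h) (hFm : MeasurableSet F)
    (hF : F ⊆ hyperplane n (⟪n, x0⟫_ℝ + h)) [IsFiniteMeasure ((surf d).restrict F)] :
    volume.restrict (openCone n x0 h F) =
      ((((volume.restrict (Ioo (0 : ℝ) 1)).withDensity
          fun l => ENNReal.ofReal (h * l ^ (d - 1))).prod ((surf d).restrict F)).map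
        fun q : ℝ × E d => x0 + q.1 • (q.2 - x0)) := by
  have hΦ : Measurable fun q : ℝ × E d => x0 + q.1 • (q.2 - x0) := by fun_prop
  refine Measure.ext fun t ht => ?_
  rw [Measure.restrict_apply ht, inter_comm, volume_openCone_inter hn hh hFm hF ht,
    Measure.map_apply hΦ ht, Measure.prod_apply (hΦ ht),
    lintegral_withDensity_eq_lintegral_mul₀ (by fun_prop)
      (measurable_measure_prodMk_left (hΦ ht)).aemeasurable]
  refine lintegral_congr fun l => ?_
  rw [Pi.mul_apply, Measure.restrict_apply (measurable_prodMk_left (hΦ ht)), inter_comm]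
  rfl

/-- The radial form of the divergence theorem. -/
theorem integral_openCone (hd : 1 ≤ d) (hn : ‖n‖ = 1) (hh : 0 < h) (hFm : MeasurableSet F)
    (hF : F ⊆ hyperplane n (⟪n, x0⟫_ℝ + h)) [IsFiniteMeasure ((surf d).restrict F)]
    (hFb : Bornology.IsBounded F) {f : E d → ℝ} (hf : ContDiff ℝ ∞ f) :
    ∫ z in openCone n x0 h F, (d * f z + fderiv ℝ f z (z - x0)) = h * ∫ y in F, f y ∂(surf d) := by
  have hΦ : Continuous fun q : ℝ × E d => x0 + q.1 • (q.2 - x0) := by fun_prop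
  have hf1 : Continuous (fderiv ℝ f) := hf.continuous_fderiv (by simp)
  -- `g` is the divergence of the radial field `z ↦ f(z) (z - x0)`, whose flux through the lateral
  -- boundary of the cone vanishes.
  set g : E d → ℝ := fun z => d * f z + fderiv ℝ f z (z - x0) with hg
  have hgc : Continuous g :=
    (continuous_const.mul hf.continuous).add (hf1.clm_apply (by fun_prop))
  set μ := (volume.restrict (Ioo (0 : ℝ) 1)).withDensity fun l => ENNReal.ofReal (h * l ^ (d - 1))
    with hμ
  have hμf : IsFiniteMeasure μ := by
    refine ⟨?_⟩
    rw [hμ, withDensity_apply _ MeasurableSet.univ, Measure.restrict_univ]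
    calc _ ≤ ∫⁻ l in Ioo (0 : ℝ) 1, ENNReal.ofReal h := by
          refine setLIntegral_mono' measurableSet_Ioo fun l hl => ENNReal.ofReal_le_ofReal ?_
          exact mul_le_of_le_one_right hh.le (pow_le_one₀ hl.1.le hl.2.le)
      _ < ⊤ := by simp
  rw [restrict_openCone hn hh hFm hF, integral_map hΦ.measurable.aemeasurable
    hgc.aestronglyMeasurable]
  have hae : ∀ᵐ q ∂(μ.prod ((surf d).restrict F)), q.1 ∈ Ioo (0 : ℝ) 1 ∧ q.2 ∈ F := by
    have h1 : ∀ᵐ l ∂μ, l ∈ Ioo (0 : ℝ) 1 :=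
      (withDensity_absolutelyContinuous _ _).ae_le (ae_restrict_mem measurableSet_Ioo)
    have h2 : ∀ᵐ y ∂((surf d).restrict F), y ∈ F := ae_restrict_mem hFm
    exact (Measure.quasiMeasurePreserving_fst.ae h1).and (Measure.quasiMeasurePreserving_snd.ae h2)
  obtain ⟨R, hR⟩ := hFb.closure.subset_closedBall 0
  have hK : IsCompact (Icc (0 : ℝ) 1 ×ˢ closure F) :=
    isCompact_Icc.prod (Metric.isCompact_of_isClosed_isBounded isClosed_closure hFb.closure)
  obtain ⟨B, hB⟩ := hK.exists_bound_of_continuousOn (hgc.comp hΦ).continuousOn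
  have hint : Integrable (fun q : ℝ × E d => g (x0 + q.1 • (q.2 - x0)))
      (μ.prod ((surf d).restrict F)) :=
    Integrable.of_bound (hgc.comp hΦ).aestronglyMeasurable B (hae.mono fun q hq =>
      hB q ⟨Ioo_subset_Icc_self hq.1, subset_closure hq.2⟩)
  rw [integral_prod_symm _ hint, ← integral_const_mul]
  refine integral_congr_ae (ae_of_all _ fun y => ?_)
  simp only
  have hw : ∀ l ∈ Ioo (0 : ℝ) 1, 0 ≤ h * l ^ (d - 1) := fun l hl =>
    mul_nonneg hh.le (pow_nonneg hl.1.le _)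
  rw [hμ, integral_withDensity_eq_integral_toReal_smul (by fun_prop) (by simp)]
  have e1 : ∀ l ∈ Ioo (0 : ℝ) 1, (ENNReal.ofReal (h * l ^ (d - 1))).toReal •
      g (x0 + l • (y - x0)) = h * (d * l ^ (d - 1) * f (x0 + l • (y - x0)) +
        l ^ d * fderiv ℝ f (x0 + l • (y - x0)) (y - x0)) := by
    intro l hl
    rw [ENNReal.toReal_ofReal (hw l hl), hg]
    simp only [add_sub_cancel_left, map_smul, smul_eq_mul]
    obtain ⟨m, rfl⟩ := Nat.exists_eq_add_of_le' hd
    rw [Nat.add_sub_cancel, pow_succ]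
    ring
  rw [setIntegral_congr_fun measurableSet_Ioo e1, integral_const_mul]
  congr 1
  rw [← integral_Ioc_eq_integral_Ioo, ← intervalIntegral.integral_of_le zero_le_one]
  -- On the ray through `y` the weighted integrand is an exact derivative; its primitive vanishes at
  -- the apex, as `d ≥ 1`, and equals `f y` at the base.
  have hder : ∀ l : ℝ, HasDerivAt (fun l : ℝ => l ^ d * f (x0 + l • (y - x0)))
      (d * l ^ (d - 1) * f (x0 + l • (y - x0)) +
        l ^ d * fderiv ℝ f (x0 + l • (y - x0)) (y - x0)) l := by
    intro l
    refine (hasDerivAt_pow d l).mul ?_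
    have h1 : HasDerivAt (fun l : ℝ => x0 + l • (y - x0)) (y - x0) l := by
      simpa using ((hasDerivAt_id l).smul_const (y - x0)).const_add x0
    exact ((hf.differentiable (by simp)) _).hasFDerivAt.comp_hasDerivAt l h1
  rw [intervalIntegral.integral_eq_sub_of_hasDerivAt (fun l _ => hder l)]
  · have : (0 : ℝ) ^ d = 0 := zero_pow (by omega)
    simp [this]
  · refine Continuous.intervalIntegrable ?_ _ _
    have hc : Continuous fun l : ℝ => x0 + l • (y - x0) := by fun_prop
    exact ((continuous_const.mul (continuous_pow _)).mul (hf.continuous.comp hc)).add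
      ((continuous_pow _).mul ((hf1.comp hc).clm_apply continuous_const))

end cone

end HDG
end

/-! ### Convex polytopes and the divergence theorem. -/

noncomputable section
namespace HDG
variable {d : ℕ} {V : Type*} [NormedAddCommGroup V] [NormedSpace ℝ V]

/-- `K` is a convex body whose boundary is composed of the flat pieces `F ∈ 𝓕`, which overlap in
null sets, and `n F` is the outward unit normal on `F`. -/
structure IsPolytope (K : Set (E d)) (𝓕 : Finset (Set (E d))) (n : Set (E d) → E d) : Prop where
  convex : Convex ℝ K
  compact : IsCompact K
  nonempty : (interior K).Nonempty
  frontier_eq : frontier K = ⋃ F ∈ 𝓕, F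
  face_closed : ∀ F ∈ 𝓕, IsClosed F
  face_nonempty : ∀ F ∈ 𝓕, F.Nonempty
  norm_normal : ∀ F ∈ 𝓕, ‖n F‖ = 1
  inner_le : ∀ F ∈ 𝓕, ∀ x ∈ F, ∀ y ∈ K, ⟪n F, y - x⟫_ℝ ≤ 0
  face_disj : ∀ F ∈ 𝓕, ∀ F' ∈ 𝓕, F ≠ F' → surf d (F ∩ F') = 0

namespace IsPolytope

variable {K : Set (E d)} {𝓕 : Finset (Set (E d))} {n : Set (E d) → E d}

theorem face_subset_frontier (h : IsPolytope K 𝓕 n) {F : Set (E d)} (hF : F ∈ 𝓕) :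
    F ⊆ frontier K := by
  rw [h.frontier_eq]
  exact subset_biUnion_of_mem (u := fun F => F) hF

theorem face_subset (h : IsPolytope K 𝓕 n) {F : Set (E d)} (hF : F ∈ 𝓕) : F ⊆ K :=
  (h.face_subset_frontier hF).trans h.compact.isClosed.frontier_subset

theorem face_isBounded (h : IsPolytope K 𝓕 n) {F : Set (E d)} (hF : F ∈ 𝓕) :
    Bornology.IsBounded F := h.compact.isBounded.subset (h.face_subset hF)

theorem exists_const (h : IsPolytope K 𝓕 n) : ∃ c : Set (E d) → ℝ, ∀ F ∈ 𝓕,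
    F ⊆ hyperplane (n F) (c F) ∧ (∀ y ∈ K, ⟪n F, y⟫_ℝ ≤ c F) ∧
      ∀ y ∈ interior K, ⟪n F, y⟫_ℝ < c F := by
  have key : ∀ F : Set (E d), ∃ c : ℝ, F ∈ 𝓕 →
      F ⊆ hyperplane (n F) c ∧ (∀ y ∈ K, ⟪n F, y⟫_ℝ ≤ c) ∧ ∀ y ∈ interior K, ⟪n F, y⟫_ℝ < c := by
    intro F
    by_cases hF : F ∈ 𝓕
    · obtain ⟨x, hx⟩ := h.face_nonempty F hF
      refine ⟨⟪n F, x⟫_ℝ, fun _ => ?_⟩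
      have hle : ∀ y ∈ K, ⟪n F, y⟫_ℝ ≤ ⟪n F, x⟫_ℝ := fun y hy => by
        have := h.inner_le F hF x hx y hy
        rw [inner_sub_right] at this
        linarith
      refine ⟨fun y hy => le_antisymm (hle y (h.face_subset hF hy)) ?_, hle, fun y hy => ?_⟩
      · have := h.inner_le F hF y hy x (h.face_subset hF hx)
        rw [inner_sub_right] at this
        linarith
      · obtain ⟨ε, hε, hb⟩ := Metric.mem_nhds_iff.1 (mem_interior_iff_mem_nhds.1 hy)
        have h1 : y + (ε / 2) • n F ∈ K := by
          refine hb ?_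
          rw [mem_ball_iff_norm, add_sub_cancel_left, norm_smul, h.norm_normal F hF, mul_one,
            Real.norm_of_nonneg (by positivity)]
          linarith
        have h2 := hle _ h1
        rw [inner_add_right, real_inner_smul_right, inner_self_unit (h.norm_normal F hF)] at h2
        linarith
    · exact ⟨0, fun h => absurd h hF⟩
  choose c hc using key
  exact ⟨c, hc⟩

theorem face_surf_lt_top (hd : 1 ≤ d) (h : IsPolytope K 𝓕 n) {F : Set (E d)} (hF : F ∈ 𝓕) :
    surf d F < ⊤ := by
  obtain ⟨c, hc⟩ := h.exists_const
  obtain ⟨A, hA⟩ := exists_surf_inter_closedBall_le hd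
  obtain ⟨R, hR0, hR⟩ := (h.face_isBounded hF).subset_closedBall_lt 0 0
  have := hA _ _ F (h.norm_normal F hF) (h.face_closed F hF).measurableSet (hc F hF).1 0 R hR0
  rw [inter_eq_left.2 hR] at this
  exact this.trans_lt (by finiteness)

/-- A ray from an interior point meets the frontier of a convex body only once. Cones over two faces
can thus overlap only above the intersection of the faces. -/
theorem eq_of_combo_eq (h : IsPolytope K 𝓕 n) {x0 y y' : E d} (hx0 : x0 ∈ interior K)
    (hy : y ∈ frontier K) (hy' : y' ∈ frontier K) {l l' : ℝ} (hl : 0 < l) (hl' : 0 < l')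
    (he : x0 + l • (y - x0) = x0 + l' • (y' - x0)) : y = y' := by
  have key : ∀ {y y' : E d} {l l' : ℝ}, y ∈ frontier K → y' ∈ frontier K → 0 < l → 0 < l' →
      l • (y - x0) = l' • (y' - x0) → ¬ l < l' := by
    intro y y' l l' hy hy' hl hl' he hlt
    have e1 : y' = (1 - l / l') • x0 + (l / l') • y := by
      have : y' - x0 = (l / l') • (y - x0) := by
        rw [div_eq_inv_mul, mul_smul, he, inv_smul_smul₀ hl'.ne']
      rw [← sub_add_cancel y' x0, this]
      module
    refine hy'.2 (e1 ▸ h.convex.combo_interior_closure_mem_interior hx0 hy.1 ?_ (by positivity)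
      (by ring))
    rw [sub_pos, div_lt_one hl']
    exact hlt
  have he' := add_left_cancel he
  have hll : l = l' := le_antisymm (not_lt.1 (key hy' hy hl' hl he'.symm))
    (not_lt.1 (key hy hy' hl hl' he'))
  subst hll
  exact sub_left_injective (smul_right_injective _ hl.ne' he')

/-- The ray from `x0` through an interior point `z` leaves the bounded set `K`, so it crosses the
frontier beyond `z`, in some face; the apex is the only interior point in no cone. -/
theorem biUnion_openCone (h : IsPolytope K 𝓕 n) {c : Set (E d) → ℝ}
    (hc : ∀ F ∈ 𝓕, F ⊆ hyperplane (n F) (c F) ∧ (∀ y ∈ K, ⟪n F, y⟫_ℝ ≤ c F) ∧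
      ∀ y ∈ interior K, ⟪n F, y⟫_ℝ < c F) {x0 : E d} (hx0 : x0 ∈ interior K) :
    ⋃ F : 𝓕, openCone (n F) x0 (c F - ⟪n F, x0⟫_ℝ) F = interior K \ {x0} := by
  have hpos : ∀ F ∈ 𝓕, 0 < c F - ⟪n F, x0⟫_ℝ := fun F hF => sub_pos.2 ((hc F hF).2.2 x0 hx0)
  have hsub : ∀ F ∈ 𝓕, F ⊆ hyperplane (n F) (⟪n F, x0⟫_ℝ + (c F - ⟪n F, x0⟫_ℝ)) := fun F hF => by
    rw [add_sub_cancel]; exact (hc F hF).1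
  ext z
  simp only [mem_iUnion, Subtype.exists]
  constructor
  · rintro ⟨F, hF, hz⟩
    refine ⟨?_, ?_⟩
    · obtain ⟨l, hl, y, hy, rfl⟩ := (mem_openCone (hpos F hF) (hsub F hF)).1 hz
      have : x0 + l • (y - x0) = (1 - l) • x0 + l • y := by module
      rw [this]
      exact h.convex.combo_interior_self_mem_interior hx0 (h.face_subset hF hy)
        (by linarith [hl.2]) hl.1.le (by ring)
    · rintro rfl
      have := hz.1.1
      simp at this
  · rintro ⟨hz, hzx⟩
    rw [mem_singleton_iff] at hzx
    obtain ⟨R, hR0, hR⟩ := h.compact.isBounded.subset_closedBall_lt 0 x0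
    have hv : 0 < ‖z - x0‖ := norm_pos_iff.2 (sub_ne_zero.2 hzx)
    set w : E d := x0 + ((R + 1) / ‖z - x0‖) • (z - x0) with hw
    have hwK : w ∉ K := fun hwK => by
      have := hR hwK
      rw [mem_closedBall_iff_norm, hw, add_sub_cancel_left, norm_smul, norm_div, norm_norm,
        div_mul_cancel₀ _ hv.ne', Real.norm_of_nonneg (by linarith)] at this
      linarith
    have hzR : ‖z - x0‖ ≤ R := mem_closedBall_iff_norm.1 (hR (interior_subset hz))
    obtain ⟨y, hys, hyf⟩ : (segment ℝ z w ∩ frontier K).Nonempty := by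
      -- Otherwise the connected segment would be covered by the interior and the exterior of `K`,
      -- meeting both.
      by_contra hem
      rw [not_nonempty_iff_eq_empty] at hem
      obtain ⟨q, -, hq, hq'⟩ := (convex_segment z w).isPreconnected (interior K) (closure K)ᶜ
        isOpen_interior isClosed_closure.isOpen_compl
        (fun q hq => by
          by_contra hq'
          rw [mem_union, not_or, mem_compl_iff, not_not] at hq'
          exact notMem_empty q (hem ▸ ⟨hq, hq'.2, hq'.1⟩))
        ⟨z, left_mem_segment ℝ z w, hz⟩
        ⟨w, right_mem_segment ℝ z w, h.compact.isClosed.closure_eq.symm ▸ hwK⟩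
      exact hq' (subset_closure (interior_subset hq))
    obtain ⟨a, b, ha, hb, hab, rfl⟩ := hys
    set s : ℝ := a + b * ((R + 1) / ‖z - x0‖) with hs
    have ey : a • z + b • w = x0 + s • (z - x0) := by
      rw [hw, hs, show a = 1 - b by linarith]
      module
    rw [ey] at hyf
    have h1 : 1 < (R + 1) / ‖z - x0‖ := by
      rw [one_lt_div hv]; linarith
    have hb0 : b ≠ 0 := fun hb0 => by
      refine hyf.2 ?_
      rw [hs, hb0, show a = 1 by linarith]
      simpa using hz
    have hs1 : 1 < s := by
      have : 0 < b := lt_of_le_of_ne hb hb0.symm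
      nlinarith
    have hs0 : 0 < s := by linarith
    rw [h.frontier_eq] at hyf
    obtain ⟨F, hF, hyF⟩ := mem_iUnion₂.1 hyf
    refine ⟨F, hF, (mem_openCone (hpos F hF) (hsub F hF)).2 ⟨s⁻¹, ⟨by positivity, ?_⟩, _, hyF, ?_⟩⟩
    · exact inv_lt_one_of_one_lt₀ hs1
    · rw [add_sub_cancel_left, inv_smul_smul₀ hs0.ne', add_sub_cancel]

/-- Sum of the cone formula over the faces; `c F - ⟪n F, x0⟫` is the height of the cone over `F`,
and overlaps of cones are null because overlaps of faces are. -/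
theorem integral_radial (hd : 1 ≤ d) (h : IsPolytope K 𝓕 n) {c : Set (E d) → ℝ}
    (hc : ∀ F ∈ 𝓕, F ⊆ hyperplane (n F) (c F) ∧ (∀ y ∈ K, ⟪n F, y⟫_ℝ ≤ c F) ∧
      ∀ y ∈ interior K, ⟪n F, y⟫_ℝ < c F) {x0 : E d} (hx0 : x0 ∈ interior K) {f : E d → ℝ}
    (hf : ContDiff ℝ ∞ f) :
    ∫ z in interior K, (d * f z + fderiv ℝ f z (z - x0)) =
      ∑ F ∈ 𝓕, (c F - ⟪n F, x0⟫_ℝ) * ∫ y in F, f y ∂(surf d) := by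
  have hpos : ∀ F ∈ 𝓕, 0 < c F - ⟪n F, x0⟫_ℝ := fun F hF => sub_pos.2 ((hc F hF).2.2 x0 hx0)
  have hsub : ∀ F ∈ 𝓕, F ⊆ hyperplane (n F) (⟪n F, x0⟫_ℝ + (c F - ⟪n F, x0⟫_ℝ)) := fun F hF => by
    rw [add_sub_cancel]; exact (hc F hF).1
  have hm : ∀ F ∈ 𝓕, MeasurableSet F := fun F hF => (h.face_closed F hF).measurableSet
  have : Nonempty (Fin d) := ⟨⟨0, hd⟩⟩
  have hae : (interior K : Set (E d)) =ᵐ[volume] (interior K \ {x0} : Set (E d)) :=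
    (sdiff_null_ae_eq_self (measure_singleton x0)).symm
  have hgc : Continuous fun z => d * f z + fderiv ℝ f z (z - x0) :=
    (continuous_const.mul hf.continuous).add
      ((hf.continuous_fderiv (by simp)).clm_apply (by fun_prop))
  rw [setIntegral_congr_set hae, ← h.biUnion_openCone hc hx0, integral_iUnion_ae,
    tsum_fintype, ← Finset.sum_coe_sort 𝓕]
  · refine Finset.sum_congr rfl fun F _ => ?_
    have : IsFiniteMeasure ((surf d).restrict (F : Set (E d))) :=
      isFiniteMeasure_restrict.2 (h.face_surf_lt_top hd F.2).ne
    exact integral_openCone hd (h.norm_normal F F.2) (hpos F F.2) (hm F F.2) (hsub F F.2)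
      (h.face_isBounded F.2) hf
  · exact fun F => (measurableSet_openCone (hm F F.2)).nullMeasurableSet
  · intro F F' hFF'
    have hne : (F : Set (E d)) ≠ F' := fun e => hFF' (Subtype.ext e)
    change volume (_ ∩ _) = 0
    rw [volume_openCone_inter (h.norm_normal F F.2) (hpos F F.2) (hm F F.2) (hsub F F.2)
      (measurableSet_openCone (hm F' F'.2))]
    rw [setLIntegral_congr_fun (g := fun _ => 0) measurableSet_Ioo]
    · simp
    · intro l hl
      refine mul_eq_zero_of_right _ (measure_mono_null ?_ (h.face_disj F F.2 F' F'.2 hne))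
      rintro y ⟨hy, hyc⟩
      refine ⟨hy, ?_⟩
      obtain ⟨m, hm, y', hy', e⟩ := (mem_openCone (hpos F' F'.2) (hsub F' F'.2)).1 hyc
      rwa [h.eq_of_combo_eq hx0 (h.face_subset_frontier F.2 hy)
        (h.face_subset_frontier F'.2 hy') hl.1 hm.1 e]
  · rw [h.biUnion_openCone hc hx0]
    exact (Continuous.integrableOn_of_isBounded
      (h.compact.isBounded.subset interior_subset) hgc).mono_set sdiff_subset

/-- The divergence theorem on a convex polytope. -/
theorem integral_fderiv (hd : 1 ≤ d) (h : IsPolytope K 𝓕 n) {f : E d → ℝ}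
    (hf : ContDiff ℝ ∞ f) (v : E d) :
    ∫ z in interior K, fderiv ℝ f z v = ∑ F ∈ 𝓕, ⟪n F, v⟫_ℝ * ∫ y in F, f y ∂(surf d) := by
  obtain ⟨c, hc⟩ := h.exists_const
  obtain ⟨x0, hx0⟩ := h.nonempty
  have hb : Bornology.IsBounded (interior K) := h.compact.isBounded.subset interior_subset
  have hf1 : Continuous (fderiv ℝ f) := hf.continuous_fderiv (by simp)
  -- The radial formula is used with two apexes, `x0` and `x0 + ε v`. The difference of the two
  -- radial fields is `ε f v`, so subtraction isolates the derivative in the direction `v`.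
  obtain ⟨ε, hε, hεK⟩ : ∃ ε : ℝ, 0 < ε ∧ x0 + ε • v ∈ interior K := by
    have hcont : Tendsto (fun ε : ℝ => x0 + ε • v) (𝓝[>] 0) (𝓝 x0) := by
      have : Continuous fun ε : ℝ => x0 + ε • v := by fun_prop
      simpa using (this.tendsto 0).mono_left nhdsWithin_le_nhds
    obtain ⟨ε, h1, h2⟩ := ((hcont.eventually (isOpen_interior.mem_nhds hx0)).and
      self_mem_nhdsWithin).exists
    exact ⟨ε, h2, h1⟩
  have e1 := h.integral_radial hd hc hx0 hf
  have e2 := h.integral_radial hd hc hεK hf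
  have hi : ∀ x : E d, IntegrableOn (fun z => d * f z + fderiv ℝ f z (z - x)) (interior K) :=
    fun x => Continuous.integrableOn_of_isBounded hb ((continuous_const.mul hf.continuous).add
      (hf1.clm_apply (continuous_id.sub continuous_const)))
  have e3 : ε * ∫ z in interior K, fderiv ℝ f z v =
      (∫ z in interior K, (d * f z + fderiv ℝ f z (z - x0))) -
        ∫ z in interior K, (d * f z + fderiv ℝ f z (z - (x0 + ε • v))) := by
    rw [← integral_sub (hi _) (hi _), ← integral_const_mul]
    refine integral_congr_ae (ae_of_all _ fun z => ?_)
    simp only [map_sub, map_add, map_smul, smul_eq_mul]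
    ring
  rw [e1, e2, ← Finset.sum_sub_distrib] at e3
  refine mul_left_cancel₀ hε.ne' (e3.trans ?_)
  rw [Finset.mul_sum]
  refine Finset.sum_congr rfl fun F _ => ?_
  rw [inner_add_right, real_inner_smul_right]
  ring

end IsPolytope

end HDG
end

noncomputable section
namespace HDG
variable {d : ℕ} {V : Type*} [NormedAddCommGroup V] [NormedSpace ℝ V]

/-! ### Elements -/

theorem IsSimplex.interior_nonempty {K : Set (E d)} (h : IsSimplex d K) :
    (interior K).Nonempty := by
  obtain ⟨p, hp, rfl⟩ := h
  rw [interior_convexHull_nonempty_iff_affineSpan_eq_top,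
    hp.affineSpan_eq_top_iff_card_eq_finrank_add_one]
  simp

theorem IsElement.convex {K : Set (E d)} (h : IsElement K) : Convex ℝ K := by
  rcases h with ⟨p, -, rfl⟩ | ⟨-, p, -, rfl⟩ | ⟨-, e, rfl⟩
  · exact convex_convexHull ℝ _
  · exact convex_convexHull ℝ _
  · refine Convex.affine_image (e : E d →ᵃ[ℝ] E d) ?_
    have : {x : E d | ∀ i, x i ∈ Icc (0 : ℝ) 1} = ⋂ i, (coordL i).toLinearMap ⁻¹' Icc 0 1 := by
      ext x; simp
    rw [this]
    exact convex_iInter fun i => (convex_Icc 0 1).linear_preimage _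

theorem IsElement.isCompact {K : Set (E d)} (h : IsElement K) : IsCompact K := by
  rcases h with ⟨p, -, rfl⟩ | ⟨-, p, -, rfl⟩ | ⟨-, e, rfl⟩
  · exact (finite_range p).isCompact_convexHull ℝ
  · exact (finite_range p).isCompact_convexHull ℝ
  · refine IsCompact.image ?_ e.toAffineMap.continuous_of_finiteDimensional
    have : {x : E d | ∀ i, x i ∈ Icc (0 : ℝ) 1} =
        (EuclideanSpace.equiv (Fin d) ℝ).toHomeomorph ⁻¹' (univ.pi fun _ => Icc (0 : ℝ) 1) := by
      ext x
      rw [mem_preimage, mem_univ_pi]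
      rfl
    rw [this]
    exact (Homeomorph.isCompact_preimage _).2 (isCompact_univ_pi fun _ => isCompact_Icc)

theorem IsElement.interior_nonempty {K : Set (E d)} (h : IsElement K) :
    (interior K).Nonempty := by
  rcases h with h | ⟨rfl, p, hp, rfl⟩ | ⟨-, e, rfl⟩
  · exact h.interior_nonempty
  -- Of three collinear points one lies between the other two, which convex independence forbids; so
  -- three of the vertices already span the plane.
  · have hcol : ¬ Collinear ℝ {p 0, p 1, p 2} := by
      intro hc
      have key : ∀ i j k : Fin 4, j ≠ i → j ≠ k → ¬ Wbtw ℝ (p i) (p j) (p k) := by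
        intro i j k hi hk hw
        have h1 : p j ∈ convexHull ℝ (p '' {i, k}) := by
          rw [image_pair, convexHull_pair]
          exact hw.mem_segment
        rcases hp {i, k} j h1 with h | h
        · exact hi h
        · exact hk h
      rcases hc.wbtw_or_wbtw_or_wbtw with h | h | h
      · exact key 0 1 2 (by decide) (by decide) h
      · exact key 1 2 0 (by decide) (by decide) h
      · exact key 2 0 1 (by decide) (by decide) h
    rw [interior_convexHull_nonempty_iff_affineSpan_eq_top]
    have h3 : AffineIndependent ℝ ![p 0, p 1, p 2] := affineIndependent_iff_not_collinear_set.2 hcol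
    have h4 := (h3.affineSpan_eq_top_iff_card_eq_finrank_add_one).2 (by simp)
    rw [eq_top_iff, ← h4]
    refine affineSpan_mono ℝ ?_
    rintro _ ⟨i, rfl⟩
    fin_cases i
    · exact mem_range_self 0
    · exact mem_range_self 1
    · exact mem_range_self 2
  · have ho : IsOpen {x : E d | ∀ i, x i ∈ Ioo (0 : ℝ) 1} := by
      simp only [ofPred_forall]
      exact isOpen_iInter_of_finite fun i => isOpen_Ioo.preimage (coordL i).continuous
    have h1 : e '' {x : E d | ∀ i, x i ∈ Ioo (0 : ℝ) 1} ⊆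
        interior (e '' {x : E d | ∀ i, x i ∈ Icc (0 : ℝ) 1}) := by
      refine interior_maximal (image_mono fun x hx i => Ioo_subset_Icc_self (hx i)) ?_
      exact (AffineEquiv.toContinuousAffineEquiv e).toHomeomorph.isOpenMap _ ho
    refine Nonempty.mono h1 (Nonempty.image _ ⟨WithLp.toLp 2 fun _ => 1 / 2, fun i => ?_⟩)
    constructor <;> norm_num

/-! ### Pairs of convex bodies with disjoint interiors -/

theorem exists_separating {K K' : Set (E d)} (hK : Convex ℝ K) (hK' : Convex ℝ K')
    (hKc : IsClosed K) (hKc' : IsClosed K') (hKn : (interior K).Nonempty)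
    (hKn' : (interior K').Nonempty) (hd : Disjoint (interior K) (interior K')) :
    ∃ (n : E d) (c : ℝ), ‖n‖ = 1 ∧ (∀ x ∈ K, ⟪n, x⟫_ℝ ≤ c) ∧ (∀ x ∈ K', c ≤ ⟪n, x⟫_ℝ) ∧
      (∀ x ∈ interior K, ⟪n, x⟫_ℝ < c) ∧ ∀ x ∈ interior K', c < ⟪n, x⟫_ℝ := by
  obtain ⟨f, u, h1, h2⟩ := geometric_hahn_banach_open_open hK.interior isOpen_interior
    hK'.interior isOpen_interior hd
  set m : E d := (InnerProductSpace.toDual ℝ (E d)).symm f with hm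
  have hf : ∀ x, ⟪m, x⟫_ℝ = f x := fun x => InnerProductSpace.toDual_symm_apply
  obtain ⟨a, ha⟩ := hKn
  obtain ⟨b, hb⟩ := hKn'
  have hm0 : 0 < ‖m‖ := by
    rw [norm_pos_iff]
    rintro hm0
    have e1 := h1 a ha
    have e2 := h2 b hb
    rw [← hf, hm0, inner_zero_left] at e1 e2
    linarith
  have hn : ∀ x, ⟪‖m‖⁻¹ • m, x⟫_ℝ = ‖m‖⁻¹ * f x := fun x => by
    rw [real_inner_smul_left, hf]
  have i1 : ∀ x ∈ interior K, ⟪‖m‖⁻¹ • m, x⟫_ℝ < ‖m‖⁻¹ * u := fun x hx => by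
    rw [hn]
    exact mul_lt_mul_of_pos_left (h1 x hx) (inv_pos.2 hm0)
  have i2 : ∀ x ∈ interior K', ‖m‖⁻¹ * u < ⟪‖m‖⁻¹ • m, x⟫_ℝ := fun x hx => by
    rw [hn]
    exact mul_lt_mul_of_pos_left (h2 x hx) (inv_pos.2 hm0)
  have cl : ∀ {S : Set (E d)}, Convex ℝ S → IsClosed S → (interior S).Nonempty →
      S ⊆ closure (interior S) := fun hS hSc hSn => by
    rw [hS.closure_interior_eq_closure_of_nonempty_interior hSn]
    exact subset_closure
  refine ⟨‖m‖⁻¹ • m, ‖m‖⁻¹ * u, ?_, fun x hx => ?_, fun x hx => ?_, i1, i2⟩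
  · rw [norm_smul, norm_inv, norm_norm, inv_mul_cancel₀ hm0.ne']
  · exact closure_minimal (t := {x | ⟪‖m‖⁻¹ • m, x⟫_ℝ ≤ ‖m‖⁻¹ * u}) (fun x hx => (i1 x hx).le)
      (isClosed_le (by fun_prop) continuous_const) (cl hK hKc ⟨a, ha⟩ hx)
  · exact closure_minimal (t := {x | ‖m‖⁻¹ * u ≤ ⟪‖m‖⁻¹ • m, x⟫_ℝ}) (fun x hx => (i2 x hx).le)
      (isClosed_le continuous_const (by fun_prop)) (cl hK' hKc' ⟨b, hb⟩ hx)

/-- Near a relatively interior point `y` of its flat part, `K` fills the whole half-ball. A point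
`w` of the half-ball, projected from `z` onto the hyperplane, lands near `y` and so in `K`, and `w`
lies on the segment from `z` to its projection. -/
theorem eventually_mem_of_le_hyperplane {K : Set (E d)} (hK : Convex ℝ K) {n y z : E d} {c : ℝ}
    (hy : y ∈ hyperplane n c) (hz : z ∈ K) (hzc : ⟪n, z⟫_ℝ < c)
    (hyK : ∃ ε > 0, ∀ w ∈ Metric.ball y ε, w ∈ hyperplane n c → w ∈ K) :
    ∀ᶠ w in 𝓝 y, ⟪n, w⟫_ℝ ≤ c → w ∈ K := by
  obtain ⟨ε, hε, hb⟩ := hyK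
  -- The ray from `z` through `w` crosses the hyperplane at the multiple `s w`; it is one at `y` and
  -- at least one on the side of `z` near `y`.
  set s : E d → ℝ := fun w => (c - ⟪n, z⟫_ℝ) / (⟪n, w⟫_ℝ - ⟪n, z⟫_ℝ) with hs
  have hsy : s y = 1 := by
    rw [hs]
    simp only [mem_hyperplane.1 hy]
    exact div_self (by linarith)
  have hcs : ContinuousAt s y := by
    refine ContinuousAt.div continuousAt_const (by fun_prop) ?_
    rw [mem_hyperplane.1 hy]
    linarith
  have hcq : ContinuousAt (fun w => z + s w • (w - z)) y :=
    continuousAt_const.add (hcs.smul (by fun_prop))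
  have h1 : ∀ᶠ w in 𝓝 y, z + s w • (w - z) ∈ Metric.ball y ε := by
    refine hcq.eventually_mem ?_
    rw [hsy, one_smul, add_sub_cancel]
    exact Metric.ball_mem_nhds y hε
  have h2 : ∀ᶠ w in 𝓝 y, ⟪n, z⟫_ℝ < ⟪n, w⟫_ℝ := by
    refine ContinuousAt.eventually_lt continuousAt_const (by fun_prop) ?_
    rwa [mem_hyperplane.1 hy]
  filter_upwards [h1, h2] with w hw1 hw2 hwc
  have hq : z + s w • (w - z) ∈ K := by
    refine hb _ hw1 ?_
    rw [mem_hyperplane, inner_add_right, real_inner_smul_right, inner_sub_right, hs]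
    simp only
    rw [div_mul_cancel₀ _ (by linarith)]
    ring
  have hs1 : 1 ≤ s w := by
    rw [hs]
    simp only
    rw [one_le_div (by linarith)]
    linarith
  have hs0 : 0 < s w := by linarith
  have e : w = (1 - (s w)⁻¹) • z + (s w)⁻¹ • (z + s w • (w - z)) := by
    rw [smul_add, inv_smul_smul₀ hs0.ne']
    module
  rw [e]
  exact hK hz hq (sub_nonneg.2 (inv_le_one_of_one_le₀ hs1)) (by positivity) (by ring)

/-- The common part lies in a separating hyperplane. Almost every point of it is relatively
interior, and there the two bodies fill the two opposite half-balls. -/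
theorem ae_mem_interior_union {K K' : Set (E d)} (hK : Convex ℝ K) (hK' : Convex ℝ K')
    (hKc : IsClosed K) (hKc' : IsClosed K') (hKn : (interior K).Nonempty)
    (hKn' : (interior K').Nonempty) (hd : Disjoint (interior K) (interior K')) :
    ∀ᵐ y ∂((surf d).restrict (K ∩ K')), y ∈ interior (K ∪ K') := by
  obtain ⟨n, c, hn, h1, h2, h3, h4⟩ := exists_separating hK hK' hKc hKc' hKn hKn' hd
  have hm := (hKc.inter hKc').measurableSet
  have hsub : K ∩ K' ⊆ hyperplane n c := fun x hx => le_antisymm (h1 x hx.1) (h2 x hx.2)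
  obtain ⟨z, hz⟩ := hKn
  obtain ⟨z', hz'⟩ := hKn'
  filter_upwards [ae_mem_relative_interior hn (hK.inter hK') hm hsub, ae_restrict_mem hm]
    with y ⟨ε, hε, hy⟩ hyK
  have e1 := eventually_mem_of_le_hyperplane hK (hsub hyK) (interior_subset hz) (h3 z hz)
    ⟨ε, hε, fun w hw hwc => (hy w hw hwc).1⟩
  have hneg : ∀ w : E d, w ∈ hyperplane (-n) (-c) ↔ w ∈ hyperplane n c := fun w => by
    rw [mem_hyperplane, mem_hyperplane, inner_neg_left, neg_inj]
  have e2 := eventually_mem_of_le_hyperplane hK' (n := -n) (c := -c) ((hneg y).2 (hsub hyK))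
    (interior_subset hz') (by rw [inner_neg_left]; linarith [h4 z' hz'])
    ⟨ε, hε, fun w hw hwc => (hy w hw ((hneg w).1 hwc)).2⟩
  rw [mem_interior_iff_mem_nhds]
  filter_upwards [e1, e2] with w hw1 hw2
  rcases le_total ⟪n, w⟫_ℝ c with h | h
  · exact Or.inl (hw1 h)
  · exact Or.inr (hw2 (by rw [inner_neg_left]; linarith))

/-- A convex body with interior points is contained in the closure of its interior. If `K''`
contained `y`, its interior would come close to `y` and meet that of `K` or `K'`. -/
theorem notMem_of_mem_interior_union {K K' K'' : Set (E d)} (hK : Convex ℝ K) (hK' : Convex ℝ K')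
    (hKn : (interior K).Nonempty) (hKn' : (interior K').Nonempty) (hK'' : Convex ℝ K'')
    (hKn'' : (interior K'').Nonempty) (hd : Disjoint (interior K) (interior K''))
    (hd' : Disjoint (interior K') (interior K'')) {y : E d} (hy : y ∈ interior (K ∪ K')) :
    y ∉ K'' := by
  intro hyK
  have cl : ∀ {S : Set (E d)}, Convex ℝ S → (interior S).Nonempty →
      S ⊆ closure (interior S) := fun hS hSn => by
    rw [hS.closure_interior_eq_closure_of_nonempty_interior hSn]
    exact subset_closure
  obtain ⟨z, hz1, hz2⟩ := mem_closure_iff.1 (cl hK'' hKn'' hyK) _ isOpen_interior hy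
  rcases interior_subset hz1 with h | h
  · obtain ⟨w, hw1, hw2⟩ := mem_closure_iff.1 (cl hK hKn h) _ isOpen_interior hz2
    exact disjoint_left.1 hd hw2 hw1
  · obtain ⟨w, hw1, hw2⟩ := mem_closure_iff.1 (cl hK' hKn' h) _ isOpen_interior hz2
    exact disjoint_left.1 hd' hw2 hw1

/-- A Lipschitz domain lies on one side of its boundary: stepping from a boundary point in the
direction `-e` leads outside the closure. This puts the interiors of elements inside `Ω`, not merely
inside its closure. -/
theorem IsLipschitzDomain.interior_closure {D : Set (E d)} (hD : IsLipschitzDomain D) :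
    interior (closure D) = D := by
  refine subset_antisymm (fun x hx => ?_) (interior_maximal subset_closure hD.1)
  by_contra hxD
  obtain ⟨e, r, L, γ, he, hr, hγ, h⟩ := hD.2.2 x
    ⟨interior_subset hx, fun h => hxD (interior_subset h)⟩
  have hle : ⟪e, x⟫_ℝ ≤ γ (x - ⟪e, x⟫_ℝ • e) :=
    not_lt.1 fun hlt => hxD ((h x (Metric.mem_ball_self hr)).2 hlt)
  have hcont : Tendsto (fun t : ℝ => x - t • e) (𝓝[>] 0) (𝓝 x) := by
    have : Continuous fun t : ℝ => x - t • e := by fun_prop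
    simpa using (this.tendsto 0).mono_left nhdsWithin_le_nhds
  obtain ⟨t, ⟨ht1, ht2⟩, ht⟩ := ((hcont.eventually ((isOpen_interior.mem_nhds hx))).and
    (hcont.eventually (Metric.ball_mem_nhds x hr)) |>.and self_mem_nhdsWithin).exists
  set y := x - t • e with hy
  have hU : IsOpen {w : E d | ⟪e, w⟫_ℝ < γ (w - ⟪e, w⟫_ℝ • e)} :=
    isOpen_lt (by fun_prop) (hγ.continuous.comp (by fun_prop))
  have hyU : y ∈ {w : E d | ⟪e, w⟫_ℝ < γ (w - ⟪e, w⟫_ℝ • e)} ∩ Metric.ball x r := by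
    refine ⟨?_, ht2⟩
    have e1 : ⟪e, y⟫_ℝ = ⟪e, x⟫_ℝ - t := by
      rw [hy, inner_sub_right, real_inner_smul_right, inner_self_unit he, mul_one]
    have e2 : y - ⟪e, y⟫_ℝ • e = x - ⟪e, x⟫_ℝ • e := by
      rw [e1, hy]; module
    rw [mem_ofPred_eq, e2, e1]
    have : 0 < t := ht
    linarith
  obtain ⟨w, ⟨hw1, hw2⟩, hwD⟩ := mem_closure_iff.1 (interior_subset ht1) _
    (hU.inter Metric.isOpen_ball) hyU
  exact lt_asymm hw1 ((h w hw2).1 hwD)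

end HDG
end

noncomputable section
namespace HDG
variable {d : ℕ} {V : Type*} [NormedAddCommGroup V] [NormedSpace ℝ V]

/-! ### Faces -/

theorem exists_unit_inner {f : E d →L[ℝ] ℝ} (hf : f ≠ 0) :
    ∃ (n : E d) (a : ℝ), ‖n‖ = 1 ∧ 0 < a ∧ ∀ x, f x = a * ⟪n, x⟫_ℝ := by
  set m : E d := (InnerProductSpace.toDual ℝ (E d)).symm f with hm
  have hfm : ∀ x, ⟪m, x⟫_ℝ = f x := fun x => InnerProductSpace.toDual_symm_apply
  have hm0 : 0 < ‖m‖ := by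
    rw [norm_pos_iff]
    rintro hm0
    refine hf (ContinuousLinearMap.ext fun x => ?_)
    rw [← hfm, hm0, inner_zero_left]
    rfl
  refine ⟨‖m‖⁻¹ • m, ‖m‖, ?_, hm0, fun x => ?_⟩
  · rw [norm_smul, norm_inv, norm_norm, inv_mul_cancel₀ hm0.ne']
  · rw [real_inner_smul_left, mul_inv_cancel_left₀ hm0.ne', hfm]

theorem exists_normal_of_subset_frontier {K F : Set (E d)} (hK : Convex ℝ K)
    (hKn : (interior K).Nonempty) (hF : Convex ℝ F) (hFn : F.Nonempty) (hFK : F ⊆ frontier K) :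
    ∃ n : E d, ‖n‖ = 1 ∧ ∀ x ∈ F, ∀ y ∈ K, ⟪n, y - x⟫_ℝ ≤ 0 := by
  obtain ⟨f, u, h1, h2⟩ := geometric_hahn_banach_open hK.interior isOpen_interior hF
    (disjoint_left.2 fun x hx hxF => (hFK hxF).2 hx)
  obtain ⟨z, hz⟩ := hKn
  obtain ⟨x0, hx0⟩ := hFn
  have hf0 : f ≠ 0 := by
    rintro rfl
    have := h1 z hz
    have := h2 x0 hx0
    simp only [zero_apply] at *
    linarith
  obtain ⟨n, a, hn, ha, hfn⟩ := exists_unit_inner hf0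
  refine ⟨n, hn, fun x hx y hy => ?_⟩
  have hy' : f y ≤ u := by
    refine closure_minimal (t := {x | f x ≤ u}) (fun x hx => (h1 x hx).le)
      (isClosed_le f.continuous continuous_const) ?_
    rw [hK.closure_interior_eq_closure_of_nonempty_interior ⟨z, hz⟩]
    exact subset_closure hy
  have h3 : a * ⟪n, y - x⟫_ℝ ≤ 0 := by
    rw [← hfn, map_sub]
    linarith [h2 x hx]
  exact nonpos_of_mul_nonpos_right h3 ha

theorem inner_lt_of_mem_interior {K : Set (E d)} {n y : E d} {c : ℝ} (hn : ‖n‖ = 1)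
    (h : ∀ y ∈ K, ⟪n, y⟫_ℝ ≤ c) (hy : y ∈ interior K) : ⟪n, y⟫_ℝ < c := by
  obtain ⟨ε, hε, hb⟩ := Metric.mem_nhds_iff.1 (mem_interior_iff_mem_nhds.1 hy)
  have h1 : y + (ε / 2) • n ∈ K := by
    refine hb ?_
    rw [mem_ball_iff_norm, add_sub_cancel_left, norm_smul, hn, mul_one,
      Real.norm_of_nonneg (by positivity)]
    linarith
  have h2 := h _ h1
  rw [inner_add_right, real_inner_smul_right, inner_self_unit hn] at h2
  linarith

theorem nonempty_of_surf_pos {F : Set (E d)} (h : 0 < surf d F) : F.Nonempty :=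
  nonempty_of_measure_ne_zero h.ne'

theorem IsFacet.exists_normal {K F : Set (E d)} (h : IsFacet K F) :
    ∃ (n : E d) (c : ℝ), ‖n‖ = 1 ∧ F = K ∩ hyperplane n c ∧ ∀ y ∈ K, ⟪n, y⟫_ℝ ≤ c := by
  obtain ⟨x, hx⟩ := nonempty_of_surf_pos h.2.2
  obtain ⟨f, hf⟩ := h.1 ⟨x, hx⟩
  -- The zero functional would expose all of `K`, while a facet is a proper subset.
  have hf0 : f ≠ 0 := by
    rintro rfl
    exact h.2.1 (by simp [hf])
  obtain ⟨n, a, hn, ha, hfn⟩ := exists_unit_inner hf0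
  simp only [hfn, mul_le_mul_iff_right₀ ha] at hf
  rw [hf] at hx
  refine ⟨n, ⟪n, x⟫_ℝ, hn, ?_, fun y hy => hx.2 y hy⟩
  rw [hf]
  ext y
  constructor
  · rintro ⟨hy, hy'⟩
    exact ⟨hy, le_antisymm (hx.2 y hy) (hy' x hx.1)⟩
  · rintro ⟨hy, hy'⟩
    exact ⟨hy, fun z hz => (hx.2 z hz).trans_eq (mem_hyperplane.1 hy').symm⟩

/-- Agreement of the hyperplanes near one point makes the normals parallel, `n' = ± n`; the sign is
decided by the point `z`, which lies strictly below both. -/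
theorem unit_eq_of_relative_interior {n n' y z : E d} {c c' : ℝ} (hn : ‖n‖ = 1) (hn' : ‖n'‖ = 1)
    (hy : y ∈ hyperplane n c)
    (hC : ∃ ε > 0, ∀ w ∈ Metric.ball y ε, w ∈ hyperplane n c → w ∈ hyperplane n' c')
    (hz : ⟪n, z⟫_ℝ < c) (hz' : ⟪n', z⟫_ℝ < c') : n = n' ∧ c = c' := by
  obtain ⟨ε, hε, hb⟩ := hC
  have hy' := hb y (Metric.mem_ball_self hε) hy
  have key : ∀ v : E d, ⟪n, v⟫_ℝ = 0 → ⟪n', v⟫_ℝ = 0 := by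
    intro v hv
    by_cases hv0 : v = 0
    · rw [hv0, inner_zero_right]
    have hvn : 0 < ‖v‖ := norm_pos_iff.2 hv0
    have h1 := hb (y + (ε / 2 / ‖v‖) • v) (by
      rw [mem_ball_iff_norm, add_sub_cancel_left, norm_smul, norm_div, norm_norm,
        div_mul_cancel₀ _ hvn.ne', Real.norm_of_nonneg (by positivity)]
      linarith) (by
      rw [mem_hyperplane, inner_add_right, real_inner_smul_right, hv, mem_hyperplane.1 hy]
      ring)
    rw [mem_hyperplane, inner_add_right, real_inner_smul_right, mem_hyperplane.1 hy'] at h1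
    have h2 : ε / 2 / ‖v‖ * ⟪n', v⟫_ℝ = 0 := by linarith
    exact (mul_eq_zero.1 h2).resolve_left (by positivity)
  set t := ⟪n, n'⟫_ℝ with ht
  have hv : ⟪n, n' - t • n⟫_ℝ = 0 := by
    rw [inner_sub_right, real_inner_smul_right, inner_self_unit hn]; ring
  have hv' := key _ hv
  have h0 : n' - t • n = 0 := by
    rw [← inner_self_eq_zero (𝕜 := ℝ), inner_sub_left, real_inner_smul_left, hv, hv']
    ring
  have hnt : n' = t • n := sub_eq_zero.1 h0
  have htt : |t| = 1 := by
    rw [hnt, norm_smul, hn, mul_one, Real.norm_eq_abs] at hn'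
    exact hn'
  have hc' : c' = t * c := by
    rw [← mem_hyperplane.1 hy', hnt, real_inner_smul_left, mem_hyperplane.1 hy]
  rcases eq_or_eq_neg_of_abs_eq htt with h | h
  · rw [h, one_smul] at hnt
    rw [h, one_mul] at hc'
    exact ⟨hnt.symm, hc'.symm⟩
  · rw [hnt, hc', h, real_inner_smul_left] at hz'
    linarith

/-- An intersection of positive measure has a relatively interior point, where the two supporting
hyperplanes agree; then they are the same, and so are the facets they cut out of `K`. -/
theorem surf_facet_inter {K F F' : Set (E d)} (hK : Convex ℝ K) (hKc : IsClosed K)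
    (hKn : (interior K).Nonempty) (h : IsFacet K F) (h' : IsFacet K F') (hne : F ≠ F') :
    surf d (F ∩ F') = 0 := by
  obtain ⟨n, c, hn, hF, hc⟩ := h.exists_normal
  obtain ⟨n', c', hn', hF', hc'⟩ := h'.exists_normal
  obtain ⟨z, hz⟩ := hKn
  by_contra hpos
  have hconv : ∀ (n : E d) (c : ℝ), Convex ℝ (hyperplane n c) := fun n c =>
    convex_hyperplane (h := ⟨fun x y => inner_add_right n x y,
      fun a x => real_inner_smul_right n x a⟩) c
  have hcl : IsClosed (F ∩ F') := by
    rw [hF, hF']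
    exact (hKc.inter (isClosed_hyperplane n c)).inter (hKc.inter (isClosed_hyperplane n' c'))
  have hco : Convex ℝ (F ∩ F') := by
    rw [hF, hF']
    exact (hK.inter (hconv n c)).inter (hK.inter (hconv n' c'))
  have hsub : F ∩ F' ⊆ hyperplane n c := by
    rw [hF]
    exact fun x hx => hx.1.2
  have hae := ae_mem_relative_interior hn hco hcl.measurableSet hsub
  have : NeBot (ae ((surf d).restrict (F ∩ F'))) := by
    rw [ae_neBot, Ne, Measure.restrict_eq_zero]
    exact hpos
  obtain ⟨y, ⟨ε, hε, hy⟩, hyF⟩ := (hae.and (ae_restrict_mem hcl.measurableSet)).exists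
  obtain ⟨e1, e2⟩ := unit_eq_of_relative_interior hn hn' (hsub hyF)
    ⟨ε, hε, fun w hw hwc => (hF' ▸ (hy w hw hwc).2 : w ∈ K ∩ hyperplane n' c').2⟩
    (inner_lt_of_mem_interior hn hc hz) (inner_lt_of_mem_interior hn' hc' hz)
  exact hne (by rw [hF, hF', e1, e2])

namespace Mesh

variable {P : Model d} (M : Mesh P)

theorem elem_subset {K : Set (E d)} (hK : K ∈ M.elems) : K ⊆ closure P.Ω := by
  rw [M.cover]
  exact subset_biUnion_of_mem (u := fun K => K) (Finset.mem_coe.2 hK)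

theorem interior_elem_subset {K : Set (E d)} (hK : K ∈ M.elems) : interior K ⊆ P.Ω := by
  rw [← P.lip.interior_closure]
  exact interior_mono (M.elem_subset hK)

/-- Almost every point of `K ∩ K'` is interior to `K ∪ K'`, hence it lies in `Ω` and in no third
element. This replaces any combinatorial conformity of the mesh and covers hanging nodes. -/
theorem ae_elem_inter {K K' : Set (E d)} (hK : K ∈ M.elems) (hK' : K' ∈ M.elems) (hne : K ≠ K') :
    ∀ᵐ y ∂((surf d).restrict (K ∩ K')), y ∈ P.Ω ∧
      ∀ K'' ∈ M.elems, y ∈ K'' → K'' = K ∨ K'' = K' := by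
  have e := M.isElement
  filter_upwards [ae_mem_interior_union (e K hK).convex (e K' hK').convex
    (e K hK).isCompact.isClosed (e K' hK').isCompact.isClosed (e K hK).interior_nonempty
    (e K' hK').interior_nonempty (M.disj K hK K' hK' hne)] with y hy
  refine ⟨?_, fun K'' hK'' hyK => ?_⟩
  · rw [← P.lip.interior_closure]
    exact interior_mono (union_subset (M.elem_subset hK) (M.elem_subset hK')) hy
  · by_contra hcon
    rw [not_or] at hcon
    exact notMem_of_mem_interior_union (e K hK).convex (e K' hK').convex
      (e K hK).interior_nonempty (e K' hK').interior_nonempty (e K'' hK'').convex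
      (e K'' hK'').interior_nonempty (M.disj K hK K'' hK'' (Ne.symm hcon.1))
      (M.disj K' hK' K'' hK'' (Ne.symm hcon.2)) hy hyK

theorem surf_eq_zero_of_ae {S F : Set (E d)} {p : E d → Prop}
    (h : ∀ᵐ y ∂((surf d).restrict S), p y) (hF : F ⊆ S) (hp : ∀ y ∈ F, ¬ p y) :
    surf d F = 0 := by
  have h1 : (surf d).restrict S F = 0 := measure_mono_null (fun y hy => hp y hy) (ae_iff.1 h)
  rwa [Measure.restrict_eq_self _ hF] at h1

theorem surf_interiorFace_inter_frontier {F : Set (E d)} (hF : IsInteriorFace M.elems F) :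
    surf d (F ∩ frontier P.Ω) = 0 := by
  obtain ⟨-, K, hK, K', hK', hne, rfl⟩ := hF
  refine surf_eq_zero_of_ae (M.ae_elem_inter hK hK' hne) inter_subset_left
    fun y hy h => hy.2.2 ?_
  rw [P.lip.1.interior_eq]
  exact h.1

theorem face_facts {F : Set (E d)} (hF : F ∈ M.faces) :
    Convex ℝ F ∧ IsCompact F ∧ 0 < surf d F := by
  have e := M.isElement
  rcases (M.mem_faces F).1 hF with ⟨h0, K, hK, K', hK', -, rfl⟩ | ⟨-, K, hK, h⟩
  · exact ⟨(e K hK).convex.inter (e K' hK').convex,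
      (e K hK).isCompact.inter (e K' hK').isCompact, h0⟩
  · refine ⟨h.1.convex (e K hK).convex, ?_, h.2.2⟩
    exact h.1.isCompact (e K hK).isCompact

/-- Almost every point of an interior face determines the two elements that contain it, hence the
face, and it is not in `∂Ω`. Two boundary faces either are facets of one element or lie on two
elements, whose common part is almost everywhere inside `Ω`. -/
theorem surf_face_inter {F F' : Set (E d)} (hF : F ∈ M.faces) (hF' : F' ∈ M.faces)
    (hne : F ≠ F') : surf d (F ∩ F') = 0 := by
  have e := M.isElement
  rcases (M.mem_faces F).1 hF with h | h
  · rcases (M.mem_faces F').1 hF' with h' | h'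
    · obtain ⟨-, K, hK, K', hK', hKK, rfl⟩ := h
      obtain ⟨-, J, hJ, J', hJ', hJJ, rfl⟩ := h'
      refine surf_eq_zero_of_ae (M.ae_elem_inter hK hK' hKK) inter_subset_left fun y hy hp => ?_
      rcases hp.2 J hJ hy.2.1 with rfl | rfl <;> rcases hp.2 J' hJ' hy.2.2 with rfl | rfl
      · exact hJJ rfl
      · exact hne rfl
      · exact hne (inter_comm _ _)
      · exact hJJ rfl
    · exact measure_mono_null (inter_subset_inter_right _ h'.1)
        (M.surf_interiorFace_inter_frontier h)
  · rcases (M.mem_faces F').1 hF' with h' | h'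
    · rw [inter_comm]
      exact measure_mono_null (inter_subset_inter_right _ h.1)
        (M.surf_interiorFace_inter_frontier h')
    · obtain ⟨hFΩ, K, hK, h⟩ := h
      obtain ⟨-, K', hK', h'⟩ := h'
      by_cases hKK : K = K'
      · subst hKK
        exact surf_facet_inter (e K hK).convex (e K hK).isCompact.isClosed
          (e K hK).interior_nonempty h h' hne
      · refine surf_eq_zero_of_ae (M.ae_elem_inter hK hK' hKK)
          (inter_subset_inter h.1.subset h'.1.subset) fun y hy hp => (hFΩ hy.1).2 ?_
        rw [P.lip.1.interior_eq]
        exact hp.1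

theorem mem_facesOf {K F : Set (E d)} : F ∈ M.facesOf K ↔ F ∈ M.faces ∧ F ⊆ frontier K := by
  classical
  unfold facesOf
  rw [Finset.mem_filter]

/-- The pieces are mesh faces, which can be proper parts of facets. Each is convex and contained in
the frontier, so a supporting hyperplane exists and `outwardNormal` does not take its default value.
-/
theorem isPolytope {K : Set (E d)} (hK : K ∈ M.elems) :
    IsPolytope K (M.facesOf K) (outwardNormal K) := by
  have e := M.isElement K hK
  have hn : ∀ F ∈ M.facesOf K, ‖outwardNormal K F‖ = 1 ∧
      ∀ x ∈ F, ∀ y ∈ K, ⟪outwardNormal K F, y - x⟫_ℝ ≤ 0 := fun F hF => by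
    rw [mem_facesOf] at hF
    have h1 := M.face_facts hF.1
    have h := exists_normal_of_subset_frontier e.convex e.interior_nonempty h1.1
      (nonempty_of_surf_pos h1.2.2) hF.2
    rw [outwardNormal, dif_pos h]
    exact h.choose_spec
  refine ⟨e.convex, e.isCompact, e.interior_nonempty, ?_, fun F hF => ?_, fun F hF => ?_,
    fun F hF => (hn F hF).1, fun F hF => (hn F hF).2, fun F hF F' hF' hne => ?_⟩
  · rw [M.frontier_eq K hK]
    ext x
    simp only [mem_iUnion, mem_facesOf, exists_prop, and_assoc]
  · exact (M.face_facts (M.mem_facesOf.1 hF).1).2.1.isClosed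
  · exact nonempty_of_surf_pos (M.face_facts (M.mem_facesOf.1 hF).1).2.2
  · exact M.surf_face_inter (M.mem_facesOf.1 hF).1 (M.mem_facesOf.1 hF').1 hne

/-! ### Decomposition of integrals -/

theorem volume_elem_sdiff {K : Set (E d)} (hK : K ∈ M.elems) : volume (K \ interior K) = 0 :=
  measure_mono_null (sdiff_subset_sdiff_left subset_closure)
    ((M.isElement K hK).convex.addHaar_frontier volume)

theorem ae_eq_biUnion {D : Set (E d)} (hD : IsLipschitzDomain D) {S : Finset (Set (E d))}
    (hS : S ⊆ M.elems) (h : closure D = ⋃ K ∈ S, K) :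
    (D : Set (E d)) =ᵐ[volume] (⋃ K ∈ S, interior K : Set (E d)) ∧ volume (closure D \ D) = 0 := by
  have hsub : ⋃ K ∈ S, interior K ⊆ D := by
    refine iUnion₂_subset fun K hK => ?_
    rw [← hD.interior_closure, h]
    exact interior_mono (subset_biUnion_of_mem (u := fun K => K) (Finset.mem_coe.2 hK))
  have hnull : volume (closure D \ ⋃ K ∈ S, interior K) = 0 := by
    refine measure_mono_null (t := ⋃ K ∈ S, K \ interior K) ?_ ?_
    · rintro x ⟨hx, hx'⟩
      rw [h] at hx
      obtain ⟨K, hK, hxK⟩ := mem_iUnion₂.1 hx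
      exact mem_iUnion₂.2 ⟨K, hK, hxK, fun hxi => hx' (mem_iUnion₂.2 ⟨K, hK, hxi⟩)⟩
    · exact (measure_biUnion_null_iff S.countable_toSet).2 fun K hK => M.volume_elem_sdiff (hS hK)
  refine ⟨?_, measure_mono_null (sdiff_subset_sdiff_right hsub) hnull⟩
  rw [ae_eq_set]
  refine ⟨measure_mono_null (sdiff_subset_sdiff_left subset_closure) hnull, ?_⟩
  rw [sdiff_eq_empty.2 hsub, measure_empty]

theorem integral_eq_sum_of_subset {S : Finset (Set (E d))} (hS : S ⊆ M.elems) {D : Set (E d)}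
    (hD : (D : Set (E d)) =ᵐ[volume] (⋃ K ∈ S, interior K : Set (E d))) {f : E d → V}
    (hf : ∀ K ∈ S, IntegrableOn f (interior K)) :
    ∫ x in D, f x = ∑ K ∈ S, ∫ x in interior K, f x := by
  rw [setIntegral_congr_set hD]
  refine integral_biUnion_finset S (fun K _ => isOpen_interior.measurableSet) ?_ hf
  intro K hK K' hK' hne
  exact M.disj K (hS hK) K' (hS hK') hne

theorem ae_eq_Ω : (P.Ω : Set (E d)) =ᵐ[volume] (⋃ K ∈ M.elems, interior K : Set (E d)) :=
  (M.ae_eq_biUnion P.lip subset_rfl M.cover).1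

theorem integral_eq_sum {f : E d → V} (hf : ∀ K ∈ M.elems, IntegrableOn f (interior K)) :
    ∫ x in P.Ω, f x = ∑ K ∈ M.elems, ∫ x in interior K, f x :=
  M.integral_eq_sum_of_subset subset_rfl M.ae_eq_Ω hf

/-- The interface has volume zero, because it consists of points in the boundaries of finitely many
convex elements. -/
theorem ae_eq_union (M : Mesh P) : (P.Ω : Set (E d)) =ᵐ[volume] (P.Ωs ∪ P.Ωf : Set (E d)) := by
  classical
  have hs := (M.ae_eq_biUnion P.lip_s (Finset.filter_subset (fun K => K ⊆ closure P.Ωs) M.elems)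
    (by
      refine M.cover_s.trans ?_
      ext x
      simp only [mem_iUnion, Finset.mem_filter, exists_prop, and_assoc])).2
  have hf := (M.ae_eq_biUnion P.lip_f (Finset.filter_subset (fun K => K ⊆ closure P.Ωf) M.elems)
    (by
      refine M.cover_f.trans ?_
      ext x
      simp only [mem_iUnion, Finset.mem_filter, exists_prop, and_assoc])).2
  rw [ae_eq_set]
  refine ⟨measure_mono_null ?_ (measure_union_null hs hf), ?_⟩
  · rintro x ⟨hx, hx'⟩
    rw [mem_union, not_or] at hx'
    exact (P.cover hx).imp (fun h => ⟨h, hx'.1⟩) (fun h => ⟨h, hx'.2⟩)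
  · rw [sdiff_eq_empty.2 (union_subset P.sub_s P.sub_f), measure_empty]

end Mesh

end HDG
end

noncomputable section
namespace HDG
variable {d : ℕ} {V : Type*} [NormedAddCommGroup V] [NormedSpace ℝ V]

/-! ### Tensor algebra -/

theorem inner_eq_sum (v w : E d) : ⟪v, w⟫_ℝ = ∑ i, v i * w i := by
  rw [PiLp.inner_apply]
  refine Finset.sum_congr rfl fun i _ => ?_
  rw [RCLike.inner_apply, conj_trivial, mul_comm]

theorem sym_inner_eq_sum (σ τ : Sym d) : ⟪σ, τ⟫_ℝ = ∑ i, ∑ j, entry σ i j * entry τ i j := by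
  rw [Submodule.coe_inner, PiLp.inner_apply, Fintype.sum_prod_type]
  refine Finset.sum_congr rfl fun i _ => Finset.sum_congr rfl fun j _ => ?_
  rw [RCLike.inner_apply, conj_trivial, mul_comm]
  rfl

theorem entry_symm (σ : Sym d) (i j : Fin d) : entry σ i j = entry σ j i := σ.2 i j

theorem entry_symPart (A : Fin d → Fin d → ℝ) (i j : Fin d) :
    entry (symPart A) i j = (A i j + A j i) / 2 := rfl

/-- Contraction with a symmetric tensor does not see the antisymmetric part, which is why the strain
can replace the full gradient in Green's formula. -/
theorem inner_symPart (τ : Sym d) (A : Fin d → Fin d → ℝ) :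
    ⟪τ, symPart A⟫_ℝ = ∑ i, ∑ j, entry τ i j * A i j := by
  have h : ∑ i, ∑ j, entry τ i j * A j i = ∑ i, ∑ j, entry τ i j * A i j := by
    rw [Finset.sum_comm]
    refine Finset.sum_congr rfl fun i _ => Finset.sum_congr rfl fun j _ => ?_
    rw [entry_symm]
  simp_rw [sym_inner_eq_sum, entry_symPart, mul_div_assoc', mul_add, add_div,
    Finset.sum_add_distrib, ← Finset.sum_div]
  rw [h, add_halves]

theorem inner_mulVec (τ : Sym d) (n v : E d) :
    ⟪mulVec τ n, v⟫_ℝ = ∑ i, ∑ j, entry τ i j * n j * v i := by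
  rw [inner_eq_sum]
  refine Finset.sum_congr rfl fun i _ => ?_
  rw [← Finset.sum_mul]
  rfl

theorem inner_unitVec (n : E d) (j : Fin d) : ⟪n, unitVec j⟫_ℝ = n j := by
  rw [unitVec, EuclideanSpace.inner_single_right, one_mul, conj_trivial]

/-- `symPart` as a continuous linear map. -/
def symPartL : (Fin d → Fin d → ℝ) →L[ℝ] Sym d :=
  LinearMap.toContinuousLinearMap
    { toFun := symPart
      map_add' := fun A B => by
        ext q
        change (A q.1 q.2 + B q.1 q.2 + (A q.2 q.1 + B q.2 q.1)) / 2 =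
          (A q.1 q.2 + A q.2 q.1) / 2 + (B q.1 q.2 + B q.2 q.1) / 2
        ring
      map_smul' := fun c A => by
        ext q
        change (c * A q.1 q.2 + c * A q.2 q.1) / 2 = c * ((A q.1 q.2 + A q.2 q.1) / 2)
        ring }

/-- The strain of a differentiable vector field. -/
def classicalStrain (ψ : E d → E d) (x : E d) : Sym d :=
  symPart fun i j => fderiv ℝ ψ x (unitVec j) i

theorem continuous_classicalStrain {ψ : E d → E d} (hψ : ContDiff ℝ ∞ ψ) :
    Continuous (classicalStrain ψ) := by
  have h1 : Continuous (fderiv ℝ ψ) := hψ.continuous_fderiv (by simp)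
  have h2 : Continuous fun x => fun i j => fderiv ℝ ψ x (unitVec j) i :=
    continuous_pi fun i => continuous_pi fun j =>
      (coordL i).continuous.comp (h1.clm_apply continuous_const)
  exact (symPartL (d := d)).continuous.comp h2

/-! ### Traces and Green's formula on polytopes -/

namespace IsPolytope

variable {K : Set (E d)} {𝓕 : Finset (Set (E d))} {n : Set (E d) → E d}

theorem frontier_surf_lt_top (hd : 1 ≤ d) (h : IsPolytope K 𝓕 n) : surf d (frontier K) < ⊤ := by
  rw [h.frontier_eq]
  exact (measure_biUnion_finset_le 𝓕 _).trans_lt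
    (ENNReal.sum_lt_top.2 fun F hF => h.face_surf_lt_top hd hF)

theorem subset_closure_interior (h : IsPolytope K 𝓕 n) : K ⊆ closure (interior K) := by
  rw [h.convex.closure_interior_eq_closure_of_nonempty_interior h.nonempty]
  exact subset_closure

theorem frontier_subset (h : IsPolytope K 𝓕 n) : frontier K ⊆ closure (interior K) :=
  h.compact.isClosed.frontier_subset.trans h.subset_closure_interior

theorem isBounded_interior (h : IsPolytope K 𝓕 n) : Bornology.IsBounded (interior K) :=
  h.compact.isBounded.subset interior_subset

theorem isBounded_frontier (h : IsPolytope K 𝓕 n) : Bornology.IsBounded (frontier K) :=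
  h.compact.isBounded.subset h.compact.isClosed.frontier_subset

theorem traceInequality [CompleteSpace V] (hd : 1 ≤ d) (h : IsPolytope K 𝓕 n) :
    TraceInequality V (interior K) (frontier K) := by
  intro r hr hr1
  obtain ⟨A, hA⟩ := exists_surf_inter_closedBall_le hd
  obtain ⟨c, hc⟩ := h.exists_const
  have : IsFiniteMeasure ((surf d).restrict (frontier K)) :=
    isFiniteMeasure_restrict.2 (h.frontier_surf_lt_top hd).ne
  refine trace_inequality (A := 𝓕.card * A) hd isOpen_interior h.convex.interior
    h.isBounded_interior h.nonempty ?_ (fun p ρ hρ => ?_) hr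
  · exact (ae_restrict_mem isClosed_frontier.measurableSet).mono fun y hy => h.frontier_subset hy
  · rw [Measure.restrict_apply Metric.isClosed_closedBall.measurableSet, inter_comm,
      h.frontier_eq, iUnion₂_inter]
    refine (measure_biUnion_finset_le 𝓕 _).trans ?_
    calc _ ≤ ∑ F ∈ 𝓕, A * ENNReal.ofReal (ρ ^ (d - 1)) :=
          Finset.sum_le_sum fun F hF => hA _ _ F (h.norm_normal F hF)
            (h.face_closed F hF).measurableSet (hc F hF).1 p ρ hρ
      _ = _ := by
          rw [Finset.sum_const, nsmul_eq_mul]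
          push_cast
          ring

theorem integrableOn_face (hd : 1 ≤ d) (h : IsPolytope K 𝓕 n) {F : Set (E d)} (hF : F ∈ 𝓕)
    {f : E d → V} (hf : Continuous f) : IntegrableOn f F (surf d) := by
  have : IsFiniteMeasure ((surf d).restrict F) :=
    isFiniteMeasure_restrict.2 (h.face_surf_lt_top hd hF).ne
  obtain ⟨C, hC⟩ := (h.compact.of_isClosed_subset (h.face_closed F hF)
    (h.face_subset hF)).exists_bound_of_continuousOn hf.continuousOn
  exact Integrable.of_bound hf.aestronglyMeasurable C
    ((ae_restrict_mem (h.face_closed F hF).measurableSet).mono hC)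

/-- Green's formula for smooth tensors. -/
theorem green_smooth (hd : 1 ≤ d) (h : IsPolytope K 𝓕 n) {τ : E d → Sym d} {ψ : E d → E d}
    (hτ : ContDiff ℝ ∞ τ) (hψ : ContDiff ℝ ∞ ψ) :
    ∫ x in interior K, ((∑ i, (∑ j, entry (fderiv ℝ τ x (unitVec j)) i j) * ψ x i) +
        ⟪τ x, classicalStrain ψ x⟫_ℝ) =
      ∑ F ∈ 𝓕, ∫ x in F, ⟪mulVec (τ x) (n F), ψ x⟫_ℝ ∂(surf d) := by
  have hf : ∀ i j, ContDiff ℝ ∞ fun x => entry (τ x) i j * ψ x i := fun i j =>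
    ((entryL i j).contDiff.comp hτ).mul ((coordL i).contDiff.comp hψ)
  have hder : ∀ i j x, fderiv ℝ (fun x => entry (τ x) i j * ψ x i) x (unitVec j) =
      entry (fderiv ℝ τ x (unitVec j)) i j * ψ x i +
        entry (τ x) i j * fderiv ℝ ψ x (unitVec j) i := by
    intro i j x
    have h1 : HasFDerivAt (fun x => entry (τ x) i j) ((entryL i j).comp (fderiv ℝ τ x)) x :=
      (entryL i j).hasFDerivAt.comp x ((hτ.differentiable (by simp)) x).hasFDerivAt
    have h2 : HasFDerivAt (fun x => ψ x i) ((coordL i).comp (fderiv ℝ ψ x)) x :=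
      (coordL i).hasFDerivAt.comp x ((hψ.differentiable (by simp)) x).hasFDerivAt
    change fderiv ℝ ((fun x => entry (τ x) i j) * fun x => ψ x i) x (unitVec j) = _
    rw [(h1.mul h2).fderiv]
    simp only [add_apply, smul_apply, ContinuousLinearMap.comp_apply, entryL_apply, coordL_apply,
      smul_eq_mul]
    ring
  have e1 : ∀ x, (∑ i, (∑ j, entry (fderiv ℝ τ x (unitVec j)) i j) * ψ x i) +
      ⟪τ x, classicalStrain ψ x⟫_ℝ =
      ∑ i, ∑ j, fderiv ℝ (fun x => entry (τ x) i j * ψ x i) x (unitVec j) := by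
    intro x
    rw [classicalStrain, inner_symPart, ← Finset.sum_add_distrib]
    refine Finset.sum_congr rfl fun i _ => ?_
    rw [Finset.sum_mul, ← Finset.sum_add_distrib]
    exact Finset.sum_congr rfl fun j _ => (hder i j x).symm
  have hint : ∀ i j, IntegrableOn
      (fun x => fderiv ℝ (fun x => entry (τ x) i j * ψ x i) x (unitVec j)) (interior K) :=
    fun i j => Continuous.integrableOn_of_isBounded h.isBounded_interior
      (((hf i j).continuous_fderiv (by simp)).clm_apply continuous_const)
  simp_rw [e1]
  rw [integral_finsetSum _ fun i _ => integrable_finsetSum _ fun j _ => hint i j]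
  simp_rw [integral_finsetSum _ fun j _ => hint _ j, h.integral_fderiv hd (hf _ _)]
  simp_rw [inner_mulVec, inner_unitVec]
  calc _ = ∑ i, ∑ F ∈ 𝓕, ∑ j, (n F) j * ∫ y in F, entry (τ y) i j * ψ y i ∂(surf d) :=
        Finset.sum_congr rfl fun i _ => Finset.sum_comm
    _ = ∑ F ∈ 𝓕, ∑ i, ∑ j, (n F) j * ∫ y in F, entry (τ y) i j * ψ y i ∂(surf d) :=
        Finset.sum_comm
    _ = _ := by
        refine Finset.sum_congr rfl fun F hF => ?_
        have hi : ∀ i j, Integrable (fun x => entry (τ x) i j * (n F) j * ψ x i)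
            ((surf d).restrict F) := fun i j =>
          h.integrableOn_face hd hF ((((entryL i j).continuous.comp hτ.continuous).mul
            continuous_const).mul ((coordL i).continuous.comp hψ.continuous))
        rw [integral_finsetSum _ fun i _ => integrable_finsetSum _ fun j _ => hi i j]
        refine Finset.sum_congr rfl fun i _ => ?_
        rw [integral_finsetSum _ fun j _ => hi i j]
        refine Finset.sum_congr rfl fun j _ => ?_
        rw [← integral_const_mul]
        refine integral_congr_ae (ae_of_all _ fun x => ?_)
        simp only
        ring

theorem exists_hasTrace [CompleteSpace V] (hd : 1 ≤ d) (h : IsPolytope K 𝓕 n) {θ : ℝ}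
    (hθ : 1 / 2 < θ) (hθ1 : θ < 1) {f : E d → V}
    (hfm : StronglyMeasurable f) (hf : MemLp f 2 (volume.restrict (interior K)))
    (hfθ : gagliardoSq θ (interior K) f < ⊤) {η : E d → ℝ} (hη : IsMollifier (interior K) η) :
    ∃ g, HasTrace (interior K) (frontier K) f g ∧
      Tendsto (fun m => eLpNorm (smoothing (interior K) η (smoothParam m) f - g) 2
        ((surf d).restrict (frontier K))) atTop (𝓝 0) :=
  exists_hasTrace_of_gagliardoSq isOpen_interior h.isBounded_interior h.convex.interior hη
    h.isBounded_frontier isClosed_frontier.measurableSet (h.frontier_surf_lt_top hd).ne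
    (h.traceInequality hd) hθ hθ1 hfm hf hfθ

/-- `trace` is an arbitrary choice among traces; by uniqueness it may be replaced in boundary
integrals by whichever one is known explicitly. -/
theorem hasTrace_trace_ae_eq [CompleteSpace V] (hd : 1 ≤ d) (h : IsPolytope K 𝓕 n)
    {f g : E d → V} (hg : HasTrace (interior K) (frontier K) f g) :
    trace (interior K) (frontier K) f =ᵐ[(surf d).restrict (frontier K)] g :=
  (hasTrace_trace ⟨g, hg⟩).ae_eq isOpen_interior h.isBounded_interior (h.traceInequality hd) hg

end IsPolytope

end HDG
end

noncomputable section
namespace HDG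
variable {d : ℕ} {V : Type*} [NormedAddCommGroup V] [NormedSpace ℝ V]

/-! ### Pairings in `L²`, their limits, and Green's formula for non-smooth tensors. -/

section inner

variable {H : Type*} [NormedAddCommGroup H] [InnerProductSpace ℝ H]
variable {α : Type*} {mα : MeasurableSpace α} {μ : Measure α}

theorem integrable_inner_of_memLp_two {f g : α → H} (hf : MemLp f 2 μ) (hg : MemLp g 2 μ) :
    Integrable (fun x => ⟪f x, g x⟫_ℝ) μ := by
  refine (integrable_smul_of_memLp_two hf.norm hg.norm).mono (hf.1.inner hg.1)
    (ae_of_all _ fun x => ?_)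
  rw [smul_eq_mul, norm_mul, norm_norm, norm_norm]
  exact norm_inner_le_norm _ _

theorem tendsto_integral_inner {f : ℕ → α → H} {f0 g : α → H} (hf : ∀ n, MemLp (f n) 2 μ)
    (hf0 : MemLp f0 2 μ) (hg : MemLp g 2 μ)
    (h : Tendsto (fun n => eLpNorm (fun x => f n x - f0 x) 2 μ) atTop (𝓝 0)) :
    Tendsto (fun n => ∫ x, ⟪f n x, g x⟫_ℝ ∂μ) atTop (𝓝 (∫ x, ⟪f0 x, g x⟫_ℝ ∂μ)) := by
  refine tendsto_integral_of_norm_sub_le (fun n => integrable_inner_of_memLp_two (hf n) hg)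
    (integrable_inner_of_memLp_two hf0 hg) (fun n => ((hf n).sub hf0).1) h hg.norm
    (fun n => ae_of_all _ fun x => ?_)
  rw [← inner_sub_left, Pi.sub_apply, mul_comm]
  exact norm_inner_le_norm _ _

end inner

/-- The normal and the test field are moved into one fixed tensor, so the boundary integrals become
plain `L²` pairings that are continuous in `τ`. -/
theorem inner_mulVec_eq_inner_symPart (τ : Sym d) (n v : E d) :
    ⟪mulVec τ n, v⟫_ℝ = ⟪τ, symPart fun i j => v i * n j⟫_ℝ := by
  rw [inner_mulVec, inner_symPart]
  refine Finset.sum_congr rfl fun i _ => Finset.sum_congr rfl fun j _ => ?_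
  ring

theorem continuous_symPart_mul {ψ : E d → E d} (hψ : Continuous ψ) (n : E d) :
    Continuous fun x => symPart fun i j => ψ x i * n j := by
  have h2 : Continuous fun x => fun i j => ψ x i * n j :=
    continuous_pi fun i => continuous_pi fun j =>
      ((coordL i).continuous.comp hψ).mul continuous_const
  exact (symPartL (d := d)).continuous.comp h2

namespace IsPolytope

variable {K : Set (E d)} {𝓕 : Finset (Set (E d))} {n : Set (E d) → E d}

/-- Green's formula. -/
theorem green (hd : 1 ≤ d) (h : IsPolytope K 𝓕 n) {σ : E d → Sym d} {w : E d → E d}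
    (hσ : HasWeakDiv (interior K) σ w) (hσm : StronglyMeasurable σ) {θ : ℝ} (hθ : 1 / 2 < θ)
    (hθ1 : θ < 1) (hσθ : gagliardoSq θ (interior K) σ < ⊤) {ψ : E d → E d}
    (hψ : ContDiff ℝ ∞ ψ) :
    (∫ x in interior K, ⟪w x, ψ x⟫_ℝ) + ∫ x in interior K, ⟪σ x, classicalStrain ψ x⟫_ℝ =
      ∑ F ∈ 𝓕, ∫ x in F, ⟪mulVec (trace (interior K) (frontier K) σ x) (n F), ψ x⟫_ℝ
        ∂(surf d) := by
  obtain ⟨η, hη⟩ := exists_isMollifier isOpen_interior h.nonempty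
  have hb := h.isBounded_interior
  have hc := h.convex.interior
  have hm : MeasurableSet (interior K) := isOpen_interior.measurableSet
  obtain ⟨g, hg, hgt⟩ := h.exists_hasTrace hd hθ hθ1 hσm hσ.1 hσθ hη
  have hgtr := h.hasTrace_trace_ae_eq hd hg
  set S : ℕ → E d → Sym d := fun m => smoothing (interior K) η (smoothParam m) σ with hS
  set W : ℕ → E d → E d := fun m => smoothing (interior K) η (smoothParam m) w with hW
  have hSs : ∀ m, ContDiff ℝ ∞ (S m) := fun m =>
    contDiff_smoothing hm hb hη (smoothParam_lt_one m) hσ.1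
  have hWs : ∀ m, ContDiff ℝ ∞ (W m) := fun m =>
    contDiff_smoothing hm hb hη (smoothParam_lt_one m) hσ.2.1
  have hSL : ∀ m, MemLp (S m) 2 (volume.restrict (interior K)) := fun m =>
    memLp_two_of_isBounded hb (hSs m).continuous
  have hWL : ∀ m, MemLp (W m) 2 (volume.restrict (interior K)) := fun m =>
    memLp_two_of_isBounded hb (hWs m).continuous
  have hψL : MemLp ψ 2 (volume.restrict (interior K)) :=
    memLp_two_of_isBounded hb hψ.continuous
  have hεL : MemLp (classicalStrain ψ) 2 (volume.restrict (interior K)) :=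
    memLp_two_of_isBounded hb (continuous_classicalStrain hψ)
  have tS := tendsto_smoothing isOpen_interior hb hc hη half_le_smoothParam smoothParam_lt_one
    tendsto_smoothParam hσ.1
  have tW := tendsto_smoothing isOpen_interior hb hc hη half_le_smoothParam smoothParam_lt_one
    tendsto_smoothParam hσ.2.1
  -- The divergence of the smoothed tensor is `smoothParam m` times the smoothing of `w`; the extra
  -- factor tends to one.
  have t1 := (tendsto_smoothParam.mul (tendsto_integral_inner hWL hσ.2.1 hψL tW)).add
    (tendsto_integral_inner hSL hσ.1 hεL tS)
  rw [one_mul] at t1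
  have hmF : ∀ F ∈ 𝓕, MeasurableSet F := fun F hF => (h.face_closed F hF).measurableSet
  have t2 : Tendsto (fun m => ∑ F ∈ 𝓕, ∫ x in F, ⟪mulVec (S m x) (n F), ψ x⟫_ℝ ∂(surf d)) atTop
      (𝓝 (∑ F ∈ 𝓕, ∫ x in F, ⟪mulVec (g x) (n F), ψ x⟫_ℝ ∂(surf d))) := by
    refine tendsto_finsetSum _ fun F hF => ?_
    simp_rw [inner_mulVec_eq_inner_symPart]
    have hle : (surf d).restrict F ≤ (surf d).restrict (frontier K) :=
      Measure.restrict_mono (h.face_subset_frontier hF) le_rfl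
    refine tendsto_integral_inner (fun m => memLp_surf (h.face_isBounded hF) (hmF F hF)
      (h.face_surf_lt_top hd hF).ne (hSs m).continuous) (hg.1.mono_measure hle)
      (memLp_surf (h.face_isBounded hF) (hmF F hF) (h.face_surf_lt_top hd hF).ne
        (continuous_symPart_mul hψ.continuous (n F))) ?_
    exact tendsto_of_tendsto_of_tendsto_of_le_of_le tendsto_const_nhds hgt (fun _ => zero_le)
      fun m => eLpNorm_mono_measure _ hle
  have e : ∀ m, smoothParam m * (∫ x in interior K, ⟪W m x, ψ x⟫_ℝ) +
      (∫ x in interior K, ⟪S m x, classicalStrain ψ x⟫_ℝ) =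
      ∑ F ∈ 𝓕, ∫ x in F, ⟪mulVec (S m x) (n F), ψ x⟫_ℝ ∂(surf d) := by
    intro m
    rw [← h.green_smooth hd (hSs m) hψ, ← integral_const_mul, ← integral_add
      ((integrable_inner_of_memLp_two (hWL m) hψL).const_mul _)
      (integrable_inner_of_memLp_two (hSL m) hεL)]
    refine setIntegral_congr_fun hm fun x hx => ?_
    simp only [hS]
    simp_rw [div_smoothing_of_hasWeakDiv hm hb hc hη (smoothParam_pos m) (smoothParam_lt_one m) hσ
      hx]
    rw [inner_eq_sum, Finset.mul_sum]
    simp_rw [mul_assoc]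
    rfl
  simp_rw [e] at t1
  rw [tendsto_nhds_unique t1 t2]
  refine Finset.sum_congr rfl fun F hF => ?_
  have hF' : trace (interior K) (frontier K) σ =ᵐ[(surf d).restrict F] g :=
    ae_mono (Measure.restrict_mono (h.face_subset_frontier hF) le_rfl) hgtr
  refine integral_congr_ae (hF'.mono fun x hx => ?_)
  simp only [hx]

end IsPolytope

/-! ### Polynomial functions -/

theorem contDiff_mvPolynomial_eval {m : ℕ} (p : MvPolynomial (Fin m) ℝ) {c : E d → E m}
    (hc : ContDiff ℝ ∞ c) : ContDiff ℝ ∞ fun x => MvPolynomial.eval (fun i => c x i) p := by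
  induction p using MvPolynomial.induction_on with
  | C a => simpa using contDiff_const
  | add p q hp hq => simpa using hp.add hq
  | mul_X p i hp => simpa using hp.mul ((coordL i).contDiff.comp hc)

/-- All that is needed of a discrete function later is a smooth function on the whole space with the
same values on `D`, obtained from the polynomials of its coordinates in a basis of `V`. -/
theorem IsPolyOn.exists_contDiff [FiniteDimensional ℝ V] {m : ℕ} {simplex : Prop} {c : E d → E m}
    {k : ℕ} {D : Set (E d)} {f : E d → V} (h : IsPolyOn simplex c k D f)
    (hc : ContDiff ℝ ∞ c) : ∃ p : E d → V, ContDiff ℝ ∞ p ∧ EqOn f p D := by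
  let b := Module.finBasis ℝ V
  choose q hq using fun i => h (b.coord i)
  refine ⟨fun x => ∑ i, MvPolynomial.eval (fun j => c x j) (q i) • b i, ?_, fun x hx => ?_⟩
  · exact ContDiff.sum fun i _ => (contDiff_mvPolynomial_eval (q i) hc).smul contDiff_const
  · simp only
    rw [← b.sum_repr (f x)]
    refine Finset.sum_congr rfl fun i _ => ?_
    rw [← (hq i).2 x hx]
    rfl

theorem contDiff_affineMap {m : ℕ} (c : E d →ᵃ[ℝ] E m) : ContDiff ℝ ∞ c :=
  (⟨c, c.continuous_of_finiteDimensional⟩ : E d →ᴬ[ℝ] E m).contDiff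

end HDG
end

noncomputable section
namespace HDG
variable {d : ℕ} {V : Type*} [NormedAddCommGroup V] [NormedSpace ℝ V]

/-! ### Weak derivatives and test functions -/

theorem IsTest.mono {D D' : Set (E d)} {φ : E d → V} (h : IsTest D φ) (hD : D ⊆ D') :
    IsTest D' φ := ⟨h.1, h.2.1, h.2.2.trans hD⟩

theorem IsTest.eq_zero {D : Set (E d)} {φ : E d → V} (h : IsTest D φ) {x : E d} (hx : x ∉ D) :
    φ x = 0 := image_eq_zero_of_notMem_tsupport fun hx' => hx (h.2.2 hx')

theorem IsTest.fderiv_eq_zero {D : Set (E d)} {φ : E d → V} (h : IsTest D φ) {x : E d}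
    (hx : x ∉ D) : fderiv ℝ φ x = 0 :=
  image_eq_zero_of_notMem_tsupport fun hx' => hx (h.2.2 (tsupport_fderiv_subset ℝ hx'))

theorem IsTest.coordL_comp {D : Set (E d)} {ψ : E d → E d} (h : IsTest D ψ) (i : Fin d) :
    IsTest D fun x => ψ x i :=
  ⟨(coordL i).contDiff.comp h.1, h.2.1.comp_left (g := fun v : E d => v i) rfl,
    (tsupport_comp_subset (g := fun v : E d => v i) rfl ψ).trans h.2.2⟩

theorem fderiv_coord {ψ : E d → E d} (hψ : ContDiff ℝ ∞ ψ) (x v : E d) (i : Fin d) :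
    fderiv ℝ (fun x => ψ x i) x v = fderiv ℝ ψ x v i := by
  have h2 : HasFDerivAt (fun x => ψ x i) ((coordL i).comp (fderiv ℝ ψ x)) x :=
    (coordL i).hasFDerivAt.comp x ((hψ.differentiable (by simp)) x).hasFDerivAt
  rw [h2.fderiv]
  rfl

theorem IsTest.smul_contDiff {D : Set (E d)} {χ : E d → ℝ} {ψ : E d → V} (h : IsTest D χ)
    (hψ : ContDiff ℝ ∞ ψ) : IsTest D fun x => χ x • ψ x :=
  ⟨h.1.smul hψ, h.2.1.smul_right, (tsupport_smul_subset_left χ ψ).trans h.2.2⟩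

theorem HasWeakDiv.mono {D D' : Set (E d)} {σ : E d → Sym d} {w : E d → E d}
    (h : HasWeakDiv D σ w) (hD : D' ⊆ D) : HasWeakDiv D' σ w := by
  refine ⟨h.1.mono_measure (Measure.restrict_mono hD le_rfl),
    h.2.1.mono_measure (Measure.restrict_mono hD le_rfl), fun φ hφ i => ?_⟩
  have h1 := h.2.2 φ (hφ.mono hD) i
  have key : ∀ F : E d → ℝ, (∀ x ∉ D', F x = 0) → ∫ x in D', F x = ∫ x in D, F x := by
    intro F hF
    rw [setIntegral_eq_integral_of_forall_compl_eq_zero hF,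
      setIntegral_eq_integral_of_forall_compl_eq_zero fun x hx => hF x fun h => hx (hD h)]
  rw [key, key, h1]
  · intro x hx
    rw [hφ.eq_zero hx, mul_zero]
  · intro x hx
    simp [hφ.fderiv_eq_zero hx]

theorem HasWeakDiv.integral_test {D : Set (E d)} {σ : E d → Sym d} {w : E d → E d}
    (h : HasWeakDiv D σ w) {ψ : E d → E d} (hψ : IsTest D ψ) :
    (∫ x in D, ⟪w x, ψ x⟫_ℝ) + ∫ x in D, ⟪σ x, classicalStrain ψ x⟫_ℝ = 0 := by
  have i1 : ∀ i j, Integrable (fun x => entry (σ x) i j * fderiv ℝ (fun x => ψ x i) x (unitVec j))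
      (volume.restrict D) := fun i j => by
    have := integrable_smul_of_memLp_two ((hψ.coordL_comp i).memLp_fderiv (D := D) (unitVec j))
      ((entryL i j).comp_memLp' h.1)
    refine this.congr (ae_of_all _ fun x => ?_)
    exact mul_comm _ _
  have i2 : ∀ i, Integrable (fun x => w x i * ψ x i) (volume.restrict D) := fun i => by
    have := integrable_smul_of_memLp_two ((hψ.coordL_comp i).memLp (D := D))
      ((coordL i).comp_memLp' h.2.1)
    refine this.congr (ae_of_all _ fun x => ?_)
    exact mul_comm _ _
  simp_rw [inner_eq_sum, classicalStrain, inner_symPart, ← fderiv_coord hψ.1]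
  rw [integral_finsetSum _ fun i _ => i2 i,
    integral_finsetSum _ fun i _ => integrable_finsetSum _ fun j _ => i1 i j,
    ← Finset.sum_add_distrib]
  refine Finset.sum_eq_zero fun i _ => ?_
  rw [h.2.2 _ (hψ.coordL_comp i) i, add_neg_cancel]

theorem IsWeakDiv.hasWeakDiv {D : Set (E d)} {τ : L2 D (Sym d)} {w : L2 D (E d)}
    (h : IsWeakDiv D τ w) : HasWeakDiv D τ w := ⟨Lp.memLp τ, Lp.memLp w, h⟩

theorem HasWeakDeriv.mono {D D' : Set (E d)} {j : Fin d} {f g : E d → V}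
    (h : HasWeakDeriv D (fun _ : Fin 1 => j) f g) (hD : D' ⊆ D) :
    HasWeakDeriv D' (fun _ : Fin 1 => j) f g := by
  refine ⟨h.1.mono_measure (Measure.restrict_mono hD le_rfl),
    h.2.1.mono_measure (Measure.restrict_mono hD le_rfl), fun φ hφ => ?_⟩
  have h1 := h.2.2 φ (hφ.mono hD)
  have key : ∀ F : E d → V, (∀ x ∉ D', F x = 0) → ∫ x in D', F x = ∫ x in D, F x := by
    intro F hF
    rw [setIntegral_eq_integral_of_forall_compl_eq_zero hF,
      setIntegral_eq_integral_of_forall_compl_eq_zero fun x hx => hF x fun h => hx (hD h)]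
  rw [key, key, h1]
  · intro x hx
    rw [hφ.eq_zero hx, zero_smul]
  · intro x hx
    simp only [iteratedFDeriv_one_apply]
    rw [hφ.fderiv_eq_zero hx, zero_apply, zero_smul]

theorem HasWeakDeriv.ae_eq [CompleteSpace V] {D : Set (E d)} (hD : IsOpen D) {m : ℕ}
    {I : Fin m → Fin d} {f g g' : E d → V} (h : HasWeakDeriv D I f g)
    (h' : HasWeakDeriv D I f g') : g =ᵐ[volume.restrict D] g' := by
  have hloc : LocallyIntegrableOn (fun x => g x - g' x) D volume :=
    locallyIntegrableOn_of_locallyIntegrable_restrict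
      ((h.2.1.sub h'.2.1).locallyIntegrable (by norm_num))
  have h0 := hD.ae_eq_zero_of_integral_contDiff_smul_eq_zero hloc (fun φ hφ hc hs => by
    have hφ' : IsTest D φ := ⟨hφ, hc, hs⟩
    have h1 : ∫ x in D, φ x • g x = ∫ x in D, φ x • g' x := by
      have := (h.2.2 φ hφ').symm.trans (h'.2.2 φ hφ')
      exact smul_right_injective _ (pow_ne_zero m (by norm_num : (-1 : ℝ) ≠ 0)) this
    rw [← setIntegral_eq_integral_of_forall_compl_eq_zero (s := D) (fun x hx => by
      rw [hφ'.eq_zero hx, zero_smul])]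
    simp_rw [smul_sub]
    rw [integral_sub (integrable_smul_of_memLp_two (hφ'.memLp (D := D)) h.2.1)
      (integrable_smul_of_memLp_two (hφ'.memLp (D := D)) h'.2.1), h1, sub_self])
  rw [EventuallyEq, ae_restrict_iff' hD.measurableSet]
  exact h0.mono fun x hx hxD => sub_eq_zero.1 (hx hxD)

theorem hasWeakDeriv_of_contDiff {D : Set (E d)} (hDm : MeasurableSet D)
    (hDb : Bornology.IsBounded D) {f p : E d → V} (hp : ContDiff ℝ ∞ p) (h : EqOn f p D)
    (j : Fin d) :
    HasWeakDeriv D (fun _ : Fin 1 => j) f (fun x => fderiv ℝ p x (unitVec j)) := by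
  have hp1 : Continuous fun x => fderiv ℝ p x (unitVec j) :=
    (hp.continuous_fderiv (by simp)).clm_apply continuous_const
  refine ⟨(memLp_two_of_isBounded hDb hp.continuous).ae_eq ?_, memLp_two_of_isBounded hDb hp1,
    fun φ hφ => ?_⟩
  · have : f =ᵐ[volume.restrict D] p := (ae_restrict_iff' hDm).2 (ae_of_all _ fun x hx => h hx)
    exact this.symm
  · simp only [iteratedFDeriv_one_apply, pow_one, neg_smul, one_smul]
    have hφ1 : Continuous fun x => fderiv ℝ φ x (unitVec j) :=
      (hφ.1.continuous_fderiv (by simp)).clm_apply continuous_const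
    have hφc : HasCompactSupport fun x => fderiv ℝ φ x (unitVec j) :=
      (hφ.2.1.fderiv (𝕜 := ℝ)).comp_left (g := fun L : E d →L[ℝ] ℝ => L (unitVec j)) rfl
    rw [setIntegral_congr_fun (g := fun x => fderiv ℝ φ x (unitVec j) • p x) hDm
      (fun x hx => by simp only [h hx])]
    rw [setIntegral_eq_integral_of_forall_compl_eq_zero fun x hx => by
        rw [hφ.fderiv_eq_zero hx, zero_apply, zero_smul],
      setIntegral_eq_integral_of_forall_compl_eq_zero fun x hx => by
        rw [hφ.eq_zero hx, zero_smul],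
      integral_smul_fderiv_eq_neg_fderiv_smul_of_integrable, neg_neg]
    · exact (hφ1.smul hp.continuous).integrable_of_hasCompactSupport hφc.smul_right
    · exact (hφ.1.continuous.smul hp1).integrable_of_hasCompactSupport hφ.2.1.smul_right
    · exact (hφ.1.continuous.smul hp.continuous).integrable_of_hasCompactSupport
        hφ.2.1.smul_right
    · exact fun x _ => (hφ.1.differentiable (by simp)) x
    · exact fun x _ => (hp.differentiable (by simp)) x

theorem weakPartial_ae_eq [CompleteSpace V] {D : Set (E d)} (hD : IsOpen D) {j : Fin d}
    {f g : E d → V} (h : HasWeakDeriv D (fun _ : Fin 1 => j) f g) :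
    weakPartial D j f =ᵐ[volume.restrict D] g := by
  have hex : ∃ g, HasWeakDeriv D (fun _ : Fin 1 => j) f g := ⟨g, h⟩
  rw [weakPartial, dif_pos hex]
  exact hex.choose_spec.ae_eq hD h

theorem strain_ae_eq {D : Set (E d)} (hD : IsOpen D) {v : E d → E d} {g : Fin d → E d → E d}
    (h : ∀ j, HasWeakDeriv D (fun _ : Fin 1 => j) v (g j)) :
    strain D v =ᵐ[volume.restrict D] fun x => symPart fun i j => g j x i := by
  have h1 : ∀ᵐ x ∂(volume.restrict D), ∀ j, weakPartial D j v x = g j x :=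
    ae_all_iff.2 fun j => weakPartial_ae_eq hD (h j)
  refine h1.mono fun x hx => ?_
  simp only [strain, hx]

/-- Cut-off functions equal to one on an increasing sequence of compact sets that exhausts `U`. -/
theorem exists_isTest_tendsto_one {U : Set (E d)} (hU : IsOpen U) (hUb : Bornology.IsBounded U) :
    ∃ χ : ℕ → E d → ℝ, (∀ m, IsTest U (χ m)) ∧ (∀ m x, |χ m x| ≤ 1) ∧
      ∀ x ∈ U, Tendsto (fun m => χ m x) atTop (𝓝 1) := by
  have key : ∀ C : Set (E d), IsCompact C → C ⊆ U → ∃ χ : E d → ℝ, IsTest U χ ∧ (∀ x, |χ x| ≤ 1) ∧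
      ∀ x ∈ C, χ x = 1 := by
    intro C hC hCU
    obtain ⟨C', hC', hCC, hCU'⟩ := exists_compact_between hC hU hCU
    obtain ⟨f, hf0, hf1, hf⟩ := exists_contMDiffMap_zero_one_of_isClosed (n := ⊤)
      (modelWithCornersSelf ℝ (E d))
      (s := (interior C')ᶜ) (t := C) isOpen_interior.isClosed_compl hC.isClosed
      (disjoint_compl_left_iff_subset.2 hCC)
    have hsupp : tsupport f ⊆ C' := by
      refine closure_minimal (fun x hx => ?_) hC'.isClosed
      by_contra hxC
      exact hx (hf0 fun h => hxC (interior_subset h))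
    refine ⟨f, ⟨f.contMDiff.contDiff, ?_, hsupp.trans hCU'⟩, fun x => ?_, fun x hx => hf1 hx⟩
    · exact hC'.of_isClosed_subset (isClosed_tsupport f) hsupp
    · rw [abs_of_nonneg (hf x).1]
      exact (hf x).2
  obtain ⟨C, hCc, hCU, hC, hCm⟩ := hU.exists_iUnion_isClosed
  have hCk : ∀ m, IsCompact (C m) := fun m =>
    Metric.isCompact_of_isClosed_isBounded (hCc m) (hUb.subset (hCU m))
  choose χ h1 h2 h3 using fun m => key (C m) (hCk m) (hCU m)
  refine ⟨χ, h1, h2, fun x hx => ?_⟩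
  rw [← hC] at hx
  obtain ⟨N, hN⟩ := mem_iUnion.1 hx
  refine tendsto_const_nhds.congr' ?_
  filter_upwards [eventually_ge_atTop N] with m hm
  exact (h3 m x (hCm hm hN)).symm

end HDG
end

noncomputable section
namespace HDG
variable {d : ℕ} {V : Type*} [NormedAddCommGroup V] [NormedSpace ℝ V]

/-! ### The normal traces of a tensor in `H(div)` -/

namespace Mesh

variable {P : Model d} (M : Mesh P) {σ : L2 P.Ω (Sym d)} {w : L2 P.Ω (E d)}

theorem exists_hasTrace_of_gagliardoSq [CompleteSpace V] (hd : 1 ≤ d) {K : Set (E d)}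
    (hK : K ∈ M.elems) (f : L2 P.Ω V)
    (hf : ∃ θ : ℝ, 1 / 2 < θ ∧ θ < 1 ∧ gagliardoSq θ (interior K) f < ⊤) :
    ∃ g, HasTrace (interior K) (frontier K) f g := by
  obtain ⟨θ, hθ, hθ1, h⟩ := hf
  obtain ⟨η, hη⟩ := exists_isMollifier isOpen_interior (M.isElement K hK).interior_nonempty
  obtain ⟨g, hg, -⟩ := (M.isPolytope hK).exists_hasTrace hd hθ hθ1 (Lp.stronglyMeasurable f)
    ((Lp.memLp f).mono_measure (Measure.restrict_mono (M.interior_elem_subset hK) le_rfl)) h hη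
  exact ⟨g, hg⟩

/-- The normal component of the trace from `K` on `F ⊆ ∂K`, multiplied by `ψ`. -/
def normalTrace (σ : E d → Sym d) (K F : Set (E d)) (ψ : E d → E d) (x : E d) : ℝ :=
  ⟪mulVec (trace (interior K) (frontier K) σ x) (outwardNormal K F), ψ x⟫_ℝ

theorem green (hd : 1 ≤ d) (hw : IsWeakDiv P.Ω σ w) {K : Set (E d)} (hK : K ∈ M.elems)
    (hθ : ∃ θ : ℝ, 1 / 2 < θ ∧ θ < 1 ∧ gagliardoSq θ (interior K) σ < ⊤) {ψ : E d → E d}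
    (hψ : ContDiff ℝ ∞ ψ) :
    (∫ x in interior K, ⟪w x, ψ x⟫_ℝ) + ∫ x in interior K, ⟪σ x, classicalStrain ψ x⟫_ℝ =
      ∑ F ∈ M.facesOf K, faceInt F (normalTrace σ K F ψ) := by
  obtain ⟨θ, h1, h2, h3⟩ := hθ
  exact (M.isPolytope hK).green hd (hw.hasWeakDiv.mono (M.interior_elem_subset hK))
    (Lp.stronglyMeasurable σ) h1 h2 h3 hψ

theorem integrable_normalTrace (hd : 1 ≤ d) {K F : Set (E d)} (hK : K ∈ M.elems)
    (hF : F ∈ M.facesOf K)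
    (hθ : ∃ θ : ℝ, 1 / 2 < θ ∧ θ < 1 ∧ gagliardoSq θ (interior K) σ < ⊤) {ψ : E d → E d}
    (hψ : Continuous ψ) : IntegrableOn (normalTrace σ K F ψ) F (surf d) := by
  have hp := M.isPolytope hK
  have h1 := (hasTrace_trace (M.exists_hasTrace_of_gagliardoSq hd hK σ hθ)).1
  have h2 := memLp_surf (hp.face_isBounded hF) (hp.face_closed F hF).measurableSet
    (hp.face_surf_lt_top hd hF).ne (continuous_symPart_mul hψ (outwardNormal K F))
  refine (integrable_inner_of_memLp_two (h1.mono_measure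
    (Measure.restrict_mono (hp.face_subset_frontier hF) le_rfl)) h2).congr
    (ae_of_all _ fun x => ?_)
  exact (inner_mulVec_eq_inner_symPart _ _ _).symm

theorem integrableOn_elem {f : E d → V} {K : Set (E d)} (hf : IntegrableOn f P.Ω)
    (hK : K ∈ M.elems) : IntegrableOn f (interior K) := hf.mono_set (M.interior_elem_subset hK)

theorem isBounded_Ω (P : Model d) : Bornology.IsBounded P.Ω := P.lip.2.1

open Classical in
-- A field `χ ψ`, with `χ` supported in `Ω` away from all the other faces, is a test field for the
-- weak divergence on `Ω`. Summing Green's formula over the elements gives zero, and only the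
-- integrals over `F` survive. Letting `χ` tend to one almost everywhere on `F` gives the claim.
-- Neither the two elements at `F` nor the relation between their normals have to be identified.
theorem sum_normalTrace_eq_zero (hd : 1 ≤ d) (hw : IsWeakDiv P.Ω σ w)
    (hθ : ∀ K ∈ M.elems, ∃ θ : ℝ, 1 / 2 < θ ∧ θ < 1 ∧ gagliardoSq θ (interior K) σ < ⊤)
    {F : Set (E d)} (hF : F ∈ M.faces) (hFi : IsInteriorFace M.elems F) {ψ : E d → E d}
    (hψ : ContDiff ℝ ∞ ψ) :
    ∑ K ∈ M.elems, (if F ∈ M.facesOf K then faceInt F (normalTrace σ K F ψ) else 0) = 0 := by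
  have hFc : ∀ F' ∈ M.faces, IsClosed F' := fun F' hF' => (M.face_facts hF').2.1.isClosed
  set U : Set (E d) := P.Ω \ ⋃ F' ∈ M.faces.erase F, F' with hU
  have hUo : IsOpen U := P.lip.1.sdiff (isClosed_biUnion_finset fun F' hF' =>
    hFc F' (Finset.mem_of_mem_erase hF'))
  obtain ⟨χ, h1, h2, h3⟩ := exists_isTest_tendsto_one hUo ((isBounded_Ω P).subset sdiff_subset)
  have hχ : ∀ m, IsTest U fun x => χ m x • ψ x := fun m => (h1 m).smul_contDiff hψ
  have hFΩ : F ⊆ closure P.Ω := by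
    obtain ⟨-, K, hK, K', hK', -, rfl⟩ := hFi
    exact inter_subset_left.trans (M.elem_subset hK)
  -- The part of `F` outside `U` lies in `∂Ω` or in another face, and both overlaps are null.
  have hae : ∀ᵐ y ∂((surf d).restrict F), y ∈ U := by
    rw [ae_restrict_iff' (hFc F hF).measurableSet, ae_iff]
    refine measure_mono_null (t := (F ∩ frontier P.Ω) ∪ ⋃ F' ∈ M.faces.erase F, F ∩ F') ?_ ?_
    · intro y hy
      rw [mem_ofPred_eq, Classical.not_imp] at hy
      obtain ⟨hyF, hyU⟩ := hy
      by_cases hyΩ : y ∈ P.Ω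
      · right
        rw [hU, Set.mem_sdiff, not_and, not_not] at hyU
        obtain ⟨F', hF', hy'⟩ := mem_iUnion₂.1 (hyU hyΩ)
        exact mem_iUnion₂.2 ⟨F', hF', hyF, hy'⟩
      · left
        exact ⟨hyF, hFΩ hyF, by rwa [P.lip.1.interior_eq]⟩
    · refine measure_union_null (M.surf_interiorFace_inter_frontier hFi) ?_
      refine (measure_biUnion_null_iff (Finset.countable_toSet _)).2 fun F' hF' => ?_
      rw [Finset.mem_coe, Finset.mem_erase] at hF'
      exact M.surf_face_inter hF hF'.2 (Ne.symm hF'.1)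
  have e : ∀ m, ∑ K ∈ M.elems, (if F ∈ M.facesOf K then
      faceInt F (normalTrace σ K F fun x => χ m x • ψ x) else 0) = 0 := by
    intro m
    have i1 : IntegrableOn (fun x => ⟪w x, χ m x • ψ x⟫_ℝ) P.Ω :=
      integrable_inner_of_memLp_two (Lp.memLp w) (hχ m).memLp
    have i2 : IntegrableOn (fun x => ⟪σ x, classicalStrain (fun x => χ m x • ψ x) x⟫_ℝ) P.Ω :=
      integrable_inner_of_memLp_two (Lp.memLp σ) (memLp_two_of_isBounded (isBounded_Ω P)
        (continuous_classicalStrain (hχ m).1))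
    have h0 := hw.hasWeakDiv.integral_test ((hχ m).mono sdiff_subset)
    rw [M.integral_eq_sum fun K hK => M.integrableOn_elem i1 hK,
      M.integral_eq_sum fun K hK => M.integrableOn_elem i2 hK, ← Finset.sum_add_distrib] at h0
    refine Eq.trans (Finset.sum_congr rfl fun K hK => ?_) h0
    rw [M.green hd hw hK (hθ K hK) (hχ m).1]
    have hz : ∀ F' ∈ M.facesOf K, F' ≠ F →
        faceInt F' (normalTrace σ K F' fun x => χ m x • ψ x) = 0 := by
      intro F' hF' hne
      have hF'M := (M.mem_facesOf.1 hF').1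
      refine setIntegral_eq_zero_of_forall_eq_zero fun x hx => ?_
      have : χ m x = 0 := (h1 m).eq_zero fun hxU =>
        hxU.2 (mem_iUnion₂.2 ⟨F', Finset.mem_erase.2 ⟨hne, hF'M⟩, hx⟩)
      rw [normalTrace, this, zero_smul, inner_zero_right]
    split_ifs with hFK
    · exact (Finset.sum_eq_single_of_mem F hFK hz).symm
    · exact (Finset.sum_eq_zero fun F' hF' => hz F' hF' fun h => hFK (h ▸ hF')).symm
  have t : Tendsto (fun m => ∑ K ∈ M.elems, (if F ∈ M.facesOf K then
      faceInt F (normalTrace σ K F fun x => χ m x • ψ x) else 0)) atTop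
      (𝓝 (∑ K ∈ M.elems, (if F ∈ M.facesOf K then faceInt F (normalTrace σ K F ψ) else 0))) := by
    refine tendsto_finsetSum _ fun K hK => ?_
    split_ifs with hFK
    · have hi := M.integrable_normalTrace hd hK hFK (hθ K hK) hψ.continuous
      have ht : ∀ m x, normalTrace σ K F (fun x => χ m x • ψ x) x
          = χ m x * normalTrace σ K F ψ x := fun m x => real_inner_smul_right _ _ _
      unfold faceInt
      simp_rw [ht]
      -- Dominated by the normal trace itself, as the cut-offs are bounded by one.
      refine tendsto_integral_of_dominated_convergence (fun x => ‖normalTrace σ K F ψ x‖)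
        (fun m => ((h1 m).1.continuous.aestronglyMeasurable).mul hi.1) hi.norm
        (fun m => ae_of_all _ fun x => ?_) (hae.mono fun x hx => ?_)
      · rw [norm_mul]
        exact mul_le_of_le_one_left (norm_nonneg _) (h2 m x)
      · simpa using (h3 x hx).mul_const (normalTrace σ K F ψ x)
    · exact tendsto_const_nhds
  simp_rw [e] at t
  exact tendsto_nhds_unique t tendsto_const_nhds

theorem IsSkeletonPoly.exists_contDiff [FiniteDimensional ℝ V] {M : Mesh P} {m : ℕ}
    {g : Set (E d) → E d → V} (h : M.IsSkeletonPoly m g) {F : Set (E d)} (hF : F ∈ M.faces) :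
    ∃ p : E d → V, ContDiff ℝ ∞ p ∧ EqOn (g F) p F :=
  (h.1 F hF).exists_contDiff (contDiff_affineMap (M.faceCoord F))

theorem IsPiecewisePoly.exists_contDiff [FiniteDimensional ℝ V] {M : Mesh P} {m : ℕ}
    {f : E d → V} (h : M.IsPiecewisePoly m f) {K : Set (E d)} (hK : K ∈ M.elems) :
    ∃ p : E d → V, ContDiff ℝ ∞ p ∧ EqOn f p (interior K) :=
  (h K hK).exists_contDiff (contDiff_affineMap (M.elemCoord K : E d →ᵃ[ℝ] E d))

/-- After exchanging the sums each face is treated separately: on an interior face `v̂` has a single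
value, so the normal traces cancel; on a boundary face it vanishes. -/
theorem sum_normalTrace_skeleton (hd : 1 ≤ d) (hw : IsWeakDiv P.Ω σ w)
    (hθ : ∀ K ∈ M.elems, ∃ θ : ℝ, 1 / 2 < θ ∧ θ < 1 ∧ gagliardoSq θ (interior K) σ < ⊤)
    {m : ℕ} {vh : Set (E d) → E d → E d} (hv : M.IsSkeletonPoly m vh) :
    ∑ K ∈ M.elems, ∑ F ∈ M.facesOf K, faceInt F (normalTrace σ K F (vh F)) = 0 := by
  classical
  have e1 : ∀ K ∈ M.elems, ∑ F ∈ M.facesOf K, faceInt F (normalTrace σ K F (vh F)) =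
      ∑ F ∈ M.faces, if F ∈ M.facesOf K then faceInt F (normalTrace σ K F (vh F)) else 0 := by
    intro K _
    rw [← Finset.sum_filter]
    refine Finset.sum_congr ?_ fun _ _ => rfl
    ext F
    rw [Finset.mem_filter, mem_facesOf]
    tauto
  rw [Finset.sum_congr rfl e1, Finset.sum_comm]
  refine Finset.sum_eq_zero fun F hF => ?_
  have hm : MeasurableSet F := (M.face_facts hF).2.1.isClosed.measurableSet
  obtain ⟨p, hp, hpF⟩ : ∃ p : E d → E d, ContDiff ℝ ∞ p ∧ EqOn (vh F) p F :=
    hv.exists_contDiff hF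
  rcases (M.mem_faces F).1 hF with h | h
  · refine Eq.trans (Finset.sum_congr rfl fun K _ => ?_)
      (M.sum_normalTrace_eq_zero hd hw hθ hF h hp)
    split_ifs
    · exact setIntegral_congr_fun hm fun x hx => by simp only [normalTrace, hpF hx]
    · rfl
  · refine Finset.sum_eq_zero fun K _ => ?_
    split_ifs
    · refine setIntegral_eq_zero_of_forall_eq_zero fun x hx => ?_
      rw [normalTrace, hv.2 F hF h x hx, inner_zero_right]
    · rfl

end Mesh

end HDG
end

noncomputable section
namespace HDG
variable {d : ℕ} {V : Type*} [NormedAddCommGroup V] [NormedSpace ℝ V]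

/-! ### The constitutive equation -/

theorem inner_smul_sub_right {H : Type*} [NormedAddCommGroup H] [InnerProductSpace ℝ H]
    (a b t : H) (c : ℝ) : ⟪t, c • (a - b)⟫_ℝ = ⟪a, c • t⟫_ℝ - c * ⟪b, t⟫_ℝ := by
  rw [real_inner_smul_right, inner_sub_right, real_inner_smul_right, mul_sub,
    real_inner_comm t, real_inner_comm t]

theorem HasWeakDiv.isWeakDiv_toLp {D : Set (E d)} {σ : E d → Sym d} {w : E d → E d}
    (h : HasWeakDiv D σ w) : IsWeakDiv D (h.1.toLp σ) (h.2.1.toLp w) := by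
  intro φ hφ i
  refine Eq.trans (integral_congr_ae ?_)
    ((h.2.2 φ hφ i).trans (congrArg Neg.neg (integral_congr_ae ?_)))
  · exact h.1.coeFn_toLp.mono fun x hx => by simp only [hx]
  · exact h.2.1.coeFn_toLp.mono fun x hx => by simp only [hx]

/-- `∑ j, ∂_j φ τ e_j`, the divergence of `φ τ`. -/
def divSmul (φ : E d → ℝ) (τ : Sym d) (x : E d) : E d :=
  ∑ j, fderiv ℝ φ x (unitVec j) • mulVec τ (unitVec j)

theorem mulVec_unitVec (τ : Sym d) (i j : Fin d) : mulVec τ (unitVec j) i = entry τ i j := by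
  change ∑ k, entry τ i k * (unitVec j : E d) k = _
  simp [unitVec]

theorem memLp_divSmul {D D' : Set (E d)} {φ : E d → ℝ} (hφ : IsTest D' φ) (τ : Sym d) :
    MemLp (divSmul φ τ) 2 (volume.restrict D) := by
  have : divSmul φ τ = ∑ j, fun x => fderiv ℝ φ x (unitVec j) • mulVec τ (unitVec j) := by
    funext x
    rw [Finset.sum_apply]
    rfl
  rw [this]
  refine memLp_finsetSum' _ fun j _ => ?_
  exact ((ContinuousLinearMap.toSpanSingleton ℝ (mulVec τ (unitVec j))).comp_memLp'
    (hφ.memLp_fderiv (D := D) (unitVec j)))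

theorem IsTest.hasWeakDiv_smul {D : Set (E d)} {φ : E d → ℝ} (hφ : IsTest D φ) (τ : Sym d) :
    HasWeakDiv D (fun x => φ x • τ) (divSmul φ τ) := by
  refine ⟨(hφ.smul_contDiff contDiff_const).memLp, memLp_divSmul hφ τ, fun χ hχ i => ?_⟩
  have e1 : ∀ x, ∑ j, entry (φ x • τ) i j * fderiv ℝ χ x (unitVec j) =
      ∑ j, entry τ i j * (fderiv ℝ χ x (unitVec j) • φ x) := fun x => by
    refine Finset.sum_congr rfl fun j _ => ?_
    rw [← entryL_apply, map_smul, entryL_apply, smul_eq_mul, smul_eq_mul]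
    ring
  have e2 : ∀ x, divSmul φ τ x i * χ x =
      ∑ j, entry τ i j * (χ x • fderiv ℝ φ x (unitVec j)) := fun x => by
    rw [divSmul, ← coordL_apply, map_sum, Finset.sum_mul]
    refine Finset.sum_congr rfl fun j _ => ?_
    rw [map_smul, coordL_apply, mulVec_unitVec, smul_eq_mul, smul_eq_mul]
    ring
  simp_rw [e1, e2]
  rw [integral_finsetSum, integral_finsetSum, ← Finset.sum_neg_distrib]
  · refine Finset.sum_congr rfl fun j _ => ?_
    rw [integral_const_mul, integral_const_mul, hχ.integral_smul_fderiv hφ, mul_neg]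
  · exact fun j _ => (integrable_smul_of_memLp_two hχ.memLp (hφ.memLp_fderiv _)).const_mul _
  · exact fun j _ => (integrable_smul_of_memLp_two (hχ.memLp_fderiv _) hφ.memLp).const_mul _

/-- The strain with given partial derivatives `g j`. -/
def strainOf (g : Fin d → E d → E d) (x : E d) : Sym d := symPart fun i j => g j x i

theorem inner_strainOf (τ : Sym d) (g : Fin d → E d → E d) (x : E d) :
    ⟪strainOf g x, τ⟫_ℝ = ∑ j, ⟪mulVec τ (unitVec j), g j x⟫_ℝ := by
  rw [real_inner_comm, strainOf, inner_symPart, Finset.sum_comm]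
  refine Finset.sum_congr rfl fun j _ => ?_
  rw [inner_eq_sum]
  refine Finset.sum_congr rfl fun i _ => ?_
  rw [mulVec_unitVec]

theorem memLp_strainOf {D : Set (E d)} {g : Fin d → E d → E d}
    (hg : ∀ j, MemLp (g j) 2 (volume.restrict D)) :
    MemLp (strainOf g) 2 (volume.restrict D) := by
  have h1 : MemLp (fun x => fun i j => g j x i) 2 (volume.restrict D) := by
    refine MemLp.of_eval fun i => MemLp.of_eval fun j => ?_
    exact (coordL i).comp_memLp' (hg j)
  exact (symPartL (d := d)).comp_memLp' h1

theorem integral_inner_divSmul {D : Set (E d)} {u : E d → E d} {g : Fin d → E d → E d}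
    (hu : ∀ j, HasWeakDeriv D (fun _ : Fin 1 => j) u (g j)) (hu2 : MemLp u 2 (volume.restrict D))
    {φ : E d → ℝ} (hφ : IsTest D φ) (τ : Sym d) :
    ∫ x in D, ⟪u x, divSmul φ τ x⟫_ℝ = - ∫ x in D, φ x * ⟪strainOf g x, τ⟫_ℝ := by
  have e1 : ∀ x, ⟪u x, divSmul φ τ x⟫_ℝ =
      ∑ j, ⟪mulVec τ (unitVec j), fderiv ℝ φ x (unitVec j) • u x⟫_ℝ := fun x => by
    rw [divSmul, inner_sum]
    refine Finset.sum_congr rfl fun j _ => ?_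
    rw [real_inner_smul_right, real_inner_smul_right, real_inner_comm]
  have e2 : ∀ x, φ x * ⟪strainOf g x, τ⟫_ℝ =
      ∑ j, ⟪mulVec τ (unitVec j), φ x • g j x⟫_ℝ := fun x => by
    rw [inner_strainOf, Finset.mul_sum]
    refine Finset.sum_congr rfl fun j _ => ?_
    rw [real_inner_smul_right]
  have i1 : ∀ j, Integrable (fun x => fderiv ℝ φ x (unitVec j) • u x) (volume.restrict D) :=
    fun j => integrable_smul_of_memLp_two (hφ.memLp_fderiv _) hu2
  have i2 : ∀ j, Integrable (fun x => φ x • g j x) (volume.restrict D) :=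
    fun j => integrable_smul_of_memLp_two hφ.memLp (hu j).2.1
  simp_rw [e1, e2]
  rw [integral_finsetSum _ fun j _ => (i1 j).const_inner _,
    integral_finsetSum _ fun j _ => (i2 j).const_inner _, ← Finset.sum_neg_distrib]
  refine Finset.sum_congr rfl fun j _ => ?_
  have h := (hu j).2.2 φ hφ
  simp only [iteratedFDeriv_one_apply, pow_one, neg_smul, one_smul] at h
  rw [integral_inner (i1 j), integral_inner (i2 j), h, inner_neg_right]

namespace Model

variable (P : Model d)

theorem memLp_As {f : E d → Sym d} {D : Set (E d)} (hf : MemLp f 2 (volume.restrict D)) :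
    MemLp (fun x => P.As (f x)) 2 (volume.restrict D) :=
  (LinearMap.toContinuousLinearMap (P.Cs.symm : Sym d →ₗ[ℝ] Sym d)).comp_memLp' hf

theorem memLp_Af {f : E d → Sym d} {D : Set (E d)} (hf : MemLp f 2 (volume.restrict D)) :
    MemLp (fun x => P.Af (f x)) 2 (volume.restrict D) := by
  have h1 : MemLp (fun x => trTensor (f x)) 2 (volume.restrict D) := by
    have := memLp_finsetSum' Finset.univ fun i _ => (entryL i i).comp_memLp' hf
    convert this using 1
    funext x
    rw [Finset.sum_apply]
    rfl
  have h2 : MemLp (fun x => (P.lamf / (d * P.lamf + 2 * P.μf) * trTensor (f x)) •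
      (idTensor : Sym d)) 2 (volume.restrict D) :=
    (ContinuousLinearMap.toSpanSingleton ℝ (idTensor (d := d))).comp_memLp' (h1.const_mul _)
  exact (hf.sub h2).const_smul (1 / (2 * P.μf))

/-- `A_s σ'` in the solid and `A_f σ` in the fluid. -/
def compliance (σ' σ : E d → Sym d) (x : E d) : Sym d :=
  P.Ωs.indicator (fun x => P.As (σ' x)) x + P.Ωf.indicator (fun x => P.Af (σ x)) x

theorem memLp_compliance {σ' σ : E d → Sym d} (h' : MemLp σ' 2 (volume.restrict P.Ω))
    (h : MemLp σ 2 (volume.restrict P.Ω)) :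
    MemLp (P.compliance σ' σ) 2 (volume.restrict P.Ω) :=
  ((P.memLp_As h').indicator P.lip_s.1.measurableSet).add
    ((P.memLp_Af h).indicator P.lip_f.1.measurableSet)

/-- The two subdomains are disjoint and fill `Ω` up to a null set, so both parts merge into one
integral of a piecewise defined tensor. -/
theorem stressForm_eq (hae : (P.Ω : Set (E d)) =ᵐ[volume] (P.Ωs ∪ P.Ωf : Set (E d)))
    {σ' σ τ : E d → Sym d} (h' : MemLp σ' 2 (volume.restrict P.Ω))
    (h : MemLp σ 2 (volume.restrict P.Ω)) (hτ : MemLp τ 2 (volume.restrict P.Ω)) :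
    P.stressForm σ' σ τ = ∫ x in P.Ω, ⟪P.compliance σ' σ x, τ x⟫_ℝ := by
  have hi : IntegrableOn (fun x => ⟪P.compliance σ' σ x, τ x⟫_ℝ) P.Ω :=
    integrable_inner_of_memLp_two (P.memLp_compliance h' h) hτ
  rw [setIntegral_congr_set hae, setIntegral_union P.disj P.lip_f.1.measurableSet
    (hi.mono_set P.sub_s) (hi.mono_set P.sub_f), stressForm]
  congr 1
  · refine setIntegral_congr_fun P.lip_s.1.measurableSet fun x hx => ?_
    have hx' : x ∉ P.Ωf := disjoint_left.1 P.disj hx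
    simp only [compliance, indicator_of_mem hx, indicator_of_notMem hx', add_zero]
  · refine setIntegral_congr_fun P.lip_f.1.measurableSet fun x hx => ?_
    have hx' : x ∉ P.Ωs := disjoint_right.1 P.disj hx
    simp only [compliance, indicator_of_mem hx, indicator_of_notMem hx', zero_add]

/-- The constitutive equation is only given for tensors in `H(div)`. The fields `φ τ` belong to it,
and integrating by parts against `u` shows that the compliance tensor and the strain have the same
integrals against every `φ`. The pointwise identity that follows can be tested with discontinuous
tensors. -/
theorem compliance_ae_eq (hae : (P.Ω : Set (E d)) =ᵐ[volume] (P.Ωs ∪ P.Ωf : Set (E d)))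
    {σ' σ : L2 P.Ω (Sym d)} {u : L2 P.Ω (E d)} {g : Fin d → E d → E d}
    (hu : ∀ j, HasWeakDeriv P.Ω (fun _ : Fin 1 => j) u (g j))
    (hcon : ∀ (τ : L2 P.Ω (Sym d)) (w : L2 P.Ω (E d)), IsWeakDiv P.Ω τ w →
      P.stressForm σ' σ τ + ∫ x in P.Ω, ⟪u x, w x⟫_ℝ = 0) :
    P.compliance σ' σ =ᵐ[volume.restrict P.Ω] strainOf g := by
  have hC := P.memLp_compliance (Lp.memLp σ') (Lp.memLp σ)
  have hS : MemLp (strainOf g) 2 (volume.restrict P.Ω) := memLp_strainOf fun j => (hu j).2.1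
  have hD := hC.sub hS
  have hloc : LocallyIntegrableOn (P.compliance σ' σ - strainOf g) P.Ω volume :=
    locallyIntegrableOn_of_locallyIntegrable_restrict (hD.locallyIntegrable (by norm_num))
  have h0 := P.lip.1.ae_eq_zero_of_integral_contDiff_smul_eq_zero hloc (fun φ hφ hc hs => by
    have hφ' : IsTest P.Ω φ := ⟨hφ, hc, hs⟩
    rw [← setIntegral_eq_integral_of_forall_compl_eq_zero (s := P.Ω) (fun x hx => by
      rw [hφ'.eq_zero hx, zero_smul])]
    -- The tensor-valued integral vanishes if its product with each constant tensor does; that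
    -- product is the constitutive equation tested with `φ τ`.
    refine ext_inner_left ℝ fun τ => ?_
    have hi : Integrable (fun x => φ x • (P.compliance σ' σ - strainOf g) x)
        (volume.restrict P.Ω) := integrable_smul_of_memLp_two hφ'.memLp hD
    have hw := hφ'.hasWeakDiv_smul τ
    have h1 := hcon _ _ hw.isWeakDiv_toLp
    have ea : ∫ x in P.Ω, ⟪P.compliance σ' σ x, hw.1.toLp (fun x => φ x • τ) x⟫_ℝ =
        ∫ x in P.Ω, ⟪P.compliance σ' σ x, φ x • τ⟫_ℝ :=
      integral_congr_ae (hw.1.coeFn_toLp.mono fun x hx => by simp only [hx])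
    have eb : ∫ x in P.Ω, ⟪u x, hw.2.1.toLp (divSmul φ τ) x⟫_ℝ =
        ∫ x in P.Ω, ⟪u x, divSmul φ τ x⟫_ℝ :=
      integral_congr_ae (hw.2.1.coeFn_toLp.mono fun x hx => by simp only [hx])
    rw [P.stressForm_eq hae (Lp.memLp σ') (Lp.memLp σ) (Lp.memLp _), ea, eb,
      integral_inner_divSmul hu (Lp.memLp u) hφ' τ, ← sub_eq_add_neg] at h1
    have i2 : Integrable (fun x => φ x * ⟪strainOf g x, τ⟫_ℝ) (volume.restrict P.Ω) :=
      integrable_smul_of_memLp_two hφ'.memLp (hS.inner_const τ)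
    have i1 : Integrable (fun x => ⟪P.compliance σ' σ x, φ x • τ⟫_ℝ) (volume.restrict P.Ω) :=
      integrable_inner_of_memLp_two hC hw.1
    rw [← integral_sub i1 i2] at h1
    rw [← integral_inner hi, inner_zero_right]
    refine Eq.trans (integral_congr_ae (ae_of_all _ fun x => ?_)) h1
    exact inner_smul_sub_right _ _ _ _)
  rw [EventuallyEq, ae_restrict_iff' P.lip.1.measurableSet]
  exact h0.mono fun x hx hxD => sub_eq_zero.1 (hx hxD)

end Model

end HDG
end

noncomputable section
namespace HDG
variable {d : ℕ} {V : Type*} [NormedAddCommGroup V] [NormedSpace ℝ V]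

/-! ### Consistency at a fixed time -/

namespace Mesh

variable {P : Model d} (M : Mesh P)

theorem memLp_of_pieces {f : E d → V}
    (h : ∀ K ∈ M.elems, ∃ p : E d → V, ContDiff ℝ ∞ p ∧ EqOn f p (interior K)) :
    MemLp f 2 (volume.restrict P.Ω) := by
  choose! p hp hfp using h
  have h1 : MemLp (∑ K ∈ M.elems, (interior K).indicator (p K)) 2 (volume.restrict P.Ω) :=
    memLp_finsetSum' _ fun K hK => (memLp_two_of_isBounded (isBounded_Ω P)
      (hp K hK).continuous).indicator isOpen_interior.measurableSet
  refine h1.ae_eq ?_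
  rw [Measure.restrict_congr_set M.ae_eq_Ω, EventuallyEq, ae_restrict_iff'
    (Finset.measurableSet_biUnion _ fun K _ => isOpen_interior.measurableSet)]
  refine ae_of_all _ fun x hx => ?_
  obtain ⟨K, hK, hxK⟩ := mem_iUnion₂.1 hx
  rw [Finset.sum_apply, Finset.sum_eq_single_of_mem K hK, indicator_of_mem hxK, hfp K hK hxK]
  intro K' hK' hne
  exact indicator_of_notMem (fun h => disjoint_left.1 (M.disj K' hK' K hK hne) h hxK) _

theorem exists_mem_facesOf {F : Set (E d)} (hF : F ∈ M.faces) :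
    ∃ K ∈ M.elems, F ∈ M.facesOf K := by
  rcases (M.mem_faces F).1 hF with ⟨-, K, hK, K', hK', hne, rfl⟩ | ⟨hFΩ, K, hK, h⟩
  · refine ⟨K, hK, M.mem_facesOf.2 ⟨hF, fun x hx => ⟨subset_closure hx.1, fun hxi => ?_⟩⟩⟩
    have hcl := (M.isPolytope hK').subset_closure_interior hx.2
    obtain ⟨z, hz, hz'⟩ := mem_closure_iff.1 hcl _ isOpen_interior hxi
    exact disjoint_left.1 (M.disj K hK K' hK' hne) hz hz'
  · refine ⟨K, hK, M.mem_facesOf.2 ⟨hF, fun x hx => ⟨subset_closure (h.1.subset hx), fun hxi => ?_⟩⟩⟩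
    refine (hFΩ hx).2 ?_
    rw [P.lip.1.interior_eq]
    exact M.interior_elem_subset hK hxi

variable {u : L2 P.Ω (E d)} {G : Fin d → L2 P.Ω (E d)}

theorem exists_hasTrace_elem (hd : 1 ≤ d) (hu : IsH10 P.Ω u G) {K : Set (E d)}
    (hK : K ∈ M.elems) : ∃ g, HasTrace (interior K) (frontier K) u g :=
  hu.exists_hasTrace hd P.lip.1 (isBounded_Ω P) (M.interior_elem_subset hK)
    (M.isPolytope hK).isBounded_frontier isClosed_frontier.measurableSet
    ((M.isPolytope hK).frontier_surf_lt_top hd).ne ((M.isPolytope hK).traceInequality hd)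

/-- The trace inequality from one element adjacent to `F` holds a fortiori with the larger set `Ω`
on the right-hand side, so no separate one is needed for the non-convex domain. -/
theorem exists_hasTrace_face (hd : 1 ≤ d) (hu : IsH10 P.Ω u G) {F : Set (E d)}
    (hF : F ∈ M.faces) : ∃ g, HasTrace P.Ω F u g := by
  obtain ⟨K, hK, hFK⟩ := M.exists_mem_facesOf hF
  have hp := M.isPolytope hK
  exact hu.exists_hasTrace hd P.lip.1 (isBounded_Ω P) subset_rfl (hp.face_isBounded hFK)
    (hp.face_closed F hFK).measurableSet (hp.face_surf_lt_top hd hFK).ne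
    ((hp.traceInequality hd).mono (M.interior_elem_subset hK) (hp.face_subset_frontier hFK))

theorem wellDefined (hd : 1 ≤ d) {σ : L2 P.Ω (Sym d)} (hu : IsH10 P.Ω u G)
    (hθ : ∀ K ∈ M.elems, ∃ θ : ℝ, 1 / 2 < θ ∧ θ < 1 ∧ gagliardoSq θ (interior K) σ < ⊤) :
    M.WellDefined σ u :=
  ⟨fun K hK => ⟨M.exists_hasTrace_of_gagliardoSq hd hK σ (hθ K hK),
    M.exists_hasTrace_elem hd hu hK,
    fun j => ⟨G j, (hu.hasWeakDeriv j).mono (M.interior_elem_subset hK)⟩⟩,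
    fun _ hF => M.exists_hasTrace_face hd hu hF⟩

/-- Both the trace from `K` and the trace from `Ω` restrict to traces on `F` from the interior of
`K`, where traces are unique. -/
theorem jump_skeletonTrace_ae_eq_zero (hd : 1 ≤ d) (hu : IsH10 P.Ω u G) {K F : Set (E d)}
    (hK : K ∈ M.elems) (hF : F ∈ M.facesOf K) :
    ∀ᵐ x ∂((surf d).restrict F), jump K F u (skeletonTrace P u) x = 0 := by
  have hp := M.isPolytope hK
  have h1 := (hasTrace_trace (M.exists_hasTrace_elem hd hu hK)).mono isOpen_interior subset_rfl
    (hp.face_subset_frontier hF)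
  have h2 := (hasTrace_trace (M.exists_hasTrace_face hd hu (M.mem_facesOf.1 hF).1)).mono
    P.lip.1 (M.interior_elem_subset hK) subset_rfl
  refine (h1.ae_eq isOpen_interior hp.isBounded_interior
    ((hp.traceInequality hd).mono subset_rfl (hp.face_subset_frontier hF)) h2).mono fun x hx => ?_
  rw [jump, skeletonTrace, hx, sub_self]

theorem stab_skeletonTrace (hd : 1 ≤ d) (hu : IsH10 P.Ω u G) (k : ℕ) (v : E d → E d)
    (vh : Set (E d) → E d → E d) : M.stab k u (skeletonTrace P u) v vh = 0 := by
  refine Finset.sum_eq_zero fun K hK => Finset.sum_eq_zero fun F hF => ?_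
  refine integral_eq_zero_of_ae ((M.jump_skeletonTrace_ae_eq_zero hd hu hK hF).mono fun x hx => ?_)
  simp only [hx, inner_zero_left, mul_zero]
  rfl

theorem Bh_skeletonTrace (hd : 1 ≤ d) (hu : IsH10 P.Ω u G) {τ : E d → Sym d}
    (hτ : MemLp τ 2 (volume.restrict P.Ω)) :
    M.Bh τ u (skeletonTrace P u) = ∫ x in P.Ω, ⟪strainOf (fun j => G j) x, τ x⟫_ℝ := by
  have h0 : ∑ K ∈ M.elems, ∑ F ∈ M.facesOf K, faceInt F (fun x =>
      ⟪mulVec (trace (interior K) (frontier K) τ x) (outwardNormal K F),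
        jump K F u (skeletonTrace P u) x⟫_ℝ) = 0 := by
    refine Finset.sum_eq_zero fun K hK => Finset.sum_eq_zero fun F hF => ?_
    refine integral_eq_zero_of_ae
      ((M.jump_skeletonTrace_ae_eq_zero hd hu hK hF).mono fun x hx => ?_)
    simp only [hx, inner_zero_right]
    rfl
  have hi : IntegrableOn (fun x => ⟪strainOf (fun j => G j) x, τ x⟫_ℝ) P.Ω :=
    integrable_inner_of_memLp_two (memLp_strainOf fun j => Lp.memLp (G j)) hτ
  rw [Bh, h0, sub_zero, M.integral_eq_sum fun K hK => M.integrableOn_elem hi hK]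
  refine Finset.sum_congr rfl fun K hK => integral_congr_ae ?_
  refine (strain_ae_eq isOpen_interior (g := fun j => G j)
    fun j => (hu.hasWeakDeriv j).mono (M.interior_elem_subset hK)).mono fun x hx => ?_
  simp only [hx]
  exact real_inner_comm _ _

/-- Green's formula with the smooth representative of `v` on each element: the `v` part of the jump
cancels its boundary term, and what remains is `v̂` against the normal traces, which sums to zero
over the mesh. -/
theorem Bh_eq_neg_integral (hd : 1 ≤ d) {σ : L2 P.Ω (Sym d)} {w : L2 P.Ω (E d)}
    (hw : IsWeakDiv P.Ω σ w)
    (hθ : ∀ K ∈ M.elems, ∃ θ : ℝ, 1 / 2 < θ ∧ θ < 1 ∧ gagliardoSq θ (interior K) σ < ⊤)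
    {m m' : ℕ} {v : E d → E d} {vh : Set (E d) → E d → E d} (hv : M.IsPiecewisePoly m v)
    (hvh : M.IsSkeletonPoly m' vh) : M.Bh σ v vh = - ∫ x in P.Ω, ⟪w x, v x⟫_ℝ := by
  have hpoly : ∀ K ∈ M.elems, ∃ p : E d → E d, ContDiff ℝ ∞ p ∧ EqOn v p (interior K) :=
    fun K hK => hv.exists_contDiff hK
  have hvL := M.memLp_of_pieces hpoly
  choose! p hp hvp using hpoly
  have hi : IntegrableOn (fun x => ⟪w x, v x⟫_ℝ) P.Ω :=
    integrable_inner_of_memLp_two (Lp.memLp w) hvL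
  have key : ∀ K ∈ M.elems, (∫ x in interior K, ⟪σ x, strain (interior K) v x⟫_ℝ) -
      (∑ F ∈ M.facesOf K, faceInt F (fun x =>
        ⟪mulVec (trace (interior K) (frontier K) σ x) (outwardNormal K F), jump K F v vh x⟫_ℝ)) =
      (∑ F ∈ M.facesOf K, faceInt F (normalTrace σ K F (vh F))) -
        ∫ x in interior K, ⟪w x, v x⟫_ℝ := by
    intro K hK
    have hP := M.isPolytope hK
    have e1 : ∫ x in interior K, ⟪σ x, strain (interior K) v x⟫_ℝ =
        ∫ x in interior K, ⟪σ x, classicalStrain (p K) x⟫_ℝ := by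
      refine integral_congr_ae ?_
      refine (strain_ae_eq isOpen_interior fun j => hasWeakDeriv_of_contDiff
        isOpen_interior.measurableSet hP.isBounded_interior (hp K hK) (hvp K hK) j).mono
        fun x hx => ?_
      simp only [hx]
      rfl
    have e2 : ∫ x in interior K, ⟪w x, v x⟫_ℝ = ∫ x in interior K, ⟪w x, p K x⟫_ℝ :=
      setIntegral_congr_fun isOpen_interior.measurableSet fun x hx => by simp only [hvp K hK hx]
    have htr := hP.hasTrace_trace_ae_eq hd (hasTrace_of_contDiff isOpen_interior.measurableSet
      hP.isBounded_frontier isClosed_frontier.measurableSet (hP.frontier_surf_lt_top hd).ne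
      (hp K hK) (hvp K hK))
    have e3 : ∀ F ∈ M.facesOf K, faceInt F (fun x =>
        ⟪mulVec (trace (interior K) (frontier K) σ x) (outwardNormal K F), jump K F v vh x⟫_ℝ) =
        faceInt F (normalTrace σ K F (p K)) - faceInt F (normalTrace σ K F (vh F)) := by
      intro F hF
      obtain ⟨q, hq, hqF⟩ : ∃ q : E d → E d, ContDiff ℝ ∞ q ∧ EqOn (vh F) q F :=
        hvh.exists_contDiff (M.mem_facesOf.1 hF).1
      have i1 := M.integrable_normalTrace hd hK hF (hθ K hK) (hp K hK).continuous
      have i2 : IntegrableOn (normalTrace σ K F (vh F)) F (surf d) :=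
        (M.integrable_normalTrace hd hK hF (hθ K hK) hq.continuous).congr_fun
          (fun x hx => by simp only [normalTrace, hqF hx]) (hP.face_closed F hF).measurableSet
      unfold faceInt
      rw [← integral_sub i1 i2]
      have htF : ∀ᵐ x ∂((surf d).restrict F), trace (interior K) (frontier K) v x = p K x :=
        ae_mono (Measure.restrict_mono (hP.face_subset_frontier hF) le_rfl) htr
      refine integral_congr_ae (htF.mono fun x hx => ?_)
      simp only [jump, normalTrace]
      rw [hx, inner_sub_right]
    rw [Finset.sum_congr rfl e3, Finset.sum_sub_distrib, ← M.green hd hw hK (hθ K hK) (hp K hK),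
      e1, e2]
    ring
  rw [Bh, ← Finset.sum_sub_distrib, Finset.sum_congr rfl key, Finset.sum_sub_distrib,
    M.sum_normalTrace_skeleton hd hw hθ hvh, zero_sub,
    M.integral_eq_sum fun K hK => M.integrableOn_elem hi hK]

theorem innerT_eq_integral {f v : E d → E d} (hf : MemLp f 2 (volume.restrict P.Ω))
    (hv : MemLp v 2 (volume.restrict P.Ω)) : M.innerT f v = ∫ x in P.Ω, ⟪f x, v x⟫_ℝ := by
  have hi : IntegrableOn (fun x => ⟪f x, v x⟫_ℝ) P.Ω := integrable_inner_of_memLp_two hf hv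
  rw [M.integral_eq_sum fun K hK => M.integrableOn_elem hi hK]
  rfl

theorem memLp_ρ_smul (P : Model d) {f : E d → E d} (hf : MemLp f 2 (volume.restrict P.Ω)) :
    MemLp (fun x => P.ρ x • f x) 2 (volume.restrict P.Ω) := by
  have hm : Measurable P.ρ :=
    Measurable.ite P.lip_s.1.measurableSet measurable_const measurable_const
  refine MemLp.of_le_mul hf (c := max P.ρs P.ρf) (hm.aestronglyMeasurable.smul hf.1)
    (ae_of_all _ fun x => ?_)
  rw [norm_smul]
  gcongr
  rw [Model.ρ]
  split_ifs
  · rw [Real.norm_of_nonneg P.ρs_pos.le]; exact le_max_left _ _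
  · rw [Real.norm_of_nonneg P.ρf_pos.le]; exact le_max_right _ _

/-- The stress terms and `B_h(τ, i(u))` both equal `(ε(u), τ)` and cancel; `B_h(σ, v)` supplies the
divergence term of the momentum equation, in which `v` is admissible because it is square
integrable. -/
theorem satisfiesHDG (hd : 1 ≤ d) (k : ℕ) {F u' w : L2 P.Ω (E d)} {σ' σ : L2 P.Ω (Sym d)}
    (hu : IsH10 P.Ω u G) (hw : IsWeakDiv P.Ω σ w)
    (hθ : ∀ K ∈ M.elems, ∃ θ : ℝ, 1 / 2 < θ ∧ θ < 1 ∧ gagliardoSq θ (interior K) σ < ⊤)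
    (hmom : ∀ v : L2 P.Ω (E d), (∫ x in P.Ω, P.ρ x * ⟪u' x, v x⟫_ℝ) - ∫ x in P.Ω, ⟪w x, v x⟫_ℝ
      = ∫ x in P.Ω, ⟪F x, v x⟫_ℝ)
    (hcon : ∀ (τ : L2 P.Ω (Sym d)) (w : L2 P.Ω (E d)), IsWeakDiv P.Ω τ w →
      P.stressForm σ' σ τ + ∫ x in P.Ω, ⟪u x, w x⟫_ℝ = 0) :
    M.SatisfiesHDG k F u' σ' σ u (skeletonTrace P u) := by
  intro τ hτ v vh hv hvh
  have hτL : MemLp τ 2 (volume.restrict P.Ω) :=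
    M.memLp_of_pieces fun K hK => hτ.exists_contDiff hK
  have hvL : MemLp v 2 (volume.restrict P.Ω) :=
    M.memLp_of_pieces fun K hK => hv.exists_contDiff hK
  have hae := ae_eq_union M
  have e1 : P.stressForm σ' σ τ = ∫ x in P.Ω, ⟪strainOf (fun j => G j) x, τ x⟫_ℝ := by
    rw [P.stressForm_eq hae (Lp.memLp σ') (Lp.memLp σ) hτL]
    refine integral_congr_ae ((P.compliance_ae_eq hae (g := fun j => G j)
      (fun j => hu.hasWeakDeriv j) hcon).mono fun x hx => ?_)
    simp only [hx]
  have e2 := hmom (hvL.toLp v)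
  have c : ∀ f : E d → E d → ℝ, ∫ x in P.Ω, f x (hvL.toLp v x) = ∫ x in P.Ω, f x (v x) :=
    fun f => integral_congr_ae (hvL.coeFn_toLp.mono fun x hx => by simp only [hx])
  rw [c fun x y => P.ρ x * ⟪u' x, y⟫_ℝ, c fun x y => ⟪w x, y⟫_ℝ, c fun x y => ⟪F x, y⟫_ℝ] at e2
  rw [M.stab_skeletonTrace hd hu, M.Bh_skeletonTrace hd hu hτL,
    M.Bh_eq_neg_integral hd hw hθ hv hvh, e1,
    M.innerT_eq_integral (memLp_ρ_smul P (Lp.memLp u')) hvL,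
    M.innerT_eq_integral (Lp.memLp F) hvL, ← e2]
  simp_rw [real_inner_smul_left]
  ring

end Mesh

end HDG
end

/-! ### The theorem, at almost every time. -/

theorem mainTheorem5 {d : ℕ} (hd : d = 2 ∨ d = 3) (P : HDG.Model d) (M : HDG.Mesh P)
    (T : ℝ) (hT : 0 < T)
    (F : ℝ → HDG.L2 P.Ω (HDG.E d)) (u0 : HDG.L2 P.Ω (HDG.E d)) (σ0 : HDG.L2 P.Ωs (HDG.Sym d))
    (u u' : ℝ → HDG.L2 P.Ω (HDG.E d)) (σ σ' : ℝ → HDG.L2 P.Ω (HDG.Sym d))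
    (hsol : P.IsSolution T F u0 σ0 u u' σ σ')
    (s : ℝ) (hs : 1 / 2 < s) (hreg : M.IsContHsHdiv T s σ) (k : ℕ) :
    ∀ᵐ t ∂(volume.restrict (Ioo 0 T)),
      M.WellDefined (σ t) (u t) ∧
      M.SatisfiesHDG k (F t) (u' t) (σ' t) (σ t) (u t) (HDG.Mesh.skeletonTrace P (u t)) := by
  have hd1 : 1 ≤ d := by omega
  obtain ⟨-, hsob, w, -, hw⟩ := hreg
  obtain ⟨-, G, -, hG⟩ := hsol.u_space
  filter_upwards [hG, hsol.momentum, hsol.constitutive, ae_restrict_mem measurableSet_Ioo]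
    with t hu hmom hcon ht
  have ht' : t ∈ Icc 0 T := Ioo_subset_Icc_self ht
  -- From the regularity in `H^s` only some exponent strictly between `1/2` and `1` is kept, which
  -- is all that the traces and Green's formula require.
  have hθ : ∀ K ∈ M.elems, ∃ θ : ℝ, 1 / 2 < θ ∧ θ < 1 ∧
      HDG.gagliardoSq θ (interior K) (σ t) < ⊤ := fun K hK =>
    HDG.exists_gagliardoSq_lt_top_of_sobolevSq hd1 isOpen_interior
      (M.isPolytope hK).isBounded_interior (M.isPolytope hK).convex.interior
      (M.isPolytope hK).nonempty hs (hsob K hK t ht').1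
  exact ⟨M.wellDefined hd1 hu hθ,
    M.satisfiesHDG hd1 k hu (hw t ht') hθ (hmom (w t) (hw t ht')) hcon⟩
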